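/- **Proposition.** Let $k$ be a field and let $A$ be a finite-dimensional unital associative $k$-algebra which is self-injective, i.e. $A$ is injective as a left $A$-module. Write $\otimes=\otimes_k$, $\overline{A}=A/(k\cdot 1)$, and $\overline a$ for the class of $a\in A$. *Forms.* For $p\ge 0$ let $\Omega^p(A)=A\otimes\overline A^{\otimes p}$, placed in degree $-p$, with the $A$-bimodule structure in which $A$ acts on the left by multiplication on the first factor and on the right by $$(a_0\otimes\overline{a_1}\otimes\cdots\otimes\overline{a_p})\blacktriangleleft a_{p+1}=(-1)^p\,a_0a_1\otimes\overline{a_2}\otimes\cdots\otimes\overline{a_{p+1}}+\sum_{i=1}^{p}(-1)^{p-i}a_0\otimes\overline{a_1}\otimes\cdots\otimes\overline{a_ia_{i+1}}\otimes\cdots\otimes\overline{a_{p+1}}$$ (for $p=0$ this is $a_0a_1$). *Cochains.* For $m\in\mathbb Z$ let $C^m(A,\Omega^p(A))=\operatorname{Hom}_k(\overline A^{\otimes (m+p)},\Omega^p(A))$, which is $0$ if $m+p<0$, with differential $\delta^m:C^m\to C^{m+1}$ given, with $n=m+p\ge 0$, by $$(-1)^{m+1}\delta^m(f)(\overline{a_1}\otimes\cdots\otimes\overline{a_{n+1}})=a_1f(\overline{a_2}\otimes\cdots\otimes\overline{a_{n+1}})+\sum_{j=1}^{n}(-1)^jf(\overline{a_1}\otimes\cdots\otimes\overline{a_ja_{j+1}}\otimes\cdots\otimes\overline{a_{n+1}})+(-1)^{n+1}f(\overline{a_1}\otimes\cdots\otimes\overline{a_n})\blacktriangleleft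 a_{n+1}.$$ In particular $C^*(A,A)=C^*(A,\Omega^0(A))$ is the normalized Hochschild cochain complex. The maps $\theta_p:C^*(A,\Omega^p(A))\to C^*(A,\Omega^{p+1}(A))$, $f\mapsto f\otimes\operatorname{id}_{\overline A}$, are morphisms of complexes, and the singular Hochschild cochain complex is $$C^*_{\mathrm{sg}}(A,A)=\varinjlim_{\theta_p}C^*(A,\Omega^p(A)).$$ *Chains.* Let $A^\vee=\operatorname{Hom}_{A\otimes A^{\mathrm{op}}}(A,A\otimes A^{\mathrm{op}})$, identified by $\alpha\mapsto\alpha(1)$ with $\{\sum_j x_j\otimes y_j\in A\otimes A:\ \sum_j ax_j\otimes y_j=\sum_j x_j\otimes y_ja\ \text{ for all } a\in A\}$, an $A$-bimodule via $a\,(\sum_j x_j\otimes y_j)\,b=\sum_j x_jb\otimes ay_j$. Let $C_p(A,A^\vee)=A^\vee\otimes\overline A^{\otimes p}$ for $p\ge 0$, with the Hochschild boundary $$b(z\otimes\overline{a_1}\otimes\cdots\otimes\overline{a_p})=za_1\otimes\overline{a_2}\otimes\cdots\otimes\overline{a_p}+\sum_{j=1}^{p-1}(-1)^jz\otimes\overline{a_1}\otimes\cdots\otimes\overline{a_ja_{j+1}}\otimes\cdots\otimes\overline{a_p}+(-1)^pa_pz\otimes\overline{a_1}\otimes\cdots\otimes\overline{a_{p-1}}.$$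 *Generalized Tate–Hochschild complex.* Let $\mathcal D^*(A,A)$ be the complex $$\cdots\xrightarrow{b}C_1(A,A^\vee)\xrightarrow{b}C_0(A,A^\vee)=A^\vee\xrightarrow{\mu}A=C^0(A,A)\xrightarrow{\delta}C^1(A,A)\xrightarrow{\delta}\cdots,$$ with $C^i(A,A)$ in degree $i\ge 0$, $C_p(A,A^\vee)$ in degree $-p-1$, and $\mu(\sum_j x_j\otimes y_j)=\sum_j x_jy_j$. *The map $\iota^*$.* Let $\iota^*:\mathcal D^*(A,A)\to C^*_{\mathrm{sg}}(A,A)$ be the morphism of complexes which, in degree $i\ge 0$, is the structure map $C^i(A,A)=C^i(A,\Omega^0(A))\to C^i_{\mathrm{sg}}(A,A)$ and, in degree $-p-1$ with $p\ge 0$, sends $$\Big(\sum_j x_j\otimes y_j\Big)\otimes\overline{a_1}\otimes\cdots\otimes\overline{a_p}$$ to the class of $$\sum_j x_j\otimes\overline{a_1}\otimes\cdots\otimes\overline{a_p}\otimes\overline{y_j}\ \in\ \Omega^{p+1}(A)=C^{-p-1}(A,\Omega^{p+1}(A)).$$ Then $\iota^*$ is a quasi-isomorphism. Moreover, if $\dim_kA\ne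 1$, then $\iota^i$ is injective for every $i\in\mathbb Z$. -/

import Mathlib

namespace TateHochschild

open scoped TensorProduct

universe u v w

section Bar

variable (k : Type u) (A : Type v) [Field k] [Ring A] [Algebra k A]

/-- The quotient `k`-module `Ā = A / (k · 1)`. -/
abbrev RedAlg : Type v := A ⧸ Submodule.span k {(1 : A)}

/-- The canonical projection `A → Ā`, `a ↦ ā`. -/
def red : A →ₗ[k] RedAlg k A := Submodule.mkQ (Submodule.span k {(1 : A)})

/-- The tensor power `Ā ⊗ ⋯ ⊗ Ā` (`n` factors, over `k`). -/
abbrev RedPow (n : ℕ) : Type (max u v) := ⨂[k]^n (RedAlg k A)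

lemma red_one : red k A 1 = 0 :=
  (Submodule.Quotient.mk_eq_zero _).2 (Submodule.mem_span_singleton_self _)

/-- Concatenation `Ā^{⊗n} ⊗ Ā ≅ Ā^{⊗(n+1)}`, putting the new factor on the right. -/
noncomputable def snocEquiv (n : ℕ) :
    RedPow k A n ⊗[k] RedAlg k A ≃ₗ[k] RedPow k A (n + 1) :=
  (LinearEquiv.lTensor (RedPow k A n)
    (PiTensorProduct.subsingletonEquiv (R := k) (s := fun _ : Fin 1 => RedAlg k A) 0).symm) ≪≫ₗ
    TensorPower.mulEquiv

lemma snocEquiv_tprod (n : ℕ) (a : Fin n → RedAlg k A) (b : RedAlg k A) :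
    snocEquiv k A n (PiTensorProduct.tprod k a ⊗ₜ b) =
      PiTensorProduct.tprod k (Fin.snoc a b : Fin (n + 1) → RedAlg k A) := by
  have h := TensorPower.tprod_mul_tprod k a (fun _ : Fin 1 => b)
  rw [TensorPower.gMul_def] at h
  simp only [snocEquiv, LinearEquiv.trans_apply, LinearEquiv.lTensor_tmul,
    PiTensorProduct.subsingletonEquiv_symm_apply']
  rw [h, Fin.append_right_eq_snoc]

variable {k A}

/-- A bilinear map `W × A → N` vanishing on `W × {1}` induces a linear map `W ⊗ Ā → N`. -/
noncomputable def descend {W N : Type*} [AddCommGroup W] [Module k W] [AddCommGroup N]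
    [Module k N] (B : W →ₗ[k] A →ₗ[k] N) (h : ∀ w, B w 1 = 0) : W ⊗[k] RedAlg k A →ₗ[k] N :=
  TensorProduct.lift (Submodule.liftQ (Submodule.span k {(1 : A)}) B.flip (by
    rw [Submodule.span_singleton_le_iff_mem, LinearMap.mem_ker]
    ext w
    exact h w)).flip

@[simp]
lemma descend_tmul {W N : Type*} [AddCommGroup W] [Module k W] [AddCommGroup N]
    [Module k N] (B : W →ₗ[k] A →ₗ[k] N) (h : ∀ w, B w 1 = 0) (x : W) (a : A) :
    descend B h (x ⊗ₜ red k A a) = B x a := rfl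

/-- Linear maps out of `W ⊗ Ā` are determined by their values on the `w ⊗ ā`. -/
lemma ext_red {W N : Type*} [AddCommGroup W] [Module k W] [AddCommGroup N]
    [Module k N] {f g : W ⊗[k] RedAlg k A →ₗ[k] N}
    (h : ∀ (x : W) (a : A), f (x ⊗ₜ red k A a) = g (x ⊗ₜ red k A a)) : f = g := by
  apply TensorProduct.ext'
  intro x y
  obtain ⟨a, rfl⟩ := Submodule.mkQ_surjective _ y
  exact h x a

/-- Linear maps out of `Ā^{⊗(n+1)}` are determined by their values on the `t ⊗ ā`. -/
lemma ext_snoc {n : ℕ} {N : Type*} [AddCommGroup N] [Module k N]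
    {f g : RedPow k A (n + 1) →ₗ[k] N}
    (h : ∀ t a, f (snocEquiv k A n (t ⊗ₜ red k A a)) = g (snocEquiv k A n (t ⊗ₜ red k A a))) :
    f = g := by
  have : f ∘ₗ (snocEquiv k A n).toLinearMap = g ∘ₗ (snocEquiv k A n).toLinearMap :=
    ext_red (fun x a => h x a)
  ext1
  ext t
  have := LinearMap.congr_fun this ((snocEquiv k A n).symm (PiTensorProduct.tprod k t))
  simpa using this

end Bar

section Words

variable (k : Type u) (A : Type v) [Field k] [Ring A] [Algebra k A]
variable (M : Type w) [AddCommGroup M] [Module k M]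

/-- Concatenation `(M ⊗ Ā^{⊗n}) ⊗ Ā ≅ M ⊗ Ā^{⊗(n+1)}`. -/
noncomputable def catEquiv (n : ℕ) :
    (M ⊗[k] RedPow k A n) ⊗[k] RedAlg k A ≃ₗ[k] M ⊗[k] RedPow k A (n + 1) :=
  TensorProduct.assoc k M (RedPow k A n) (RedAlg k A) ≪≫ₗ LinearEquiv.lTensor M (snocEquiv k A n)

lemma catEquiv_tmul (n : ℕ) (m : M) (t : RedPow k A n) (a : RedAlg k A) :
    catEquiv k A M n ((m ⊗ₜ t) ⊗ₜ a) = m ⊗ₜ snocEquiv k A n (t ⊗ₜ a) := by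
  simp [catEquiv]

variable {k A M}

/-- Induction on `M ⊗ Ā^{⊗(n+1)}`: linear maps agree if they agree on `ω ⊗ ā`. -/
lemma ext_cat {n : ℕ} {N : Type*} [AddCommGroup N] [Module k N]
    {f g : M ⊗[k] RedPow k A (n + 1) →ₗ[k] N}
    (h : ∀ x a, f (catEquiv k A M n (x ⊗ₜ red k A a)) = g (catEquiv k A M n (x ⊗ₜ red k A a))) :
    f = g := by
  have : f ∘ₗ (catEquiv k A M n).toLinearMap = g ∘ₗ (catEquiv k A M n).toLinearMap :=
    ext_red h
  ext1
  ext m t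
  have := LinearMap.congr_fun this ((catEquiv k A M n).symm (m ⊗ₜ PiTensorProduct.tprod k t))
  simpa using this

variable (k A M)

variable [Module Aᵐᵒᵖ M] [IsScalarTower k Aᵐᵒᵖ M]

/-- Right multiplication on a right `A`-module: `a ↦ (m ↦ m a)`. -/
noncomputable def rmul : A →ₗ[k] Module.End k M :=
  (Algebra.lsmul k k M).toLinearMap ∘ₗ (MulOpposite.opLinearEquiv k).toLinearMap

@[simp]
lemma rmul_apply (a : A) (m : M) : rmul k A M a m = MulOpposite.op a • m := rfl

/-- The recursion step for the right action. -/
noncomputable def rActStep (n : ℕ)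
    (R : { R : A →ₗ[k] Module.End k (M ⊗[k] RedPow k A n) // R 1 = LinearMap.id }) (b : A) :
    (M ⊗[k] RedPow k A n) ⊗[k] RedAlg k A →ₗ[k] (M ⊗[k] RedPow k A n) ⊗[k] RedAlg k A :=
  descend
    (LinearMap.mk₂ k (fun x a => x ⊗ₜ[k] red k A (a * b) - R.1 a x ⊗ₜ[k] red k A b)
      (by intro x y a; simp only [TensorProduct.add_tmul, map_add]; abel)
      (by intro c x a; simp only [TensorProduct.smul_tmul', map_smul, smul_sub])
      (by intro x a a'; simp only [add_mul, map_add, LinearMap.add_apply,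
            TensorProduct.tmul_add, TensorProduct.add_tmul]; abel)
      (by intro c x a; simp only [smul_mul_assoc, map_smul, LinearMap.smul_apply,
            TensorProduct.tmul_smul, TensorProduct.smul_tmul', smul_sub]))
    (by intro x; simp [R.2])

/-- The right action `◀` of `A` on `M ⊗ Ā^{⊗n}`, for a right `A`-module `M`, given by
`(m ⊗ ā₁ ⊗ ⋯ ⊗ āₙ) ◀ b = ∑ᵢ (-1)^(n-i) (contract the i-th product in the word m a₁ ⋯ aₙ b)`
(see `rAct_tprod` below). It is constructed by the recursion
`(ω ⊗ ā) ◀ b = ω ⊗ (ab)‾ - (ω ◀ a) ⊗ b̄`, that is `(ω da) b = ω d(ab) - ω a db`. -/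
noncomputable def rActAux :
    (n : ℕ) → { R : A →ₗ[k] Module.End k (M ⊗[k] RedPow k A n) // R 1 = LinearMap.id }
  | 0 => ⟨(LinearMap.rTensorHom (RedPow k A 0)) ∘ₗ rmul k A M, by
      apply TensorProduct.ext'
      intro m t
      simp⟩
  | n + 1 =>
    ⟨{ toFun := fun b => (catEquiv k A M n).conj (rActStep k A M n (rActAux n) b)
       map_add' := by
        intro b b'
        rw [← map_add]
        congr 1
        apply ext_red
        intro x a
        simp only [rActStep, descend_tmul, LinearMap.mk₂_apply, LinearMap.add_apply, mul_add,
          map_add, TensorProduct.tmul_add]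
        abel
       map_smul' := by
        intro c b
        rw [RingHom.id_apply, ← map_smul]
        congr 1
        apply ext_red
        intro x a
        simp only [rActStep, descend_tmul, LinearMap.mk₂_apply, LinearMap.smul_apply,
          mul_smul_comm, map_smul, TensorProduct.tmul_smul, smul_sub] },
      by
        have : rActStep k A M n (rActAux n) 1 = LinearMap.id := by
          apply ext_red
          intro x a
          simp [rActStep, red_one]
        simp only [LinearMap.coe_mk, AddHom.coe_mk, this]
        exact LinearEquiv.conj_id _⟩

/-- The right action `ω ↦ ω ◀ a` on `M ⊗ Ā^{⊗n}`. -/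
noncomputable def rAct (n : ℕ) : A →ₗ[k] Module.End k (M ⊗[k] RedPow k A n) := (rActAux k A M n).1

lemma rAct_one (n : ℕ) (x : M ⊗[k] RedPow k A n) : rAct k A M n 1 x = x := by
  rw [rAct, (rActAux k A M n).2, LinearMap.id_apply]

lemma rAct_zero_tmul (a : A) (m : M) (t : RedPow k A 0) :
    rAct k A M 0 a (m ⊗ₜ t) = (MulOpposite.op a • m) ⊗ₜ t := rfl

lemma rAct_cat (n : ℕ) (b : A) (x : M ⊗[k] RedPow k A n) (a : A) :
    rAct k A M (n + 1) b (catEquiv k A M n (x ⊗ₜ red k A a)) =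
      catEquiv k A M n (x ⊗ₜ red k A (a * b)) -
        catEquiv k A M n (rAct k A M n a x ⊗ₜ red k A b) := by
  change (catEquiv k A M n).conj (rActStep k A M n (rActAux k A M n) b) _ = _
  rw [LinearEquiv.conj_apply_apply, LinearEquiv.symm_apply_apply, rActStep, descend_tmul,
    LinearMap.mk₂_apply, map_sub]
  rfl

lemma rAct_mul (n : ℕ) (a b : A) :
    rAct k A M n (a * b) = rAct k A M n b ∘ₗ rAct k A M n a := by
  induction n generalizing a b with
  | zero =>
    apply TensorProduct.ext'
    intro m t
    simp only [LinearMap.comp_apply, rAct_zero_tmul, MulOpposite.op_mul, mul_smul]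
  | succ n ih =>
    apply ext_cat
    intro x c
    simp only [LinearMap.comp_apply, rAct_cat, map_sub, mul_assoc, ih c a]
    abel

/-- A `k`-linear endomorphism of `M` commuting with the right action induces one of
`M ⊗ Ā^{⊗n}` commuting with `◀`. -/
lemma rTensor_rAct {N : Type*} [AddCommGroup N] [Module k N] [Module Aᵐᵒᵖ N]
    [IsScalarTower k Aᵐᵒᵖ N] (f : M →ₗ[k] N)
    (hf : ∀ (a : A) m, f (MulOpposite.op a • m) = MulOpposite.op a • f m) (n : ℕ) (a : A)
    (x : M ⊗[k] RedPow k A n) :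
    f.rTensor _ (rAct k A M n a x) = rAct k A N n a (f.rTensor _ x) := by
  induction n generalizing a with
  | zero =>
    induction x with
    | zero => simp
    | tmul m t => simp only [rAct_zero_tmul, LinearMap.rTensor_tmul, hf]
    | add x y hx hy => simp only [map_add, hx, hy]
  | succ n ih =>
    have key : ∀ (y : (M ⊗[k] RedPow k A n) ⊗[k] RedAlg k A),
        f.rTensor _ (catEquiv k A M n y) =
          catEquiv k A N n ((f.rTensor (RedPow k A n)).rTensor _ y) := by
      intro y
      induction y with
      | zero => simp
      | add x y hx hy => simp only [map_add, hx, hy]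
      | tmul x b =>
        induction x with
        | zero => simp
        | add x y hx hy => simp only [TensorProduct.add_tmul, map_add, hx, hy]
        | tmul m t => simp only [catEquiv_tmul, LinearMap.rTensor_tmul]
    have : f.rTensor _ ∘ₗ rAct k A M (n + 1) a = rAct k A N (n + 1) a ∘ₗ f.rTensor _ := by
      apply ext_cat
      intro x c
      simp only [LinearMap.comp_apply, rAct_cat, map_sub, key, LinearMap.rTensor_tmul, ih]
    exact LinearMap.congr_fun this x

/-- Explicit formula for the right action. With `w = (a₁, …, aₙ, b)`, the first summand is
`± m w₁ ⊗ w̄₂ ⊗ ⋯`, and in the others two neighbouring entries of `w` are multiplied. -/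
lemma rAct_tprod (n : ℕ) (m : M) (a : Fin n → A) (b : A) :
    rAct k A M n b (m ⊗ₜ PiTensorProduct.tprod k (fun i => red k A (a i))) =
      (-1 : k) ^ n • ((MulOpposite.op ((Fin.snoc a b : Fin (n + 1) → A) 0) • m) ⊗ₜ
        PiTensorProduct.tprod k
          (fun i : Fin n => red k A ((Fin.snoc a b : Fin (n + 1) → A) i.succ))) +
      ∑ j : Fin n, (-1 : k) ^ (n - 1 - (j : ℕ)) • (m ⊗ₜ PiTensorProduct.tprod k
        (fun i => red k A (Fin.contractNth j.castSucc (· * ·)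
          (Fin.snoc a b : Fin (n + 1) → A) i))) := by
  induction n generalizing b with
  | zero =>
    simp only [rAct_zero_tmul, pow_zero, one_smul, Finset.univ_eq_empty, Finset.sum_empty, add_zero]
    congr 2
    ext i
    exact i.elim0
  | succ n ih =>
    have hsnoc : ∀ (x : Fin n → A) (y : A), (fun i => red k A ((Fin.snoc x y : Fin (n + 1) → A) i)) =
        (Fin.snoc (fun i => red k A (x i)) (red k A y) : Fin (n + 1) → RedAlg k A) := by
      intro x y
      ext i
      refine Fin.lastCases ?_ (fun i => ?_) i <;> simp
    have hcat : ∀ (m : M) (x : Fin n → A) (y : A), m ⊗ₜ[k] PiTensorProduct.tprod k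
        (fun i => red k A ((Fin.snoc x y : Fin (n + 1) → A) i)) =
        catEquiv k A M n ((m ⊗ₜ PiTensorProduct.tprod k (fun i => red k A (x i))) ⊗ₜ red k A y) := by
      intro m x y
      rw [catEquiv_tmul, snocEquiv_tprod, hsnoc]
    obtain ⟨a, c, rfl⟩ : ∃ (a' : Fin n → A) (c : A), a = Fin.snoc a' c :=
      ⟨Fin.init a, a (Fin.last n), (Fin.snoc_init_self a).symm⟩
    rw [hcat, rAct_cat, ih, Fin.sum_univ_castSucc]
    have h1 : ∀ j : Fin n, (Fin.contractNth j.castSucc.castSucc (· * ·)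
        (Fin.snoc (Fin.snoc a c : Fin (n + 1) → A) b : Fin (n + 2) → A)) =
        Fin.snoc (Fin.contractNth j.castSucc (· * ·) (Fin.snoc a c : Fin (n + 1) → A)) b := by
      intro j
      ext i
      refine Fin.lastCases ?_ (fun i => ?_) i
      · rw [Fin.contractNth_apply_of_gt _ _ _ _ (by simp)]
        simp
      · simp only [Fin.snoc_castSucc]
        rcases lt_trichotomy (i : ℕ) j with h | h | h
        · rw [Fin.contractNth_apply_of_lt _ _ _ _ (by simpa using h),
            Fin.contractNth_apply_of_lt _ _ _ _ (by simpa using h), Fin.snoc_castSucc]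
        · rw [Fin.contractNth_apply_of_eq _ _ _ _ (by simpa using h),
            Fin.contractNth_apply_of_eq _ _ _ _ (by simpa using h), ← Fin.castSucc_succ]
          simp only [Fin.snoc_castSucc]
        · rw [Fin.contractNth_apply_of_gt _ _ _ _ (by simpa using h),
            Fin.contractNth_apply_of_gt _ _ _ _ (by simpa using h),
            ← Fin.castSucc_succ, Fin.snoc_castSucc]
    have h2 : (Fin.contractNth (Fin.last n).castSucc (· * ·)
        (Fin.snoc (Fin.snoc a c : Fin (n + 1) → A) b : Fin (n + 2) → A)) = Fin.snoc a (c * b) := by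
      ext i
      refine Fin.lastCases ?_ (fun i => ?_) i
      · rw [Fin.contractNth_apply_of_eq _ _ _ _ (by simp), Fin.snoc_castSucc, Fin.succ_last]
        simp
      · rw [Fin.contractNth_apply_of_lt _ _ _ _ (by simp)]
        simp
    have h3 : (fun i : Fin (n + 1) =>
        (Fin.snoc (Fin.snoc a c : Fin (n + 1) → A) b : Fin (n + 2) → A) i.succ) =
        Fin.snoc (fun i : Fin n => (Fin.snoc a c : Fin (n + 1) → A) i.succ) b := by
      ext i
      refine Fin.lastCases ?_ (fun i => ?_) i
      · rw [Fin.succ_last]; simp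
      · rw [← Fin.castSucc_succ]; simp only [Fin.snoc_castSucc]
    have h4 : (Fin.snoc (Fin.snoc a c : Fin (n + 1) → A) b : Fin (n + 2) → A) 0 =
        (Fin.snoc a c : Fin (n + 1) → A) 0 := by
      rw [← Fin.castSucc_zero, Fin.snoc_castSucc]
    have h3' : ∀ i : Fin (n + 1),
        (Fin.snoc (Fin.snoc a c : Fin (n + 1) → A) b : Fin (n + 2) → A) i.succ =
        (Fin.snoc (fun i : Fin n => (Fin.snoc a c : Fin (n + 1) → A) i.succ) b :
          Fin (n + 1) → A) i := fun i => congrFun h3 i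
    simp only [h1, h2, h3', h4, hcat, TensorProduct.add_tmul, TensorProduct.sum_tmul,
      ← TensorProduct.smul_tmul', map_add, map_sum, map_smul]
    have h5 : ∀ j : Fin n, (-1 : k) ^ (n + 1 - 1 - (j.castSucc : ℕ)) =
        - (-1 : k) ^ (n - 1 - (j : ℕ)) := by
      intro j
      have : n + 1 - 1 - (j.castSucc : ℕ) = (n - 1 - (j : ℕ)) + 1 := by
        have := j.2
        simp only [Fin.val_castSucc]
        omega
      rw [this, pow_succ, mul_neg_one]
    simp only [h5, neg_smul, Finset.sum_neg_distrib, pow_succ, mul_neg_one]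
    simp
    abel

end Words


section Complexes

variable (k : Type u) (A : Type v) [Field k] [Ring A] [Algebra k A]

/-- `M ⊗ Ā^{⊗n}`, viewed as an `A`-bimodule: on the left `A` acts through `M`, and on the right it
acts by `◀`. -/
def Word (M : Type w) [AddCommGroup M] [Module k M] (n : ℕ) : Type (max u v w) :=
  M ⊗[k] RedPow k A n

/-- The bimodule `Ω^p(A) = A ⊗ Ā^{⊗p}` of noncommutative differential forms of degree `p`. -/
abbrev Forms (p : ℕ) : Type (max u v) := Word k A A p

section

variable (M : Type w) [AddCommGroup M] [Module k M] (n : ℕ)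

noncomputable instance : AddCommGroup (Word k A M n) :=
  inferInstanceAs (AddCommGroup (M ⊗[k] RedPow k A n))

noncomputable instance : Module k (Word k A M n) :=
  inferInstanceAs (Module k (M ⊗[k] RedPow k A n))

noncomputable instance [Module A M] [IsScalarTower k A M] : Module A (Word k A M n) :=
  inferInstanceAs (Module A (M ⊗[k] RedPow k A n))

instance [Module A M] [IsScalarTower k A M] : IsScalarTower k A (Word k A M n) :=
  inferInstanceAs (IsScalarTower k A (M ⊗[k] RedPow k A n))

variable [Module Aᵐᵒᵖ M] [IsScalarTower k Aᵐᵒᵖ M]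

noncomputable instance : Module Aᵐᵒᵖ (Word k A M n) where
  smul a x := rAct k A M n a.unop x
  one_smul x := rAct_one k A M n x
  mul_smul a b x := LinearMap.congr_fun (rAct_mul k A M n b.unop a.unop) x
  smul_zero _ := map_zero _
  smul_add _ := map_add _
  add_smul a b x := LinearMap.congr_fun (map_add (rAct k A M n) a.unop b.unop) x
  zero_smul x := LinearMap.congr_fun (map_zero (rAct k A M n)) x

instance : IsScalarTower k Aᵐᵒᵖ (Word k A M n) where
  smul_assoc c a x := LinearMap.congr_fun (map_smul (rAct k A M n) c a.unop) x

instance [Module A M] [IsScalarTower k A M] [SMulCommClass A Aᵐᵒᵖ M] :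
    SMulCommClass A Aᵐᵒᵖ (Word k A M n) where
  smul_comm a b x := rTensor_rAct k A M (Algebra.lsmul k k M a)
    (fun c m => smul_comm a (MulOpposite.op c) m) n b.unop x

end

section Cochains

variable (M : Type w) [AddCommGroup M] [Module k M] [Module A M] [IsScalarTower k A M]

variable {k A M} in
/-- The left `A`-linear extension `A ⊗ Ā^{⊗n} → M`, `a ⊗ t ↦ a f(t)`, of a cochain `f`. -/
noncomputable def leftExt {n : ℕ} (f : RedPow k A n →ₗ[k] M) : A ⊗[k] RedPow k A n →ₗ[k] M :=
  TensorProduct.lift ((Algebra.lsmul k k M).toLinearMap.compl₂ f)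

variable {k A M} in
@[simp]
lemma leftExt_tmul {n : ℕ} (f : RedPow k A n →ₗ[k] M) (a : A) (t : RedPow k A n) :
    leftExt f (a ⊗ₜ t) = a • f t := rfl

variable {k A M} in
lemma leftExt_smul {n : ℕ} (f : RedPow k A n →ₗ[k] M) (a : A) (x : A ⊗[k] RedPow k A n) :
    leftExt f (a • x) = a • leftExt f x := by
  induction x with
  | zero => simp
  | tmul b t => simp [TensorProduct.smul_tmul', mul_smul]
  | add x y hx hy => simp only [smul_add, map_add, hx, hy]

lemma smul_catEquiv (n : ℕ) (a : A) (x : M ⊗[k] RedPow k A n) (v : RedAlg k A) :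
    a • catEquiv k A M n (x ⊗ₜ v) = catEquiv k A M n ((a • x) ⊗ₜ v) := by
  induction x with
  | zero => simp
  | add x y hx hy => simp only [TensorProduct.add_tmul, map_add, smul_add, hx, hy]
  | tmul m t => simp only [catEquiv_tmul, TensorProduct.smul_tmul']

variable [Module Aᵐᵒᵖ M] [IsScalarTower k Aᵐᵒᵖ M]

/-- The bilinear map `(t, a) ↦ F((1 ⊗ t) ◀ a) - f(t) a`, where `F` is the left linear extension
of `f`. -/
noncomputable def coboundaryForm (n : ℕ) (f : RedPow k A n →ₗ[k] M) :
    RedPow k A n →ₗ[k] A →ₗ[k] M :=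
  ((rAct k A A n).flip ∘ₗ TensorProduct.mk k A (RedPow k A n) 1).compr₂ (leftExt f) -
    (rmul k A M).flip ∘ₗ f

lemma coboundaryForm_apply (n : ℕ) (f : RedPow k A n →ₗ[k] M) (t : RedPow k A n) (a : A) :
    coboundaryForm k A M n f t a =
      leftExt f (rAct k A A n a ((1 : A) ⊗ₜ[k] t)) - MulOpposite.op a • f t := rfl

lemma coboundaryForm_one (n : ℕ) (f : RedPow k A n →ₗ[k] M) (t : RedPow k A n) :
    coboundaryForm k A M n f t 1 = 0 := by
  simp [coboundaryForm_apply, rAct_one]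

/-- The value of the coboundary map `coboundary` below. -/
noncomputable def coboundaryFun (n : ℕ) (f : RedPow k A n →ₗ[k] M) :
    RedPow k A (n + 1) →ₗ[k] M :=
  (descend (W := RedPow k A n) (N := M) ((-1 : k) ^ n • coboundaryForm k A M n f)
    (fun t => by simp [coboundaryForm_one])) ∘ₗ (snocEquiv k A n).symm.toLinearMap

lemma coboundaryFun_snoc (n : ℕ) (f : RedPow k A n →ₗ[k] M) (t : RedPow k A n) (a : A) :
    coboundaryFun k A M n f (snocEquiv k A n (t ⊗ₜ red k A a)) = (-1 : k) ^ n •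
        (leftExt f (rAct k A A n a ((1 : A) ⊗ₜ[k] t)) - MulOpposite.op a • f t) := by
  simp only [coboundaryFun, LinearMap.comp_apply, LinearEquiv.coe_coe,
    LinearEquiv.symm_apply_apply, descend_tmul, LinearMap.smul_apply, coboundaryForm_apply]

/-- The Hochschild coboundary of `f : Ā^{⊗n} → M` without the global sign:
`a₁ f(ā₂, …) + ∑_{1 ≤ j ≤ n} (-1)^j f(…, (a_j a_{j+1})‾, …) + (-1)^(n+1) f(ā₁, …, āₙ) a_{n+1}`
(see `coboundary_tprod` below). The first `n + 1` terms together are `(-1)^n` times the value of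
the left linear extension of `f` at `(1 ⊗ ā₁ ⊗ ⋯ ⊗ āₙ) ◀ a_{n+1}`. -/
noncomputable def coboundary (n : ℕ) :
    (RedPow k A n →ₗ[k] M) →ₗ[k] (RedPow k A (n + 1) →ₗ[k] M) where
  toFun f := coboundaryFun k A M n f
  map_add' f g := by
    apply ext_snoc
    intro t a
    have : leftExt (f + g) = leftExt f + leftExt g := by
      apply TensorProduct.ext'; intro a t; simp
    rw [LinearMap.add_apply]
    simp only [coboundaryFun_snoc, LinearMap.add_apply, this, smul_add, smul_sub]
    abel
  map_smul' c f := by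
    apply ext_snoc
    intro t a
    have : leftExt (c • f) = c • leftExt f := by
      apply TensorProduct.ext'; intro a t
      simp only [leftExt_tmul, LinearMap.smul_apply]
      exact smul_comm _ _ _
    rw [LinearMap.smul_apply]
    rw [coboundaryFun_snoc, coboundaryFun_snoc, this, LinearMap.smul_apply, LinearMap.smul_apply,
      smul_comm (MulOpposite.op a) c, ← smul_sub, RingHom.id_apply, smul_comm c]

lemma coboundary_snoc (n : ℕ) (f : RedPow k A n →ₗ[k] M) (t : RedPow k A n) (a : A) :
    coboundary k A M n f (snocEquiv k A n (t ⊗ₜ red k A a)) = (-1 : k) ^ n •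
        (leftExt f (rAct k A A n a ((1 : A) ⊗ₜ[k] t)) - MulOpposite.op a • f t) :=
  coboundaryFun_snoc k A M n f t a

/-- Explicit formula for the coboundary. -/
lemma coboundary_tprod (n : ℕ) (f : RedPow k A n →ₗ[k] M) (a : Fin (n + 1) → A) :
    coboundary k A M n f (PiTensorProduct.tprod k (fun i => red k A (a i))) =
      a 0 • f (PiTensorProduct.tprod k (fun i => red k A (a i.succ))) +
      ∑ j : Fin n, (-1 : k) ^ ((j : ℕ) + 1) • f (PiTensorProduct.tprod k
        (fun i => red k A (Fin.contractNth j.castSucc (· * ·) a i))) +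
      (-1 : k) ^ (n + 1) • (MulOpposite.op (a (Fin.last n)) •
        f (PiTensorProduct.tprod k (fun i => red k A (a i.castSucc)))) := by
  obtain ⟨a, b, rfl⟩ : ∃ (a' : Fin n → A) (c : A), a = Fin.snoc a' c :=
    ⟨Fin.init a, a (Fin.last n), (Fin.snoc_init_self a).symm⟩
  have h : PiTensorProduct.tprod k (fun i => red k A ((Fin.snoc a b : Fin (n + 1) → A) i)) =
      snocEquiv k A n (PiTensorProduct.tprod k (fun i => red k A (a i)) ⊗ₜ red k A b) := by
    rw [snocEquiv_tprod]
    congr 1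
    ext i
    refine Fin.lastCases ?_ (fun i => ?_) i <;> simp
  rw [h, coboundary_snoc, rAct_tprod]
  simp only [map_add, map_sum, map_smul, leftExt_tmul, one_smul, Fin.snoc_castSucc, Fin.snoc_last,
    smul_sub, smul_add, Finset.smul_sum, smul_smul, ← pow_add, pow_succ, mul_neg_one,
    neg_smul, MulOpposite.smul_eq_mul_unop, MulOpposite.unop_op, one_mul, ← sub_eq_add_neg]
  congr 2
  · simp [← two_mul]
  · refine Finset.sum_congr rfl fun j _ => ?_
    rw [← neg_smul]
    congr 1
    have hj := j.2
    have h1 : n + (n - 1 - (j : ℕ)) = 2 * (n - 1 - (j : ℕ)) + (j + 1) := by omega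
    rw [h1, pow_add, pow_mul]
    simp [pow_succ]

section Square

variable [SMulCommClass A Aᵐᵒᵖ M]

lemma rAct_smul (n : ℕ) (a b : A) (x : M ⊗[k] RedPow k A n) :
    rAct k A M n b (a • x) = a • rAct k A M n b x :=
  (rTensor_rAct k A M (Algebra.lsmul k k M a)
    (fun c m => smul_comm a (MulOpposite.op c) m) n b x).symm

lemma leftExt_coboundary (n : ℕ) (f : RedPow k A n →ₗ[k] M) (x : A ⊗[k] RedPow k A n) (c : A) :
    leftExt (coboundary k A M n f) (catEquiv k A A n (x ⊗ₜ red k A c)) =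
      (-1 : k) ^ n • (leftExt f (rAct k A A n c x) - MulOpposite.op c • leftExt f x) := by
  induction x with
  | zero => simp
  | add x y hx hy =>
    simp only [TensorProduct.add_tmul, map_add, smul_add, hx, hy, smul_sub]
    abel
  | tmul a t =>
    have : SMulCommClass Aᵐᵒᵖ A M := SMulCommClass.symm A Aᵐᵒᵖ M
    rw [catEquiv_tmul, leftExt_tmul, coboundary_snoc, leftExt_tmul,
      smul_comm (MulOpposite.op c) a, smul_comm a, smul_sub, ← leftExt_smul, ← rAct_smul,
      TensorProduct.smul_tmul', smul_eq_mul, mul_one]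

lemma coboundary_coboundary (n : ℕ) (f : RedPow k A n →ₗ[k] M) :
    coboundary k A M (n + 1) (coboundary k A M n f) = 0 := by
  apply ext_snoc
  intro t a
  obtain ⟨y, rfl⟩ := (snocEquiv k A n).surjective t
  rw [LinearMap.zero_apply]
  revert y
  suffices h : ∀ y c, coboundary k A M (n + 1) (coboundary k A M n f)
      (snocEquiv k A (n + 1) (snocEquiv k A n (y ⊗ₜ red k A c) ⊗ₜ red k A a)) = 0 by
    intro y
    induction y with
    | zero => simp
    | add x y hx hy => simp only [TensorProduct.add_tmul, map_add, hx, hy, add_zero]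
    | tmul y v =>
      obtain ⟨c, rfl⟩ := Submodule.mkQ_surjective _ v
      exact h y c
  intro t c
  rw [coboundary_snoc, ← catEquiv_tmul, rAct_cat, map_sub, leftExt_coboundary, leftExt_coboundary,
    coboundary_snoc, rAct_mul]
  simp only [leftExt_tmul, one_smul, LinearMap.comp_apply, MulOpposite.op_mul, mul_smul, smul_sub,
    smul_comm _ ((-1 : k) ^ n)]
  abel

end Square

lemma coboundary_comp {N : Type*} [AddCommGroup N] [Module k N] [Module A N] [IsScalarTower k A N]
    [Module Aᵐᵒᵖ N] [IsScalarTower k Aᵐᵒᵖ N] (g : M →ₗ[k] N) (hl : ∀ (a : A) m, g (a • m) = a • g m)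
    (hr : ∀ (a : A) m, g (MulOpposite.op a • m) = MulOpposite.op a • g m) (n : ℕ)
    (f : RedPow k A n →ₗ[k] M) :
    coboundary k A N n (g ∘ₗ f) = g ∘ₗ coboundary k A M n f := by
  have h : ∀ x, leftExt (g ∘ₗ f) x = g (leftExt f x) := by
    intro x
    induction x with
    | zero => simp
    | add x y hx hy => simp only [map_add, hx, hy]
    | tmul a t => simp [hl]
  apply ext_snoc
  intro t a
  rw [LinearMap.comp_apply, coboundary_snoc, coboundary_snoc, h, map_smul, map_sub, hr]
  rfl

end Cochains

section Chains

variable (M : Type w) [AddCommGroup M] [Module k M] [Module A M] [IsScalarTower k A M]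
variable [Module Aᵐᵒᵖ M] [IsScalarTower k Aᵐᵒᵖ M]

/-- The Hochschild boundary `M ⊗ Ā^{⊗(n+1)} → M ⊗ Ā^{⊗n}`,
`m ⊗ ā₁ ⊗ ⋯ ⊗ ā_{n+1} ↦ m a₁ ⊗ ā₂ ⊗ ⋯ + ∑_{1 ≤ j ≤ n} (-1)^j m ⊗ ⋯ ⊗ (a_j a_{j+1})‾ ⊗ ⋯
  + (-1)^(n+1) a_{n+1} m ⊗ ā₁ ⊗ ⋯ ⊗ āₙ`
(see `boundary_tprod` below), for `M` in degree `0`. The first `n + 1` terms together are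
`(-1)^n (m ⊗ ā₁ ⊗ ⋯ ⊗ āₙ) ◀ a_{n+1}`. -/
noncomputable def boundary (n : ℕ) :
    M ⊗[k] RedPow k A (n + 1) →ₗ[k] M ⊗[k] RedPow k A n :=
  ((-1 : k) ^ n • descend
    ((rAct k A M n).flip - (Algebra.lsmul k k (M ⊗[k] RedPow k A n)).toLinearMap.flip)
    (by intro x; simp [rAct_one])) ∘ₗ (catEquiv k A M n).symm.toLinearMap

lemma boundary_cat (n : ℕ) (x : M ⊗[k] RedPow k A n) (a : A) :
    boundary k A M n (catEquiv k A M n (x ⊗ₜ red k A a)) =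
      (-1 : k) ^ n • (rAct k A M n a x - a • x) := by
  simp only [boundary, LinearMap.comp_apply, LinearEquiv.coe_coe, LinearEquiv.symm_apply_apply,
    LinearMap.smul_apply, descend_tmul]
  rfl

/-- Explicit formula for the boundary. -/
lemma boundary_tprod (n : ℕ) (m : M) (a : Fin (n + 1) → A) :
    boundary k A M n (m ⊗ₜ PiTensorProduct.tprod k (fun i => red k A (a i))) =
      (MulOpposite.op (a 0) • m) ⊗ₜ PiTensorProduct.tprod k (fun i => red k A (a i.succ)) +
      ∑ j : Fin n, (-1 : k) ^ ((j : ℕ) + 1) • (m ⊗ₜ PiTensorProduct.tprod k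
        (fun i => red k A (Fin.contractNth j.castSucc (· * ·) a i))) +
      (-1 : k) ^ (n + 1) • ((a (Fin.last n) • m) ⊗ₜ
        PiTensorProduct.tprod k (fun i => red k A (a i.castSucc))) := by
  obtain ⟨a, b, rfl⟩ : ∃ (a' : Fin n → A) (c : A), a = Fin.snoc a' c :=
    ⟨Fin.init a, a (Fin.last n), (Fin.snoc_init_self a).symm⟩
  have h : PiTensorProduct.tprod k (fun i => red k A ((Fin.snoc a b : Fin (n + 1) → A) i)) =
      snocEquiv k A n (PiTensorProduct.tprod k (fun i => red k A (a i)) ⊗ₜ red k A b) := by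
    rw [snocEquiv_tprod]
    congr 1
    ext i
    refine Fin.lastCases ?_ (fun i => ?_) i <;> simp
  rw [h, ← catEquiv_tmul, boundary_cat, rAct_tprod]
  simp only [TensorProduct.smul_tmul' (_ : A), Fin.snoc_castSucc, Fin.snoc_last,
    smul_sub, smul_add, Finset.smul_sum, smul_smul, ← pow_add, pow_succ, mul_neg_one,
    neg_smul, ← sub_eq_add_neg]
  congr 2
  · simp [← two_mul]
  · refine Finset.sum_congr rfl fun j _ => ?_
    rw [← neg_smul]
    congr 1
    have hj := j.2
    have h1 : n + (n - 1 - (j : ℕ)) = 2 * (n - 1 - (j : ℕ)) + (j + 1) := by omega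
    rw [h1, pow_add, pow_mul]
    simp [pow_succ]

lemma boundary_boundary [SMulCommClass A Aᵐᵒᵖ M] (n : ℕ) :
    boundary k A M n ∘ₗ boundary k A M (n + 1) = 0 := by
  apply ext_cat
  intro x a
  obtain ⟨y, rfl⟩ := (catEquiv k A M n).surjective x
  rw [LinearMap.zero_apply]
  revert y
  suffices h : ∀ y c, (boundary k A M n ∘ₗ boundary k A M (n + 1))
      (catEquiv k A M (n + 1) (catEquiv k A M n (y ⊗ₜ red k A c) ⊗ₜ red k A a)) = 0 by
    intro y
    induction y with
    | zero => simp
    | add x y hx hy => simp only [TensorProduct.add_tmul, map_add, hx, hy, add_zero]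
    | tmul y v =>
      obtain ⟨c, rfl⟩ := Submodule.mkQ_surjective _ v
      exact h y c
  intro y c
  rw [LinearMap.comp_apply, boundary_cat, rAct_cat, smul_catEquiv, map_smul, map_sub, map_sub,
    boundary_cat, boundary_cat, boundary_cat, rAct_mul, rAct_smul]
  simp only [LinearMap.comp_apply, mul_smul, smul_sub]
  abel

end Chains


section Theta

/-- Concatenation `Ω^p(A) ⊗ Ā ≅ Ω^{p+1}(A)`. -/
noncomputable def formsCat (p : ℕ) : Forms k A p ⊗[k] RedAlg k A ≃ₗ[k] Forms k A (p + 1) :=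
  catEquiv k A A p

lemma op_smul_formsCat (p : ℕ) (b : A) (x : Forms k A p) (a : A) :
    MulOpposite.op b • formsCat k A p (x ⊗ₜ red k A a) =
      formsCat k A p (x ⊗ₜ red k A (a * b)) -
        formsCat k A p ((MulOpposite.op a • x) ⊗ₜ red k A b) :=
  rAct_cat k A A p b x a

lemma smul_formsCat (p : ℕ) (b : A) (x : Forms k A p) (v : RedAlg k A) :
    b • formsCat k A p (x ⊗ₜ v) = formsCat k A p ((b • x) ⊗ₜ v) :=
  smul_catEquiv k A A p b x v

/-- The map `θ_p : f ↦ f ⊗ id` from `Hom(Ā^{⊗n}, A ⊗ Ā^{⊗p})` to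
`Hom(Ā^{⊗(n+1)}, A ⊗ Ā^{⊗(p+1)})`. -/
noncomputable def theta (p n : ℕ) :
    (RedPow k A n →ₗ[k] Forms k A p) →ₗ[k] (RedPow k A (n + 1) →ₗ[k] Forms k A (p + 1)) where
  toFun f := (formsCat k A p).toLinearMap ∘ₗ LinearMap.rTensor (RedAlg k A) f ∘ₗ
    (snocEquiv k A n).symm.toLinearMap
  map_add' f g := by
    rw [LinearMap.rTensor_add, LinearMap.add_comp, LinearMap.comp_add]
  map_smul' c f := by
    rw [LinearMap.rTensor_smul, LinearMap.smul_comp, LinearMap.comp_smul, RingHom.id_apply]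

lemma theta_snoc (p n : ℕ) (f : RedPow k A n →ₗ[k] Forms k A p) (t : RedPow k A n)
    (v : RedAlg k A) :
    theta k A p n f (snocEquiv k A n (t ⊗ₜ v)) = formsCat k A p (f t ⊗ₜ v) := by
  simp only [theta, LinearMap.coe_mk, AddHom.coe_mk, LinearMap.comp_apply, LinearEquiv.coe_coe,
    LinearEquiv.symm_apply_apply, LinearMap.rTensor_tmul]

lemma leftExt_theta (p n : ℕ) (f : RedPow k A n →ₗ[k] Forms k A p) (x : A ⊗[k] RedPow k A n)
    (v : RedAlg k A) :
    leftExt (theta k A p n f) (catEquiv k A A n (x ⊗ₜ v)) =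
      formsCat k A p (leftExt f x ⊗ₜ v) := by
  induction x with
  | zero => simp only [TensorProduct.zero_tmul, map_zero]
  | add x y hx hy => simp only [TensorProduct.add_tmul, map_add, hx, hy]
  | tmul a t =>
    rw [catEquiv_tmul, leftExt_tmul, theta_snoc, smul_formsCat, leftExt_tmul]

lemma coboundary_theta (p n : ℕ) (f : RedPow k A n →ₗ[k] Forms k A p) :
    coboundary k A (Forms k A (p + 1)) (n + 1) (theta k A p n f) =
      theta k A p (n + 1) (coboundary k A (Forms k A p) n f) := by
  apply ext_snoc
  intro t a
  obtain ⟨y, rfl⟩ := (snocEquiv k A n).surjective t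
  revert y
  suffices h : ∀ y c, coboundary k A (Forms k A (p + 1)) (n + 1) (theta k A p n f)
      (snocEquiv k A (n + 1) (snocEquiv k A n (y ⊗ₜ red k A c) ⊗ₜ red k A a)) =
      theta k A p (n + 1) (coboundary k A (Forms k A p) n f)
      (snocEquiv k A (n + 1) (snocEquiv k A n (y ⊗ₜ red k A c) ⊗ₜ red k A a)) by
    intro y
    induction y with
    | zero => simp
    | add x y hx hy => simp only [TensorProduct.add_tmul, map_add, hx, hy]
    | tmul y v =>
      obtain ⟨c, rfl⟩ := Submodule.mkQ_surjective _ v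
      exact h y c
  intro t c
  rw [coboundary_snoc, theta_snoc, theta_snoc, coboundary_snoc, ← catEquiv_tmul, rAct_cat, map_sub,
    leftExt_theta, leftExt_theta, op_smul_formsCat, leftExt_tmul, one_smul,
    ← TensorProduct.smul_tmul' ((-1 : k) ^ n), TensorProduct.sub_tmul, map_smul, map_sub, pow_succ, mul_neg_one,
    neg_smul, ← smul_neg]
  congr 1
  abel

end Theta

section Dual

/-- `A^∨ = Hom_{A ⊗ A^op}(A, A ⊗ A^op)`, identified through `α ↦ α(1)` with the space of all
`∑ xᵢ ⊗ yᵢ ∈ A ⊗ A` such that `∑ a xᵢ ⊗ yᵢ = ∑ xᵢ ⊗ yᵢ a` for every `a`. -/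
noncomputable def dualSubmodule : Submodule k (A ⊗[k] A) where
  carrier := {z | ∀ a : A, (LinearMap.mulLeft k a).rTensor A z = (LinearMap.mulRight k a).lTensor A z}
  add_mem' := by
    intro x y hx hy a
    rw [map_add, map_add, hx a, hy a]
  zero_mem' := by
    intro a
    rw [map_zero, map_zero]
  smul_mem' := by
    intro c x hx a
    rw [map_smul, map_smul, hx a]

/-- The bimodule `A^∨`, with `a (∑ xᵢ ⊗ yᵢ) b = ∑ xᵢ b ⊗ a yᵢ`. -/
def Dual : Type v := dualSubmodule k A

noncomputable instance : AddCommGroup (Dual k A) := inferInstanceAs (AddCommGroup (dualSubmodule k A))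

noncomputable instance : Module k (Dual k A) := inferInstanceAs (Module k (dualSubmodule k A))

/-- The inclusion `A^∨ → A ⊗ A`. -/
noncomputable def dualIncl : Dual k A →ₗ[k] A ⊗[k] A := (dualSubmodule k A).subtype

lemma dualIncl_injective : Function.Injective (dualIncl k A) := Subtype.val_injective

lemma dualIncl_mem (z : Dual k A) (a : A) :
    (LinearMap.mulLeft k a).rTensor A (dualIncl k A z) =
      (LinearMap.mulRight k a).lTensor A (dualIncl k A z) := z.2 a

noncomputable instance : SMul A (Dual k A) where
  smul a z := ⟨(LinearMap.mulLeft k a).lTensor A (dualIncl k A z), by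
    intro b
    rw [← LinearMap.comp_apply, LinearMap.rTensor_comp_lTensor, ← LinearMap.lTensor_comp_rTensor,
      LinearMap.comp_apply, dualIncl_mem, ← LinearMap.lTensor_comp_apply,
      ← LinearMap.lTensor_comp_apply]
    congr 2
    ext x
    simp [mul_assoc]⟩

noncomputable instance : SMul Aᵐᵒᵖ (Dual k A) where
  smul a z := ⟨(LinearMap.mulRight k a.unop).rTensor A (dualIncl k A z), by
    intro b
    rw [← LinearMap.comp_apply (LinearMap.lTensor _ _), LinearMap.lTensor_comp_rTensor,
      ← LinearMap.rTensor_comp_lTensor,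
      LinearMap.comp_apply, ← dualIncl_mem, ← LinearMap.rTensor_comp_apply,
      ← LinearMap.rTensor_comp_apply]
    congr 2
    ext x
    simp [mul_assoc]⟩

lemma dualIncl_smul (a : A) (z : Dual k A) :
    dualIncl k A (a • z) = (LinearMap.mulLeft k a).lTensor A (dualIncl k A z) := rfl

lemma dualIncl_op_smul (a : Aᵐᵒᵖ) (z : Dual k A) :
    dualIncl k A (a • z) = (LinearMap.mulRight k a.unop).rTensor A (dualIncl k A z) := rfl

noncomputable instance : Module A (Dual k A) where
  one_smul z := dualIncl_injective k A (by simp [dualIncl_smul])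
  mul_smul a b z := dualIncl_injective k A (by
    simp only [dualIncl_smul, LinearMap.mulLeft_mul, LinearMap.lTensor_comp_apply])
  smul_zero a := dualIncl_injective k A (by simp [dualIncl_smul])
  smul_add a x y := dualIncl_injective k A (by simp [dualIncl_smul])
  add_smul a b x := dualIncl_injective k A (by
    have : LinearMap.mulLeft k (a + b) = LinearMap.mulLeft k a + LinearMap.mulLeft k b := by
      ext x; simp [add_mul]
    simp [dualIncl_smul, this, LinearMap.lTensor_add])
  zero_smul z := dualIncl_injective k A (by simp [dualIncl_smul])

noncomputable instance : Module Aᵐᵒᵖ (Dual k A) where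
  one_smul z := dualIncl_injective k A (by simp [dualIncl_op_smul])
  mul_smul a b z := dualIncl_injective k A (by
    simp only [dualIncl_op_smul, MulOpposite.unop_mul, LinearMap.mulRight_mul,
      LinearMap.rTensor_comp_apply])
  smul_zero a := dualIncl_injective k A (by simp [dualIncl_op_smul])
  smul_add a x y := dualIncl_injective k A (by simp [dualIncl_op_smul])
  add_smul a b x := dualIncl_injective k A (by
    have : LinearMap.mulRight k (a.unop + b.unop) =
        LinearMap.mulRight k a.unop + LinearMap.mulRight k b.unop := by
      ext x; simp [mul_add]
    simp [dualIncl_op_smul, this, LinearMap.rTensor_add])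
  zero_smul z := dualIncl_injective k A (by simp [dualIncl_op_smul])

instance : IsScalarTower k A (Dual k A) where
  smul_assoc c a z := dualIncl_injective k A (by
    have : LinearMap.mulLeft k (c • a) = c • LinearMap.mulLeft k a := by
      ext x; simp
    simp [dualIncl_smul, this, LinearMap.lTensor_smul])

instance : IsScalarTower k Aᵐᵒᵖ (Dual k A) where
  smul_assoc c a z := dualIncl_injective k A (by
    have : LinearMap.mulRight k (c • a.unop) = c • LinearMap.mulRight k a.unop := by
      ext x; simp
    simp [dualIncl_op_smul, this, LinearMap.rTensor_smul])

instance : SMulCommClass A Aᵐᵒᵖ (Dual k A) where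
  smul_comm a b z := dualIncl_injective k A (by
    rw [dualIncl_smul, dualIncl_op_smul, dualIncl_op_smul, dualIncl_smul,
      ← LinearMap.comp_apply (LinearMap.lTensor _ _), LinearMap.lTensor_comp_rTensor,
      ← LinearMap.comp_apply (LinearMap.rTensor _ _), LinearMap.rTensor_comp_lTensor])

/-- Componentwise `A ⊗ A^op ≅ A ⊗ A` as `k`-modules. -/
noncomputable def unopEquiv : A ⊗[k] Aᵐᵒᵖ ≃ₗ[k] A ⊗[k] A :=
  LinearEquiv.lTensor A (MulOpposite.opLinearEquiv k).symm

lemma unopEquiv_left_mul (a : A) (z : A ⊗[k] Aᵐᵒᵖ) :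
    unopEquiv k A ((a ⊗ₜ 1) * z) = (LinearMap.mulLeft k a).rTensor A (unopEquiv k A z) := by
  induction z with
  | zero => simp
  | add x y hx hy => simp only [mul_add, map_add, hx, hy]
  | tmul x y => simp [unopEquiv]

lemma unopEquiv_right_mul (a : A) (z : A ⊗[k] Aᵐᵒᵖ) :
    unopEquiv k A ((1 ⊗ₜ MulOpposite.op a) * z) =
      (LinearMap.mulRight k a).lTensor A (unopEquiv k A z) := by
  induction z with
  | zero => simp
  | add x y hx hy => simp only [mul_add, map_add, hx, hy]
  | tmul x y => simp [unopEquiv]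

/-- The identification of `Hom_{A ⊗ A^op}(A, A ⊗ A^op)` with the module `Dual` used here,
`α ↦ α(1)`. -/
noncomputable def homEquivDual :
    letI : Module (A ⊗[k] Aᵐᵒᵖ) A := TensorProduct.Algebra.module
    (A →ₗ[A ⊗[k] Aᵐᵒᵖ] A ⊗[k] Aᵐᵒᵖ) ≃+ Dual k A :=
  letI : Module (A ⊗[k] Aᵐᵒᵖ) A := TensorProduct.Algebra.module
  have hsmul : ∀ (x : A) (y : Aᵐᵒᵖ) (m : A), (x ⊗ₜ[k] y) • m = x * (m * y.unop) :=
    fun x y m => rfl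
  { toFun := fun α => ⟨unopEquiv k A (α 1), fun a => by
      rw [← unopEquiv_left_mul, ← unopEquiv_right_mul, ← smul_eq_mul, ← smul_eq_mul, ← map_smul,
        ← map_smul, hsmul, hsmul]
      simp⟩
    invFun := fun z =>
      { toFun := fun a => (a ⊗ₜ 1) * (unopEquiv k A).symm (dualIncl k A z)
        map_add' := fun a b => by rw [TensorProduct.add_tmul, add_mul]
        map_smul' := fun r a => by
          have hz : ∀ b : A, (b ⊗ₜ[k] (1 : Aᵐᵒᵖ)) * (unopEquiv k A).symm (dualIncl k A z) =
              ((1 : A) ⊗ₜ[k] MulOpposite.op b) * (unopEquiv k A).symm (dualIncl k A z) := by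
            intro b
            apply (unopEquiv k A).injective
            rw [unopEquiv_left_mul, unopEquiv_right_mul, LinearEquiv.apply_symm_apply,
              dualIncl_mem]
          induction r with
          | zero =>
            have h0 : ((0 : A ⊗[k] Aᵐᵒᵖ) • a : A) = 0 := zero_smul (A ⊗[k] Aᵐᵒᵖ) a
            have h1 : ∀ w : A ⊗[k] Aᵐᵒᵖ, (0 : A ⊗[k] Aᵐᵒᵖ) • w = 0 := fun w => zero_mul w
            rw [h0, TensorProduct.zero_tmul, zero_mul]
            exact (h1 _).symm
          | add x y hx hy => rw [add_smul, TensorProduct.add_tmul, add_mul, hx, hy, map_add, add_smul]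
          | tmul x y =>
            have h1 : ((x * (a * y.unop)) ⊗ₜ[k] (1 : Aᵐᵒᵖ)) =
                ((x * a) ⊗ₜ[k] (1 : Aᵐᵒᵖ)) * (y.unop ⊗ₜ[k] (1 : Aᵐᵒᵖ)) := by
              rw [Algebra.TensorProduct.tmul_mul_tmul, mul_one, mul_assoc]
            rw [hsmul, h1, mul_assoc, hz, ← mul_assoc, RingHom.id_apply, smul_eq_mul, ← mul_assoc]
            simp [Algebra.TensorProduct.tmul_mul_tmul] }
    left_inv := fun α => by
      ext a
      change (a ⊗ₜ 1) * (unopEquiv k A).symm (unopEquiv k A (α 1)) = α a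
      rw [LinearEquiv.symm_apply_apply, ← smul_eq_mul, ← map_smul, hsmul]
      simp
    right_inv := fun z => by
      apply dualIncl_injective
      change unopEquiv k A ((1 ⊗ₜ 1) * (unopEquiv k A).symm (dualIncl k A z)) = _
      rw [← Algebra.TensorProduct.one_def, one_mul, LinearEquiv.apply_symm_apply]
    map_add' := fun α β => by
      apply dualIncl_injective
      change unopEquiv k A ((α + β) 1) = unopEquiv k A (α 1) + unopEquiv k A (β 1)
      rw [LinearMap.add_apply, map_add] }

end Dual


section Iota

/-- The map `(A ⊗ A) ⊗ Ā^{⊗n} → (A ⊗ Ā^{⊗n}) ⊗ A`, `(x ⊗ y) ⊗ t ↦ (x ⊗ t) ⊗ y`. -/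
noncomputable def interchange (n : ℕ) : (A ⊗[k] A) ⊗[k] RedPow k A n →ₗ[k] Forms k A n ⊗[k] A :=
  (TensorProduct.rightComm k A A (RedPow k A n)).toLinearMap

/-- The map `A^∨ ⊗ Ā^{⊗n} → (A ⊗ Ā^{⊗n}) ⊗ A`, `(x ⊗ y) ⊗ t ↦ (x ⊗ t) ⊗ y`. -/
noncomputable def spread (n : ℕ) : Dual k A ⊗[k] RedPow k A n →ₗ[k] Forms k A n ⊗[k] A :=
  interchange k A n ∘ₗ (dualIncl k A).rTensor _

/-- The map `A^∨ ⊗ Ā^{⊗n} → A ⊗ Ā^{⊗(n+1)}`, `(∑ xⱼ ⊗ yⱼ) ⊗ t ↦ ∑ xⱼ ⊗ t ⊗ ȳⱼ`. -/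
noncomputable def iotaNeg (n : ℕ) : Dual k A ⊗[k] RedPow k A n →ₗ[k] Forms k A (n + 1) :=
  (formsCat k A n).toLinearMap ∘ₗ (red k A).lTensor _ ∘ₗ spread k A n

/-- `∑ ωⱼ ⊗ yⱼ ↦ ∑ ωⱼ ◀ yⱼ` on `Ω^n(A) ⊗ A`. -/
noncomputable def actMap (n : ℕ) : Forms k A n ⊗[k] A →ₗ[k] Forms k A n :=
  TensorProduct.lift (rmul k A (Forms k A n)).flip

lemma actMap_tmul (n : ℕ) (x : Forms k A n) (a : A) :
    actMap k A n (x ⊗ₜ a) = MulOpposite.op a • x := rfl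

/-- Concatenation with a fixed element of `Ā`. -/
noncomputable def formsCatRight (n : ℕ) (v : RedAlg k A) : Forms k A n →ₗ[k] Forms k A (n + 1) :=
  (formsCat k A n).toLinearMap ∘ₗ (TensorProduct.mk k (Forms k A n) (RedAlg k A)).flip v

lemma formsCatRight_apply (n : ℕ) (v : RedAlg k A) (x : Forms k A n) :
    formsCatRight k A n v x = formsCat k A n (x ⊗ₜ v) := rfl

lemma interchange_cat (n : ℕ) (w : (A ⊗[k] A) ⊗[k] RedPow k A n) (v : RedAlg k A) :
    interchange k A (n + 1) (catEquiv k A (A ⊗[k] A) n (w ⊗ₜ v)) =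
      (formsCatRight k A n v).rTensor A (interchange k A n w) := by
  suffices h : interchange k A (n + 1) ∘ₗ (catEquiv k A (A ⊗[k] A) n).toLinearMap ∘ₗ
      (TensorProduct.mk k _ (RedAlg k A)).flip v =
      (formsCatRight k A n v).rTensor A ∘ₗ interchange k A n from LinearMap.congr_fun h w
  apply TensorProduct.ext_threefold
  intro x y t
  change interchange k A (n + 1) (catEquiv k A (A ⊗[k] A) n (((x ⊗ₜ y) ⊗ₜ t) ⊗ₜ v)) =
    (catEquiv k A A n ((x ⊗ₜ t) ⊗ₜ v)) ⊗ₜ y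
  rw [catEquiv_tmul, catEquiv_tmul]
  rfl

lemma incl_cat (n : ℕ) (w : Dual k A ⊗[k] RedPow k A n) (v : RedAlg k A) :
    (dualIncl k A).rTensor _ (catEquiv k A (Dual k A) n (w ⊗ₜ v)) =
      catEquiv k A (A ⊗[k] A) n ((dualIncl k A).rTensor _ w ⊗ₜ v) := by
  induction w with
  | zero => simp
  | add x y hx hy => simp only [TensorProduct.add_tmul, map_add, hx, hy]
  | tmul z t => simp only [catEquiv_tmul, LinearMap.rTensor_tmul]

lemma spread_cat (n : ℕ) (w : Dual k A ⊗[k] RedPow k A n) (v : RedAlg k A) :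
    spread k A (n + 1) (catEquiv k A (Dual k A) n (w ⊗ₜ v)) =
      (formsCatRight k A n v).rTensor A (spread k A n w) := by
  rw [spread, LinearMap.comp_apply, incl_cat, interchange_cat]
  rfl

lemma spread_mem (n : ℕ) (w : Dual k A ⊗[k] RedPow k A n) (b : A) :
    (Algebra.lsmul k k (Forms k A n) b).rTensor A (spread k A n w) =
      (LinearMap.mulRight k b).lTensor _ (spread k A n w) := by
  have aux1 : (Algebra.lsmul k k (Forms k A n) b).rTensor A ∘ₗ interchange k A n =
      interchange k A n ∘ₗ ((LinearMap.mulLeft k b).rTensor A).rTensor _ :=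
    TensorProduct.ext_threefold fun x y t => rfl
  have aux2 : (LinearMap.mulRight k b).lTensor (Forms k A n) ∘ₗ interchange k A n =
      interchange k A n ∘ₗ ((LinearMap.mulRight k b).lTensor A).rTensor _ :=
    TensorProduct.ext_threefold fun x y t => rfl
  have h : (LinearMap.mulLeft k b).rTensor A ∘ₗ dualIncl k A =
      (LinearMap.mulRight k b).lTensor A ∘ₗ dualIncl k A := by
    ext1 z
    exact dualIncl_mem k A z b
  rw [spread, ← LinearMap.comp_apply, ← LinearMap.comp_apply, ← LinearMap.comp_assoc,
    ← LinearMap.comp_assoc, aux1, aux2, LinearMap.comp_assoc, LinearMap.comp_assoc,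
    ← LinearMap.rTensor_comp, ← LinearMap.rTensor_comp, h]

lemma spread_smul (n : ℕ) (w : Dual k A ⊗[k] RedPow k A n) (b : A) :
    spread k A n (b • w) = (LinearMap.mulLeft k b).lTensor _ (spread k A n w) := by
  have aux2 : (LinearMap.mulLeft k b).lTensor (Forms k A n) ∘ₗ interchange k A n =
      interchange k A n ∘ₗ ((LinearMap.mulLeft k b).lTensor A).rTensor _ :=
    TensorProduct.ext_threefold fun x y t => rfl
  rw [spread, LinearMap.comp_apply, LinearMap.comp_apply, ← LinearMap.comp_apply _
    (interchange k A n), aux2, LinearMap.comp_apply]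
  congr 1
  induction w with
  | zero => simp
  | add x y hx hy => rw [smul_add, map_add, map_add, map_add, hx, hy]
  | tmul z t => rfl

lemma spread_rAct (n : ℕ) (w : Dual k A ⊗[k] RedPow k A n) (b : A) :
    spread k A n (rAct k A (Dual k A) n b w) = (rmul k A (Forms k A n) b).rTensor A
      (spread k A n w) := by
  induction n generalizing b with
  | zero =>
    have aux1 : (rmul k A (Forms k A 0) b).rTensor A ∘ₗ interchange k A 0 =
        interchange k A 0 ∘ₗ ((LinearMap.mulRight k b).rTensor A).rTensor _ :=
      TensorProduct.ext_threefold fun x y t => rfl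
    rw [spread, LinearMap.comp_apply, LinearMap.comp_apply, ← LinearMap.comp_apply _
      (interchange k A 0), aux1, LinearMap.comp_apply]
    congr 1
    induction w with
    | zero => simp
    | add x y hx hy => rw [map_add, map_add, map_add, map_add, hx, hy]
    | tmul z t => rfl
  | succ n ih =>
    have : spread k A (n + 1) ∘ₗ rAct k A (Dual k A) (n + 1) b =
        (rmul k A (Forms k A (n + 1)) b).rTensor A ∘ₗ spread k A (n + 1) := by
      apply ext_cat
      intro x c
      rw [LinearMap.comp_apply, LinearMap.comp_apply, rAct_cat, map_sub, spread_cat, spread_cat,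
        spread_cat, ih]
      induction spread k A n x with
      | zero => simp
      | add x y hx hy =>
        simp only [map_add, ← hx, ← hy]
        abel
      | tmul w y =>
        simp only [LinearMap.rTensor_tmul, formsCatRight_apply, rmul_apply, op_smul_formsCat,
          TensorProduct.sub_tmul]
    exact LinearMap.congr_fun this w

lemma iota_smul_sub (n : ℕ) (w : Dual k A ⊗[k] RedPow k A n) (b : A) :
    b • iotaNeg k A n w - MulOpposite.op b • iotaNeg k A n w =
      formsCat k A n (actMap k A n (spread k A n w) ⊗ₜ red k A b) := by
  have h1 : ∀ s : Forms k A n ⊗[k] A, b • formsCat k A n ((red k A).lTensor _ s) =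
      formsCat k A n ((red k A).lTensor _ ((Algebra.lsmul k k (Forms k A n) b).rTensor A s)) := by
    intro s
    induction s with
    | zero => simp
    | add x y hx hy => simp only [map_add, smul_add, hx, hy]
    | tmul w y => simp [smul_formsCat]
  have h2 : ∀ s : Forms k A n ⊗[k] A, MulOpposite.op b • formsCat k A n ((red k A).lTensor _ s) =
      formsCat k A n ((red k A).lTensor _ ((LinearMap.mulRight k b).lTensor _ s)) -
        formsCat k A n (actMap k A n s ⊗ₜ red k A b) := by
    intro s
    induction s with
    | zero => simp
    | add x y hx hy => simp only [map_add, smul_add, hx, hy, TensorProduct.add_tmul]; abel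
    | tmul w y => simp [op_smul_formsCat, actMap_tmul]
  change b • formsCat k A n ((red k A).lTensor _ (spread k A n w)) -
    MulOpposite.op b • formsCat k A n ((red k A).lTensor _ (spread k A n w)) = _
  rw [h1, h2, spread_mem]
  abel

lemma actMap_spread (n : ℕ) (w : Dual k A ⊗[k] RedPow k A (n + 1)) :
    actMap k A (n + 1) (spread k A (n + 1) w) =
      (-1 : k) ^ (n + 1) • iotaNeg k A n (boundary k A (Dual k A) n w) := by
  have : actMap k A (n + 1) ∘ₗ spread k A (n + 1) =
      (-1 : k) ^ (n + 1) • (iotaNeg k A n ∘ₗ boundary k A (Dual k A) n) := by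
    apply ext_cat
    intro x c
    rw [LinearMap.smul_apply, LinearMap.comp_apply, LinearMap.comp_apply, boundary_cat, map_smul,
      smul_smul, pow_succ, mul_assoc, mul_comm (-1 : k), ← mul_assoc, ← pow_add, ← two_mul, pow_mul,
      neg_one_sq, one_pow, one_mul, spread_cat, map_sub, neg_one_smul, neg_sub]
    change _ = formsCat k A n ((red k A).lTensor _ (spread k A n _)) -
      formsCat k A n ((red k A).lTensor _ (spread k A n _))
    rw [spread_rAct, spread_smul]
    induction spread k A n x with
    | zero => simp
    | add x y hx hy =>
      simp only [map_add, hx, hy]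
      abel
    | tmul w y =>
      simp [op_smul_formsCat, actMap_tmul, formsCatRight_apply]
  exact LinearMap.congr_fun this w

end Iota


open CategoryTheory

set_option linter.unusedSectionVars false

section HochschildComplexes

section

variable (M : Type w) [AddCommGroup M] [Module k M]

/-- The degree `m` part `∏ₙ Hom(Ā^{⊗n}, M)^m` of `C^*(A, M)`, for a bimodule `M` in degree `-p`:
a map `Ā^{⊗n} → M` has degree `m` exactly when `n = m + p` (recall that `Ā` sits in degree `-1`).
So this is `Hom(Ā^{⊗(m+p)}, M)` if `0 ≤ m + p`, and `0` otherwise. -/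
abbrev CochainSpace (p : ℕ) (m : ℤ) : Type (max u v w) :=
  ∀ n : {n : ℕ // (n : ℤ) = m + p}, RedPow k A n →ₗ[k] M

/-- A map `Ā^{⊗n} → M`, regarded as a cochain of degree `m = n - p`. -/
noncomputable def embed (p n : ℕ) (m : ℤ) (h : (n : ℤ) = m + p) :
    (RedPow k A n →ₗ[k] M) →ₗ[k] CochainSpace k A M p m :=
  LinearMap.single k (fun n : {n : ℕ // (n : ℤ) = m + p} => RedPow k A n →ₗ[k] M) ⟨n, h⟩

lemma embed_apply (p n : ℕ) (m : ℤ) (h : (n : ℤ) = m + p) (f : RedPow k A n →ₗ[k] M) :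
    embed k A M p n m h f ⟨n, h⟩ = f :=
  Pi.single_eq_same (M := fun n : {n : ℕ // (n : ℤ) = m + p} => RedPow k A n →ₗ[k] M) ⟨n, h⟩ f

end

variable (M : Type w) [AddCommGroup M] [Module k M] [Module A M] [IsScalarTower k A M]
  [Module Aᵐᵒᵖ M] [IsScalarTower k Aᵐᵒᵖ M] [SMulCommClass A Aᵐᵒᵖ M]

/-- The Hochschild chain complex `C_*(A, M)`, with `C_n(A, M) = M ⊗ Ā^{⊗n}`, for a bimodule `M`
in degree `0`. -/
noncomputable def hochschildChains : ChainComplex (ModuleCat.{max u v w} k) ℕ :=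
  ChainComplex.of (fun n => ModuleCat.of k (M ⊗[k] RedPow k A n))
    (fun n => ModuleCat.ofHom (boundary k A M n))
    (fun n => by
      rw [← ModuleCat.ofHom_comp, boundary_boundary]
      rfl)

/-- The Hochschild cochain complex `C^*(A, M)`, with `C^n(A, M) = Hom(Ā^{⊗n}, M)`, for a bimodule
`M` in degree `0`. The differential `δ^n` is `(-1)^(n+1)` times `coboundary`. -/
noncomputable def hochschildCochains : CochainComplex (ModuleCat.{max u v w} k) ℕ :=
  CochainComplex.of (fun n => ModuleCat.of k (RedPow k A n →ₗ[k] M))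
    (fun n => ModuleCat.ofHom ((-1 : k) ^ (n + 1) • coboundary k A M n))
    (fun n => by
      rw [← ModuleCat.ofHom_comp]
      have : ((-1 : k) ^ (n + 1 + 1) • coboundary k A M (n + 1)) ∘ₗ
          ((-1 : k) ^ (n + 1) • coboundary k A M n) = 0 := by
        ext1 f
        simp [coboundary_coboundary]
      rw [this]
      rfl)

lemma hochschildChains_d (n : ℕ) :
    (hochschildChains k A M).d (n + 1) n = ModuleCat.ofHom (boundary k A M n) :=
  ChainComplex.of_d (fun n => ModuleCat.of k (M ⊗[k] RedPow k A n))
    (fun n => ModuleCat.ofHom (boundary k A M n)) n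

lemma hochschildCochains_d (n : ℕ) :
    (hochschildCochains k A M).d n (n + 1) =
      ModuleCat.ofHom ((-1 : k) ^ (n + 1) • coboundary k A M n) :=
  CochainComplex.of_d (fun n => ModuleCat.of k (RedPow k A n →ₗ[k] M))
    (fun n => ModuleCat.ofHom ((-1 : k) ^ (n + 1) • coboundary k A M n)) n

/-- The differential `δ^m` of `C^*(A, M)` for `M` in degree `-p`: it is `(-1)^(m+1)` times
`coboundary`. -/
noncomputable def cochainD (p : ℕ) (m : ℤ) :
    CochainSpace k A M p m →ₗ[k] CochainSpace k A M p (m + 1) :=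
  LinearMap.pi fun n => match n with
    | ⟨0, _⟩ => 0
    | ⟨n + 1, h⟩ => (-1 : k) ^ (m + 1) • (coboundary k A M n ∘ₗ
        LinearMap.proj (R := k) (ι := {n : ℕ // (n : ℤ) = m + p})
          (φ := fun n => RedPow k A n →ₗ[k] M) ⟨n, by push_cast at h; omega⟩)

lemma cochainD_comp (p : ℕ) (m : ℤ) :
    cochainD k A M p (m + 1) ∘ₗ cochainD k A M p m = 0 := by
  ext1 f
  funext ⟨n, h⟩
  match n, h with
  | 0, h => rfl
  | 1, h =>
    change (-1 : k) ^ (m + 1 + 1) • coboundary k A M 0 0 = 0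
    rw [map_zero, smul_zero]
  | n + 2, h =>
    change (-1 : k) ^ (m + 1 + 1) • coboundary k A M (n + 1)
      ((-1 : k) ^ (m + 1) • coboundary k A M n _) = 0
    rw [map_smul, coboundary_coboundary, smul_zero, smul_zero]

/-- The Hochschild cochain complex `C^*(A, M)` for a bimodule `M` in degree `-p`. -/
noncomputable def gradedHochschildCochains (p : ℕ) :
    CochainComplex (ModuleCat.{max u v w} k) ℤ :=
  CochainComplex.of (fun m => ModuleCat.of k (CochainSpace k A M p m))
    (fun m => ModuleCat.ofHom (cochainD k A M p m))
    (fun m => by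
      rw [← ModuleCat.ofHom_comp, cochainD_comp]
      rfl)

lemma gradedHochschildCochains_d (p : ℕ) (m : ℤ) :
    (gradedHochschildCochains k A M p).d m (m + 1) = ModuleCat.ofHom (cochainD k A M p m) :=
  CochainComplex.of_d (fun m => ModuleCat.of k (CochainSpace k A M p m))
    (fun m => ModuleCat.ofHom (cochainD k A M p m)) m

lemma cochainD_embed (p n : ℕ) (m : ℤ) (h : (n : ℤ) = m + p) (f : RedPow k A n →ₗ[k] M) :
    cochainD k A M p m (embed k A M p n m h f) =
      (-1 : k) ^ (m + 1) • embed k A M p (n + 1) (m + 1) (by push_cast; omega)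
        (coboundary k A M n f) := by
  funext ⟨n', h'⟩
  obtain rfl : n' = n + 1 := by omega
  rw [Pi.smul_apply, embed_apply]
  change (-1 : k) ^ (m + 1) • coboundary k A M n (embed k A M p n m _ f ⟨n, _⟩) = _
  rw [embed_apply]

end HochschildComplexes

section SingularComplex

/-- The map `θ_p` in degree `m`. -/
noncomputable def thetaD (p : ℕ) (m : ℤ) :
    CochainSpace k A (Forms k A p) p m →ₗ[k]
      CochainSpace k A (Forms k A (p + 1)) (p + 1) m :=
  LinearMap.pi fun n => match n with
    | ⟨0, _⟩ => 0
    | ⟨n + 1, h⟩ => theta k A p n ∘ₗ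
        LinearMap.proj (R := k) (ι := {n : ℕ // (n : ℤ) = m + p})
          (φ := fun n => RedPow k A n →ₗ[k] Forms k A p) ⟨n, by push_cast at h; omega⟩

lemma thetaD_comm (p : ℕ) (m : ℤ) :
    thetaD k A p (m + 1) ∘ₗ cochainD k A (Forms k A p) p m =
      cochainD k A (Forms k A (p + 1)) (p + 1) m ∘ₗ thetaD k A p m := by
  ext1 f
  funext ⟨n, h⟩
  match n, h with
  | 0, h => rfl
  | 1, h =>
    change theta k A p 0 0 = (-1 : k) ^ (m + 1) • coboundary k A (Forms k A (p + 1)) 0 0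
    rw [map_zero, map_zero, smul_zero]
  | n + 2, h =>
    have h' : (n : ℤ) = m + p := by push_cast at h; omega
    change theta k A p (n + 1) ((-1 : k) ^ (m + 1) • coboundary k A (Forms k A p) n (f ⟨n, h'⟩)) =
      (-1 : k) ^ (m + 1) •
        coboundary k A (Forms k A (p + 1)) (n + 1) (theta k A p n (f ⟨n, h'⟩))
    rw [map_smul, coboundary_theta]

lemma thetaD_embed (p n : ℕ) (m : ℤ) (h : (n : ℤ) = m + p)
    (f : RedPow k A n →ₗ[k] Forms k A p) :
    thetaD k A p m (embed k A _ p n m h f) =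
      embed k A _ (p + 1) (n + 1) m (by push_cast; omega) (theta k A p n f) := by
  funext ⟨n', h'⟩
  obtain rfl : n' = n + 1 := by push_cast at h'; omega
  rw [embed_apply]
  change theta k A p n (embed k A _ p n m _ f ⟨n, _⟩) = _
  rw [embed_apply]

/-- The complex `C^*(A, Ω^p(A))`, with `Ω^p(A)` in degree `-p`. -/
noncomputable abbrev formsCochains (p : ℕ) : CochainComplex (ModuleCat.{max u v} k) ℤ :=
  gradedHochschildCochains k A (Forms k A p) p

/-- The morphism of complexes `θ_p : C^*(A, Ω^p(A)) → C^*(A, Ω^{p+1}(A))`. -/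
noncomputable def thetaHom (p : ℕ) : formsCochains k A p ⟶ formsCochains k A (p + 1) :=
  CochainComplex.ofHom (X := formsCochains k A p) (Y := formsCochains k A (p + 1))
    (fun m => ModuleCat.ofHom (thetaD k A p m))
    (fun m => by
      simp only [formsCochains, gradedHochschildCochains, CochainComplex.of_d]
      rw [← ModuleCat.ofHom_comp, ← ModuleCat.ofHom_comp, thetaD_comm])

/-- The inductive system `C^*(A, A) → C^*(A, Ω^1(A)) → C^*(A, Ω^2(A)) → ⋯`. -/
noncomputable def singularSystem : ℕ ⥤ CochainComplex (ModuleCat.{max u v} k) ℤ :=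
  Functor.ofSequence (thetaHom k A)

/-- The singular Hochschild cochain complex `C_sg^*(A, A)`, the colimit of the `C^*(A, Ω^p(A))`
along the `θ_p`. -/
noncomputable def singularHochschild : CochainComplex (ModuleCat.{max u v} k) ℤ :=
  Limits.colimit (singularSystem k A)

/-- The structure morphism `C^*(A, Ω^p(A)) → C_sg^*(A, A)`. -/
noncomputable def toSingular (p : ℕ) : formsCochains k A p ⟶ singularHochschild k A :=
  Limits.colimit.ι (singularSystem k A) p

lemma theta_toSingular (p : ℕ) : thetaHom k A p ≫ toSingular k A (p + 1) = toSingular k A p := by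
  have h := Limits.colimit.w (singularSystem k A) (homOfLE (Nat.le_add_right p 1))
  rw [singularSystem, Functor.ofSequence_map_homOfLE_succ] at h
  exact h

end SingularComplex

section TateComplex

/-- The identification `Ā^{⊗0} = k`. -/
noncomputable def redPowZero : RedPow k A 0 ≃ₗ[k] k :=
  PiTensorProduct.isEmptyEquiv (R := k) (s := fun _ : Fin 0 => RedAlg k A) (Fin 0)

/-- An element `m` of `M`, regarded as the map `Ā^{⊗0} = k → M`, `1 ↦ m`. -/
noncomputable def const (M : Type w) [AddCommGroup M] [Module k M] :
    M →ₗ[k] (RedPow k A 0 →ₗ[k] M) :=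
  LinearMap.mk₂ k (fun m t => redPowZero k A t • m)
    (fun _ _ _ => smul_add _ _ _) (fun _ _ _ => smul_comm _ _ _)
    (fun _ _ _ => by rw [map_add, add_smul]) (fun _ _ _ => by rw [map_smul, smul_assoc])

lemma const_apply (M : Type w) [AddCommGroup M] [Module k M] (m : M) (t : RedPow k A 0) :
    const k A M m t = redPowZero k A t • m := rfl

lemma coboundary_const (M : Type w) [AddCommGroup M] [Module k M] [Module A M]
    [IsScalarTower k A M] [Module Aᵐᵒᵖ M] [IsScalarTower k Aᵐᵒᵖ M] (m : M) (t : RedPow k A 0)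
    (b : A) : coboundary k A M 0 (const k A M m) (snocEquiv k A 0 (t ⊗ₜ red k A b)) =
      redPowZero k A t • (b • m - MulOpposite.op b • m) := by
  rw [coboundary_snoc, rAct_zero_tmul, leftExt_tmul, const_apply, pow_zero, one_smul,
    MulOpposite.smul_eq_mul_unop, one_mul, MulOpposite.unop_op, smul_sub, smul_comm b,
    smul_comm (MulOpposite.op b)]

/-- The map `μ : A^∨ → A`, `∑ xᵢ ⊗ yᵢ ↦ ∑ xᵢ yᵢ`. -/
noncomputable def mu : Dual k A →ₗ[k] A := LinearMap.mul' k A ∘ₗ dualIncl k A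

lemma mu_op_smul (b : A) (z : Dual k A) : mu k A (MulOpposite.op b • z) = mu k A (b • z) := by
  rw [mu, LinearMap.comp_apply, LinearMap.comp_apply, dualIncl_op_smul, dualIncl_smul]
  induction dualIncl k A z with
  | zero => simp
  | add x y hx hy => simp only [map_add, hx, hy]
  | tmul x y => simp [mul_assoc]

lemma mu_central (b : A) (z : Dual k A) : b * mu k A z = mu k A z * b := by
  have h1 : ∀ z : A ⊗[k] A, b * LinearMap.mul' k A z =
      LinearMap.mul' k A ((LinearMap.mulLeft k b).rTensor A z) := by
    intro z
    induction z with
    | zero => simp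
    | add x y hx hy => simp only [map_add, mul_add, hx, hy]
    | tmul x y => simp [mul_assoc]
  have h2 : ∀ z : A ⊗[k] A, LinearMap.mul' k A z * b =
      LinearMap.mul' k A ((LinearMap.mulRight k b).lTensor A z) := by
    intro z
    induction z with
    | zero => simp
    | add x y hx hy => simp only [map_add, add_mul, hx, hy]
    | tmul x y => simp [mul_assoc]
  rw [mu, LinearMap.comp_apply, h1, h2, dualIncl_mem]

/-- The map `μ`, from `C_0(A, A^∨) = A^∨ ⊗ Ā^{⊗0}` to `C^0(A, A) = Hom(Ā^{⊗0}, A)`. -/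
noncomputable def muZero : Dual k A ⊗[k] RedPow k A 0 →ₗ[k] (RedPow k A 0 →ₗ[k] A) :=
  const k A A ∘ₗ mu k A ∘ₗ (TensorProduct.rid k (Dual k A)).toLinearMap ∘ₗ
    (redPowZero k A).toLinearMap.lTensor _

lemma muZero_tmul (z : Dual k A) (t : RedPow k A 0) :
    muZero k A (z ⊗ₜ t) = redPowZero k A t • const k A A (mu k A z) := by
  simp [muZero]

lemma muZero_boundary : muZero k A ∘ₗ boundary k A (Dual k A) 0 = 0 := by
  apply ext_cat
  intro x c
  rw [LinearMap.comp_apply, boundary_cat, pow_zero, one_smul, map_sub, LinearMap.zero_apply,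
    sub_eq_zero]
  induction x with
  | zero => simp
  | add x y hx hy => rw [map_add, map_add, smul_add, map_add, hx, hy]
  | tmul z t =>
    rw [rAct_zero_tmul, TensorProduct.smul_tmul', muZero_tmul, muZero_tmul, mu_op_smul]

lemma coboundary_muZero : coboundary k A A 0 ∘ₗ muZero k A = 0 := by
  apply TensorProduct.ext'
  intro z t
  apply ext_snoc
  intro s b
  rw [LinearMap.comp_apply, muZero_tmul, map_smul, LinearMap.smul_apply, coboundary_const,
    smul_eq_mul, MulOpposite.smul_eq_mul_unop, MulOpposite.unop_op, mu_central, sub_self,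
    smul_zero, smul_zero]
  rfl

/-- The data gluing `C_*(A, A^∨)` and `C^*(A, A)` along `μ`. -/
noncomputable def tateConnect :
    CochainComplex.ConnectData (hochschildChains k A (Dual k A)) (hochschildCochains k A A) where
  d₀ := ModuleCat.ofHom (muZero k A)
  comp_d₀ := by
    have h : (hochschildChains k A (Dual k A)).d 1 0 = _ := hochschildChains_d k A (Dual k A) 0
    rw [h]
    exact (ModuleCat.ofHom_comp _ _).symm.trans
      ((congrArg ModuleCat.ofHom (muZero_boundary k A)).trans rfl)
  d₀_comp := by
    have h : (hochschildCochains k A A).d 0 1 = _ := hochschildCochains_d k A A 0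
    rw [h]
    refine (ModuleCat.ofHom_comp _ _).symm.trans ?_
    rw [LinearMap.smul_comp, coboundary_muZero, smul_zero]
    rfl

/-- The generalized Tate–Hochschild complex
`𝒟^*(A, A) : ⋯ → C_1(A, A^∨) → A^∨ → A → C^1(A, A) → ⋯`, with `C^i(A, A)` in degree `i` and
`C_i(A, A^∨)` in degree `-i-1`. -/
noncomputable def tateHochschild : CochainComplex (ModuleCat.{max u v} k) ℤ :=
  (tateConnect k A).cochainComplex

/-- The identification `A = Ω^0(A)`. -/
noncomputable def toFormsZero : A →ₗ[k] Forms k A 0 :=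
  (TensorProduct.mk k A (RedPow k A 0)).flip ((redPowZero k A).symm 1)

lemma toFormsZero_smul (a m : A) : toFormsZero k A (a • m) = a • toFormsZero k A m := rfl

lemma toFormsZero_op_smul (a m : A) :
    toFormsZero k A (MulOpposite.op a • m) = MulOpposite.op a • toFormsZero k A m := rfl

/-- The map `ι^n` for `n ≥ 0`, sending `f ∈ C^n(A, A)` to itself, regarded as an element of
`C^n(A, Ω^0(A))`. -/
noncomputable def iotaPos (n : ℕ) :
    (RedPow k A n →ₗ[k] A) →ₗ[k] CochainSpace k A (Forms k A 0) 0 (Int.ofNat n) :=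
  embed k A (Forms k A 0) 0 n (Int.ofNat n) (by simp) ∘ₗ
    LinearMap.compRight k (toFormsZero k A)

/-- The map `ι^{-n-1}`, sending `α ∈ C_n(A, A^∨)` to the element `iotaNeg α` of
`A ⊗ Ā^{⊗(n+1)}`, regarded as an element of `C^{-n-1}(A, Ω^{n+1}(A))` with no arguments. -/
noncomputable def iotaNegSucc (n : ℕ) :
    Dual k A ⊗[k] RedPow k A n →ₗ[k] CochainSpace k A (Forms k A (n + 1)) (n + 1) (Int.negSucc n) :=
  embed k A (Forms k A (n + 1)) (n + 1) 0 (Int.negSucc n) (by simp [Int.negSucc_eq]) ∘ₗ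
    const k A (Forms k A (n + 1)) ∘ₗ iotaNeg k A n

lemma coboundary_iotaNeg_zero (α : Dual k A ⊗[k] RedPow k A 0) :
    coboundary k A (Forms k A 1) 0 (const k A (Forms k A 1) (iotaNeg k A 0 α)) =
      theta k A 0 0 (toFormsZero k A ∘ₗ muZero k A α) := by
  have key : ∀ t : RedPow k A 0, redPowZero k A t • actMap k A 0 (spread k A 0 α) =
      toFormsZero k A (muZero k A α t) := by
    intro t
    induction α with
    | zero => simp
    | add x y hx hy => simp only [map_add, smul_add, LinearMap.add_apply, hx, hy]
    | tmul z s =>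
      rw [muZero_tmul, LinearMap.smul_apply, const_apply, map_smul, map_smul, smul_comm]
      congr 1
      have : ∀ w : A ⊗[k] A, actMap k A 0 (interchange k A 0 (w ⊗ₜ s)) =
          redPowZero k A s • toFormsZero k A (LinearMap.mul' k A w) := by
        intro w
        induction w with
        | zero => simp
        | add x y hx hy => simp only [TensorProduct.add_tmul, map_add, smul_add, hx, hy]
        | tmul x y =>
          have e : s = redPowZero k A s • (redPowZero k A).symm 1 := by
            rw [← map_smul, smul_eq_mul, mul_one, LinearEquiv.symm_apply_apply]
          rw [LinearMap.mul'_apply]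
          change (x * y) ⊗ₜ[k] s = redPowZero k A s • ((x * y) ⊗ₜ[k] (redPowZero k A).symm 1)
          rw [← TensorProduct.tmul_smul, ← e]
      exact this _
  apply ext_snoc
  intro t b
  rw [coboundary_const, iota_smul_sub, theta_snoc, LinearMap.comp_apply, ← key,
    ← TensorProduct.smul_tmul', map_smul]

lemma coboundary_iotaNeg_succ (n : ℕ) (α : Dual k A ⊗[k] RedPow k A (n + 1)) :
    coboundary k A (Forms k A (n + 2)) 0 (const k A (Forms k A (n + 2)) (iotaNeg k A (n + 1) α)) =
      (-1 : k) ^ (n + 1) • theta k A (n + 1) 0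
        (const k A (Forms k A (n + 1)) (iotaNeg k A n (boundary k A (Dual k A) n α))) := by
  apply ext_snoc
  intro t b
  rw [coboundary_const, iota_smul_sub, actMap_spread, LinearMap.smul_apply, theta_snoc,
    const_apply, ← TensorProduct.smul_tmul' ((-1 : k) ^ (n + 1)), map_smul,
    ← TensorProduct.smul_tmul' (redPowZero k A t), map_smul, smul_comm]

lemma iotaPos_comm (n : ℕ) :
    cochainD k A (Forms k A 0) 0 (Int.ofNat n) ∘ₗ iotaPos k A n =
      iotaPos k A (n + 1) ∘ₗ ((-1 : k) ^ (n + 1) • coboundary k A A n) := by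
  ext1 f
  change cochainD k A (Forms k A 0) 0 (Int.ofNat n)
    (embed k A (Forms k A 0) 0 n (Int.ofNat n) _ (toFormsZero k A ∘ₗ f)) =
    embed k A (Forms k A 0) 0 (n + 1) (Int.ofNat (n + 1)) _
      (toFormsZero k A ∘ₗ ((-1 : k) ^ (n + 1) • coboundary k A A n f))
  rw [cochainD_embed, coboundary_comp k A A (toFormsZero k A) (toFormsZero_smul k A)
    (toFormsZero_op_smul k A), LinearMap.comp_smul, map_smul]
  have : (-1 : k) ^ (Int.ofNat n + 1) = (-1 : k) ^ (n + 1) := by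
    rw [← zpow_natCast]; rfl
  rw [this]
  rfl

lemma iotaNegSucc_zero_comm :
    cochainD k A (Forms k A 1) 1 (Int.negSucc 0) ∘ₗ iotaNegSucc k A 0 =
      thetaD k A 0 (Int.ofNat 0) ∘ₗ iotaPos k A 0 ∘ₗ muZero k A := by
  refine LinearMap.ext fun α => ?_
  change cochainD k A (Forms k A 1) 1 (Int.negSucc 0)
    (embed k A (Forms k A 1) 1 0 (Int.negSucc 0) _ (const k A (Forms k A 1) (iotaNeg k A 0 α))) =
    thetaD k A 0 (Int.ofNat 0) (embed k A (Forms k A 0) 0 0 (Int.ofNat 0) _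
      (toFormsZero k A ∘ₗ muZero k A α))
  rw [cochainD_embed, thetaD_embed, coboundary_iotaNeg_zero]
  have : (-1 : k) ^ (Int.negSucc 0 + 1) = 1 := by simp
  rw [this, one_smul]
  rfl

lemma iotaNegSucc_succ_comm (n : ℕ) :
    cochainD k A (Forms k A (n + 2)) (n + 2) (Int.negSucc (n + 1)) ∘ₗ iotaNegSucc k A (n + 1) =
      thetaD k A (n + 1) (Int.negSucc n) ∘ₗ iotaNegSucc k A n ∘ₗ boundary k A (Dual k A) n := by
  refine LinearMap.ext fun α => ?_
  change cochainD k A (Forms k A (n + 2)) (n + 2) (Int.negSucc (n + 1))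
    (embed k A (Forms k A (n + 2)) (n + 2) 0 (Int.negSucc (n + 1)) _
      (const k A (Forms k A (n + 2)) (iotaNeg k A (n + 1) α))) =
    thetaD k A (n + 1) (Int.negSucc n) (embed k A (Forms k A (n + 1)) (n + 1) 0 (Int.negSucc n) _
      (const k A (Forms k A (n + 1)) (iotaNeg k A n (boundary k A (Dual k A) n α))))
  rw [cochainD_embed, thetaD_embed, coboundary_iotaNeg_succ, map_smul, smul_smul]
  have : (-1 : k) ^ (Int.negSucc (n + 1) + 1) * (-1 : k) ^ (n + 1) = 1 := by
    have e : Int.negSucc (n + 1) + 1 = -((n + 1 : ℕ) : ℤ) := by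
      rw [Int.negSucc_eq]; push_cast; ring
    rw [e, zpow_neg, zpow_natCast, inv_mul_cancel₀ (pow_ne_zero _ (by simp))]
  rw [this, one_smul]
  rfl

/-- `iotaPos` as a morphism of `k`-modules. -/
noncomputable def iotaPosHom (n : ℕ) :
    (hochschildCochains k A A).X n ⟶ (formsCochains k A 0).X (Int.ofNat n) :=
  ModuleCat.ofHom (iotaPos k A n)

/-- `iotaNegSucc` as a morphism of `k`-modules. -/
noncomputable def iotaNegHom (n : ℕ) :
    (hochschildChains k A (Dual k A)).X n ⟶ (formsCochains k A (n + 1)).X (Int.negSucc n) :=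
  ModuleCat.ofHom (iotaNegSucc k A n)

lemma iotaPosHom_comm (n : ℕ) :
    iotaPosHom k A n ≫ (formsCochains k A 0).d (Int.ofNat n) (Int.ofNat (n + 1)) =
      (hochschildCochains k A A).d n (n + 1) ≫ iotaPosHom k A (n + 1) := by
  have h1 : (formsCochains k A 0).d (Int.ofNat n) (Int.ofNat (n + 1)) = _ :=
    gradedHochschildCochains_d k A (Forms k A 0) 0 (Int.ofNat n)
  rw [h1, hochschildCochains_d]
  exact congrArg ModuleCat.ofHom (iotaPos_comm k A n)

lemma iotaNegHom_zero_comm :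
    iotaNegHom k A 0 ≫ (formsCochains k A 1).d (Int.negSucc 0) (Int.ofNat 0) =
      (tateConnect k A).d₀ ≫ iotaPosHom k A 0 ≫ (thetaHom k A 0).f (Int.ofNat 0) := by
  have h1 : (formsCochains k A 1).d (Int.negSucc 0) (Int.ofNat 0) = _ :=
    gradedHochschildCochains_d k A (Forms k A 1) 1 (Int.negSucc 0)
  rw [h1]
  exact congrArg ModuleCat.ofHom (iotaNegSucc_zero_comm k A)

lemma iotaNegHom_succ_comm (n : ℕ) :
    iotaNegHom k A (n + 1) ≫ (formsCochains k A (n + 2)).d (Int.negSucc (n + 1)) (Int.negSucc n) =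
      (hochschildChains k A (Dual k A)).d (n + 1) n ≫ iotaNegHom k A n ≫
        (thetaHom k A (n + 1)).f (Int.negSucc n) := by
  have h1 : (formsCochains k A (n + 2)).d (Int.negSucc (n + 1)) (Int.negSucc n) = _ :=
    gradedHochschildCochains_d k A (Forms k A (n + 2)) (n + 2) (Int.negSucc (n + 1))
  rw [h1, hochschildChains_d]
  exact congrArg ModuleCat.ofHom (iotaNegSucc_succ_comm k A n)

/-- The components of `ι`. -/
noncomputable def iotaF : ∀ i : ℤ, (tateHochschild k A).X i ⟶ (singularHochschild k A).X i
  | Int.ofNat n => iotaPosHom k A n ≫ (toSingular k A 0).f (Int.ofNat n)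
  | Int.negSucc n => iotaNegHom k A n ≫ (toSingular k A (n + 1)).f (Int.negSucc n)

/-- The natural morphism of complexes `ι^* : 𝒟^*(A, A) → C_sg^*(A, A)`. -/
noncomputable def iota : tateHochschild k A ⟶ singularHochschild k A where
  f := iotaF k A
  comm' := by
    rintro i j (rfl : i + 1 = j)
    match i with
    | Int.ofNat n =>
      change (iotaPosHom k A n ≫ (toSingular k A 0).f (Int.ofNat n)) ≫
        (singularHochschild k A).d (Int.ofNat n) (Int.ofNat (n + 1)) =
        (hochschildCochains k A A).d n (n + 1) ≫ iotaPosHom k A (n + 1) ≫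
          (toSingular k A 0).f (Int.ofNat (n + 1))
      rw [Category.assoc, HomologicalComplex.Hom.comm, ← Category.assoc, ← Category.assoc,
        iotaPosHom_comm]
    | Int.negSucc 0 =>
      change (iotaNegHom k A 0 ≫ (toSingular k A 1).f (Int.negSucc 0)) ≫
        (singularHochschild k A).d (Int.negSucc 0) (Int.ofNat 0) =
        (tateConnect k A).d₀ ≫ iotaPosHom k A 0 ≫ (toSingular k A 0).f (Int.ofNat 0)
      rw [Category.assoc, HomologicalComplex.Hom.comm, ← Category.assoc, iotaNegHom_zero_comm,
        ← theta_toSingular k A 0, HomologicalComplex.comp_f]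
      simp only [Category.assoc]
    | Int.negSucc (n + 1) =>
      change (iotaNegHom k A (n + 1) ≫ (toSingular k A (n + 2)).f (Int.negSucc (n + 1))) ≫
        (singularHochschild k A).d (Int.negSucc (n + 1)) (Int.negSucc n) =
        (tateConnect k A).d (Int.negSucc (n + 1)) (Int.negSucc n) ≫
          iotaNegHom k A n ≫ (toSingular k A (n + 1)).f (Int.negSucc n)
      rw [Category.assoc, HomologicalComplex.Hom.comm, ← Category.assoc, iotaNegHom_succ_comm,
        ← theta_toSingular k A (n + 1), HomologicalComplex.comp_f,
        CochainComplex.ConnectData.d_negSucc]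
      simp only [Category.assoc]
      rfl

end TateComplex

end Complexes

end TateHochschild

namespace TateHochschild

open scoped TensorProduct
open CategoryTheory Limits

universe u v w

/-! ### Quasi-isomorphisms and sequential colimits in terms of elements. -/

section Categorical

/-! The engine is the short exact sequence of bimodules `0 → Ω^{p+1}(A) → Ω^p(A) ⊗ A → Ω^p(A) → 0`,
with inclusion `outerIncl` and quotient map `outerAct`; in the middle term `A` acts on the right
through the last factor only. As left modules it splits, by `outerUnit` and `outerRed`. The section
`outerUnit` is not right linear, and its defect is concatenation. Hence `θ` is, up to sign, the
connecting map of this sequence on Hochschild cohomology (`coboundary_outerUnit`).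

The middle term has no cohomology in positive degrees. Cochains with values in `M ⊗ A` correspond to
`A`-linear maps from the normalized bar resolution of `Hom_k(A, k)` to `M` (`adjunct`,
`exists_adjunct_eq`, `adjunct_barDiff`), so the cohomology is `Ext_A(Hom_k(A, k), M)`. For `M =
Ω^p(A)`, a free left module of finite rank over a self-injective algebra, this vanishes
(`injective_forms`, `exists_coboundary_eq`). Consequently, with `n` the number of arguments, `θ`
maps the cohomology at `n` onto that at `n + 1` for all `n ≥ 0` (`exists_theta_add_coboundary`), and
injectively for `n ≥ 1` (`exists_eq_coboundary_of_theta`).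

At `n = 0` cocycles are central elements, and the centre of `Ω^p(A) ⊗ A` is `A^∨ ⊗ Ā^{⊗p}`
(`exists_outerSpread_eq`). So classes without arguments killed by `θ` come from `A^∨ ⊗ Ā^{⊗p}`
(`exists_const_actMap_eq`), and central elements of `Ω^{p+1}(A)` lie in the image of `iotaNeg`
(`exists_iotaNeg_eq`).

For surjectivity of `ι` on cohomology, a class at level `p` is moved down along `θ` until either `p
= 0` or no argument is left; in both cases it is in the image of `ι` (`exists_iotaMap_add_sgD`). For
injectivity, a primitive found at a high level is moved down along `θ`; when the arguments run out,
the description of the kernel of `θ` produces a chain whose boundary, or whose image under `μ`, is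
the given element up to sign (`exists_tateD_eq`).

When `Ā ≠ 0`, every `θ` is injective on cochains, hence so are the structure maps of the colimit;
together with `dual_red_injective` this gives injectivity of `ι` in each degree, and it lets cocycle
conditions be checked in the colimit. When `Ā = 0`, the singular complex is zero and `𝒟^*(A, A)` is
acyclic because `μ` is bijective (`mu_bijective`). If moreover the dimension is not one, then `A =
0` and injectivity is trivial. -/

lemma cycles_exists_of_apply_eq_zero {k : Type u} [Ring k] {S : ShortComplex (ModuleCat.{v} k)}
    (x : S.X₂) (hx : S.g x = 0) : ∃ c : S.cycles, S.iCycles c = x :=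
  ⟨S.moduleCatCyclesIso.inv (⟨x, hx⟩ : LinearMap.ker S.g.hom),
    ConcreteCategory.congr_hom S.moduleCatCyclesIso_inv_iCycles (⟨x, hx⟩ : LinearMap.ker S.g.hom)⟩

/-- Homology embeds into the opcycles, which are the cokernel of `S.f`, so vanishing can be tested
there. -/
lemma homologyπ_eq_zero_iff {k : Type u} [Ring k] {S : ShortComplex (ModuleCat.{v} k)}
    (c : S.cycles) : S.homologyπ c = 0 ↔ ∃ w, S.f w = S.iCycles c := by
  have h1 : S.homologyι (S.homologyπ c) = S.pOpcycles (S.iCycles c) :=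
    ConcreteCategory.congr_hom S.homology_π_ι c
  have h2 : Function.Injective S.homologyι := (ModuleCat.mono_iff_injective _).1 inferInstance
  rw [← h2.eq_iff, h1, map_zero]
  exact S.moduleCat_pOpcycles_eq_zero_iff _

/-- A morphism of short complexes of modules inducing a bijection on homology, elementwise. -/
lemma shortComplex_quasiIso_of_elements {k : Type u} [Ring k]
    {S₁ S₂ : ShortComplex (ModuleCat.{v} k)} (φ : S₁ ⟶ S₂)
    (hs : ∀ y : S₂.X₂, S₂.g y = 0 → ∃ x : S₁.X₂, S₁.g x = 0 ∧ ∃ z : S₂.X₁, y = φ.τ₂ x + S₂.f z)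
    (hi : ∀ x : S₁.X₂, S₁.g x = 0 → ∀ z : S₂.X₁, φ.τ₂ x = S₂.f z → ∃ w : S₁.X₁, x = S₁.f w) :
    ShortComplex.QuasiIso φ := by
  rw [ShortComplex.quasiIso_iff, ConcreteCategory.isIso_iff_bijective]
  have hsurj : ∀ (S : ShortComplex (ModuleCat.{v} k)), Function.Surjective S.homologyπ :=
    fun S => (ModuleCat.epi_iff_surjective _).1 inferInstance
  have hg : ∀ (S : ShortComplex (ModuleCat.{v} k)) (c : S.cycles), S.g (S.iCycles c) = 0 :=
    fun S c => (ConcreteCategory.congr_hom S.iCycles_g c)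
  have hπ : ∀ c : S₁.cycles, ShortComplex.homologyMap φ (S₁.homologyπ c) =
      S₂.homologyπ (ShortComplex.cyclesMap φ c) :=
    fun c => ConcreteCategory.congr_hom (ShortComplex.homologyπ_naturality φ) c
  have hc : ∀ c : S₁.cycles, S₂.iCycles (ShortComplex.cyclesMap φ c) = φ.τ₂ (S₁.iCycles c) :=
    fun c => ConcreteCategory.congr_hom (ShortComplex.cyclesMap_i φ) c
  constructor
  · rw [injective_iff_map_eq_zero]
    intro a ha
    obtain ⟨c, rfl⟩ := hsurj _ a
    rw [hπ, homologyπ_eq_zero_iff] at ha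
    obtain ⟨z, hz⟩ := ha
    obtain ⟨w, hw⟩ := hi (S₁.iCycles c) (hg _ c) z (by rw [hz, hc])
    exact (homologyπ_eq_zero_iff c).2 ⟨w, hw.symm⟩
  · intro b
    obtain ⟨c, rfl⟩ := hsurj _ b
    obtain ⟨x, hx, z, hz⟩ := hs (S₂.iCycles c) (hg _ c)
    obtain ⟨d, rfl⟩ := cycles_exists_of_apply_eq_zero x hx
    refine ⟨S₁.homologyπ d, ?_⟩
    rw [hπ, ← sub_eq_zero, ← map_sub, homologyπ_eq_zero_iff]
    refine ⟨-z, ?_⟩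
    rw [map_sub, map_neg, hc, hz]
    abel

/-- A morphism of cochain complexes of modules inducing a bijection on cohomology, elementwise. -/
lemma quasiIso_of_elements {k : Type u} [Ring k] {K L : CochainComplex (ModuleCat.{v} k) ℤ}
    (φ : K ⟶ L)
    (hs : ∀ (i : ℤ) (y : L.X (i + 1)), L.d (i + 1) (i + 1 + 1) y = 0 →
      ∃ x : K.X (i + 1), K.d (i + 1) (i + 1 + 1) x = 0 ∧
        ∃ z : L.X i, y = φ.f (i + 1) x + L.d i (i + 1) z)
    (hi : ∀ (i : ℤ) (x : K.X (i + 1)), K.d (i + 1) (i + 1 + 1) x = 0 →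
      ∀ z : L.X i, φ.f (i + 1) x = L.d i (i + 1) z → ∃ w : K.X i, x = K.d i (i + 1) w) :
    QuasiIso φ := by
  rw [quasiIso_iff]
  intro j
  -- Writing the degree as a successor makes both neighbouring differentials of the form `d m (m +
  -- 1)`.
  obtain ⟨i, rfl⟩ : ∃ i, j = i + 1 := ⟨j - 1, by ring⟩
  rw [quasiIsoAt_iff' φ i (i + 1) (i + 1 + 1) (by simp) (by simp)]
  exact shortComplex_quasiIso_of_elements _ (hs i) (hi i)

/-- Filtered colimits of abelian groups are computed on underlying sets; `shrink` lowers the size of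
the index category to universe `0`, where `ℕ` lives. -/
instance (k : Type u) [Ring k] :
    PreservesColimitsOfShape ℕ (forget (ModuleCat.{max u v} k)) := by
  have : PreservesFilteredColimitsOfSize.{0, 0} (forget AddCommGrpCat.{max u v}) :=
    preservesFilteredColimitsOfSize_shrink _
  have : PreservesColimitsOfShape ℕ (forget AddCommGrpCat.{max u v}) :=
    PreservesFilteredColimitsOfSize.preserves_filtered_colimits ℕ
  exact inferInstanceAs (PreservesColimitsOfShape ℕ
    (forget₂ (ModuleCat.{max u v} k) AddCommGrpCat.{max u v} ⋙ forget AddCommGrpCat.{max u v}))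

section Sequence

variable {k : Type u} [Ring k] {X : ℕ → CochainComplex (ModuleCat.{max u v} k) ℤ}
  (f : ∀ n, X n ⟶ X (n + 1))

lemma colimit_exists_rep (i : ℤ) (y : (colimit (Functor.ofSequence f)).X i) :
    ∃ (p : ℕ) (x : (X p).X i), (colimit.ι (Functor.ofSequence f) p).f i x = y :=
  Concrete.isColimit_exists_rep _
    (isColimitOfPreserves (HomologicalComplex.eval _ _ i)
      (colimit.isColimit (Functor.ofSequence f))) y

/-- Elements identified in a filtered colimit already agree at a finite stage, and the transition
maps to that stage are composites of injections. -/
lemma colimit_ι_injective (hf : ∀ n i, Function.Injective ((f n).f i)) (p : ℕ) (i : ℤ) :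
    Function.Injective ((colimit.ι (Functor.ofSequence f) p).f i) := by
  have h : ∀ m, Function.Injective
      (((Functor.ofSequence f).map (homOfLE (Nat.le_add_right p m))).f i) := by
    intro m
    induction m with
    | zero =>
      rw [show homOfLE (Nat.le_add_right p 0) = 𝟙 p from rfl, CategoryTheory.Functor.map_id]
      exact fun _ _ h => h
    | succ m ih =>
      rw [show homOfLE (Nat.le_add_right p (m + 1)) = homOfLE (Nat.le_add_right p m) ≫
        homOfLE (Nat.le_add_right (p + m) 1) from rfl, Functor.map_comp,
        Functor.ofSequence_map_homOfLE_succ]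
      exact (hf (p + m) i).comp ih
  intro x y hxy
  obtain ⟨q, a, b, hab⟩ := Concrete.isColimit_exists_of_rep_eq _
    (isColimitOfPreserves (HomologicalComplex.eval _ _ i)
      (colimit.isColimit (Functor.ofSequence f))) x y hxy
  obtain ⟨m, rfl⟩ := Nat.exists_eq_add_of_le (leOfHom a)
  exact h m hab

end Sequence

end Categorical

/-! ### The bimodule `M ⊗ A` with outer actions, and contraction with functionals. -/

section OuterBimodule

variable (k : Type u) (A : Type v) [Field k] [Ring A] [Algebra k A]

/-- `M ⊗ A`, with `A` acting on the left through `M` and on the right through `A`. -/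
def Outer (M : Type w) [AddCommGroup M] [Module k M] : Type (max v w) := M ⊗[k] A

variable (M : Type w) [AddCommGroup M] [Module k M]

noncomputable instance : AddCommGroup (Outer k A M) := inferInstanceAs (AddCommGroup (M ⊗[k] A))

noncomputable instance : Module k (Outer k A M) := inferInstanceAs (Module k (M ⊗[k] A))

noncomputable instance [Module A M] [IsScalarTower k A M] : Module A (Outer k A M) :=
  inferInstanceAs (Module A (M ⊗[k] A))

instance [Module A M] [IsScalarTower k A M] : IsScalarTower k A (Outer k A M) :=
  inferInstanceAs (IsScalarTower k A (M ⊗[k] A))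

/-- The pure tensor `m ⊗ a`, as an element of `Outer k A M`. -/
noncomputable def outerMk : M →ₗ[k] A →ₗ[k] Outer k A M := TensorProduct.mk k M A

variable {k A M}

/-- The linear map on `Outer k A M` induced by a bilinear map. -/
noncomputable def outerLift {N : Type*} [AddCommGroup N] [Module k N] (B : M →ₗ[k] A →ₗ[k] N) :
    Outer k A M →ₗ[k] N := TensorProduct.lift B

@[simp]
lemma outerLift_mk {N : Type*} [AddCommGroup N] [Module k N] (B : M →ₗ[k] A →ₗ[k] N) (m : M)
    (a : A) : outerLift B (outerMk k A M m a) = B m a := rfl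

lemma outer_ext {N : Type*} [AddCommGroup N] [Module k N] {f g : Outer k A M →ₗ[k] N}
    (h : ∀ m a, f (outerMk k A M m a) = g (outerMk k A M m a)) : f = g :=
  TensorProduct.ext' h

lemma smul_outerMk [Module A M] [IsScalarTower k A M] (a : A) (m : M) (b : A) :
    a • outerMk k A M m b = outerMk k A M (a • m) b := rfl

variable (k A M)

/-- Right multiplication on the second factor of `M ⊗ A`. -/
noncomputable def outerRight (a : A) : Outer k A M →ₗ[k] Outer k A M :=
  outerLift ((outerMk k A M).compl₂ (LinearMap.mulRight k a))

@[simp]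
lemma outerRight_mk (a : A) (m : M) (b : A) :
    outerRight k A M a (outerMk k A M m b) = outerMk k A M m (b * a) := rfl

noncomputable instance : Module Aᵐᵒᵖ (Outer k A M) where
  smul a x := outerRight k A M a.unop x
  one_smul x := LinearMap.congr_fun (f := outerRight k A M 1) (g := LinearMap.id)
    (outer_ext fun m b => by simp) x
  mul_smul a b x := LinearMap.congr_fun (f := outerRight k A M (b.unop * a.unop))
    (g := outerRight k A M a.unop ∘ₗ outerRight k A M b.unop)
    (outer_ext fun m c => by simp [mul_assoc]) x
  smul_zero _ := map_zero _
  smul_add _ := map_add _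
  add_smul a b x := LinearMap.congr_fun (f := outerRight k A M (a.unop + b.unop))
    (g := outerRight k A M a.unop + outerRight k A M b.unop)
    (outer_ext fun m c => by simp [mul_add]) x
  zero_smul x := LinearMap.congr_fun (f := outerRight k A M 0) (g := 0)
    (outer_ext fun m b => by simp) x

@[simp]
lemma op_smul_outerMk (a : A) (m : M) (b : A) :
    MulOpposite.op a • outerMk k A M m b = outerMk k A M m (b * a) := rfl

instance : IsScalarTower k Aᵐᵒᵖ (Outer k A M) where
  smul_assoc c a x := LinearMap.congr_fun (f := outerRight k A M (c • a.unop))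
    (g := c • outerRight k A M a.unop) (outer_ext fun m b => by simp) x

instance [Module A M] [IsScalarTower k A M] : SMulCommClass A Aᵐᵒᵖ (Outer k A M) where
  smul_comm a b x := LinearMap.congr_fun
    (f := Algebra.lsmul k k (Outer k A M) a ∘ₗ outerRight k A M b.unop)
    (g := outerRight k A M b.unop ∘ₗ Algebra.lsmul k k (Outer k A M) a)
    (outer_ext fun m c => by simp [smul_outerMk]) x

variable {k A}

/-- Contraction `m ⊗ a ↦ φ(a) m` of `M ⊗ A` with a functional on `A`. -/
noncomputable def contract (φ : Module.Dual k A) : Outer k A M →ₗ[k] M :=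
  outerLift ((LinearMap.lsmul k M).flip.compl₂ φ)

@[simp]
lemma contract_mk (φ : Module.Dual k A) (m : M) (a : A) :
    contract M φ (outerMk k A M m a) = φ a • m := rfl

lemma contract_smul [Module A M] [IsScalarTower k A M] (φ : Module.Dual k A) (a : A)
    (x : Outer k A M) : contract M φ (a • x) = a • contract M φ x :=
  LinearMap.congr_fun (f := contract M φ ∘ₗ Algebra.lsmul k k _ a)
    (g := Algebra.lsmul k k _ a ∘ₗ contract M φ)
    (outer_ext fun m b => by
      simp only [LinearMap.comp_apply, Algebra.lsmul_coe, smul_outerMk, contract_mk]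
      exact smul_comm _ _ _) x

/-- This converts the right action on `M ⊗ A` into the left action of `A` on `Hom_k(A, k)`, which is
the module resolved by the bar complex below. -/
lemma contract_op_smul (φ : Module.Dual k A) (a : A) (x : Outer k A M) :
    contract M φ (MulOpposite.op a • x) = contract M (φ ∘ₗ LinearMap.mulRight k a) x :=
  LinearMap.congr_fun (f := contract M φ ∘ₗ outerRight k A M a)
    (g := contract M (φ ∘ₗ LinearMap.mulRight k a)) (outer_ext fun m b => by simp) x

lemma contract_add (φ ψ : Module.Dual k A) : contract M (φ + ψ) = contract M φ + contract M ψ :=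
  outer_ext fun m b => by simp [add_smul]

lemma contract_const_smul (c : k) (φ : Module.Dual k A) :
    contract M (c • φ) = c • contract M φ :=
  outer_ext fun m b => by simp [mul_smul]

/-- The coordinate functionals of a `k`-basis of `A` already separate points; the basis may be
infinite. -/
lemma eq_of_contract_eq {x y : Outer k A M}
    (h : ∀ φ : Module.Dual k A, contract M φ x = contract M φ y) : x = y := by
  classical
  let e := Module.Basis.ofVectorSpace k A
  have key : ∀ (z : Outer k A M) i, TensorProduct.equivFinsuppOfBasisRight (M := M) e z i =
      contract M (e.coord i) z := by
    intro z i
    refine LinearMap.congr_fun (f := Finsupp.lapply i ∘ₗ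
      (TensorProduct.equivFinsuppOfBasisRight (M := M) e).toLinearMap) (g := contract M (e.coord i))
      (TensorProduct.ext' fun m a => ?_) z
    exact TensorProduct.equivFinsuppOfBasisRight_apply_tmul_apply e m a i
  apply (TensorProduct.equivFinsuppOfBasisRight (M := M) e).injective
  ext i
  exact (key x i).trans ((h _).trans (key y i).symm)

end OuterBimodule

/-! ### The normalized bar resolution and its contracting homotopy. -/

section BarResolution

variable (k : Type u) (A : Type v) [Field k] [Ring A] [Algebra k A]

/-- The pure tensor `a ⊗ t` as a differential form. -/
noncomputable def formsMk (n : ℕ) : A →ₗ[k] RedPow k A n →ₗ[k] Forms k A n :=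
  TensorProduct.mk k A (RedPow k A n)

variable {k A} in
lemma forms_ext {n : ℕ} {N : Type*} [AddCommGroup N] [Module k N] {f g : Forms k A n →ₗ[k] N}
    (h : ∀ a t, f (formsMk k A n a t) = g (formsMk k A n a t)) : f = g :=
  TensorProduct.ext' h

lemma smul_formsMk (n : ℕ) (a b : A) (t : RedPow k A n) :
    a • formsMk k A n b t = formsMk k A n (a * b) t := rfl

lemma op_smul_formsMk_zero (a b : A) (t : RedPow k A 0) :
    MulOpposite.op a • formsMk k A 0 b t = formsMk k A 0 (b * a) t := rfl

/-- The operator `a₀ ⊗ ā₁ ⊗ ⋯ ⊗ āₙ ↦ 1 ⊗ ā₀ ⊗ ⋯ ⊗ āₙ` on forms. -/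
noncomputable def formsDiff : (n : ℕ) → Forms k A n →ₗ[k] Forms k A (n + 1)
  | 0 => (formsCat k A 0).toLinearMap ∘ₗ
      TensorProduct.map (formsMk k A 0 1) (red k A) ∘ₗ
        (TensorProduct.comm k A (RedPow k A 0)).toLinearMap
  | n + 1 => (formsCat k A (n + 1)).toLinearMap ∘ₗ (formsDiff n).rTensor _ ∘ₗ
      (formsCat k A n).symm.toLinearMap

lemma formsDiff_zero (a : A) (t : RedPow k A 0) :
    formsDiff k A 0 (formsMk k A 0 a t) = formsCat k A 0 (formsMk k A 0 1 t ⊗ₜ red k A a) := rfl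

lemma formsDiff_cat (n : ℕ) (x : Forms k A n) (v : RedAlg k A) :
    formsDiff k A (n + 1) (formsCat k A n (x ⊗ₜ v)) =
      formsCat k A (n + 1) (formsDiff k A n x ⊗ₜ v) := by
  simp [formsDiff]

variable {k A} in
lemma forms_ext_cat {n : ℕ} {N : Type*} [AddCommGroup N] [Module k N]
    {f g : Forms k A (n + 1) →ₗ[k] N}
    (h : ∀ x a, f (formsCat k A n (x ⊗ₜ red k A a)) = g (formsCat k A n (x ⊗ₜ red k A a))) :
    f = g := ext_cat h

/-- This is the graded Leibniz rule `d(ω a) = (dω) a + (-1)^n ω da`. Its last term becomes the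
identity in the homotopy formula for the bar complex. -/
lemma formsDiff_op_smul (n : ℕ) (a : A) (x : Forms k A n) :
    formsDiff k A n (MulOpposite.op a • x) =
      MulOpposite.op a • formsDiff k A n x + (-1 : k) ^ n • formsCat k A n (x ⊗ₜ red k A a) := by
  suffices h : ∀ a : A, formsDiff k A n ∘ₗ rmul k A _ a = rmul k A _ a ∘ₗ formsDiff k A n +
      (-1 : k) ^ n • (formsCatRight k A n (red k A a)) from LinearMap.congr_fun (h a) x
  clear x a
  intro a
  induction n generalizing a with
  | zero =>
    apply forms_ext
    intro m t
    simp only [LinearMap.comp_apply, LinearMap.add_apply, LinearMap.smul_apply, rmul_apply,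
      formsCatRight_apply]
    rw [op_smul_formsMk_zero, formsDiff_zero, formsDiff_zero, op_smul_formsCat, pow_zero, one_smul,
      op_smul_formsMk_zero, one_mul, sub_add_cancel]
  | succ n ih =>
    apply forms_ext_cat
    intro x c
    have := LinearMap.congr_fun (ih c) x
    simp only [LinearMap.comp_apply, LinearMap.add_apply, LinearMap.smul_apply, rmul_apply,
      formsCatRight_apply] at this ⊢
    rw [op_smul_formsCat, map_sub, formsDiff_cat, formsDiff_cat, this, formsDiff_cat,
      op_smul_formsCat, TensorProduct.add_tmul, map_add, pow_succ, mul_neg_one, neg_smul,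
      ← TensorProduct.smul_tmul' ((-1 : k) ^ n), map_smul]
    abel

variable {X : Type*} [AddCommGroup X] [Module k X] (ρ : A →ₐ[k] Module.End k X)

/-- The bilinear map `(ω, a) ↦ (x ↦ ω a ⊗ x - ω ⊗ a x)`. -/
noncomputable def barForm (n : ℕ) :
    Forms k A n →ₗ[k] A →ₗ[k] (X →ₗ[k] Forms k A n ⊗[k] X) :=
  LinearMap.mk₂ k (fun ω a => TensorProduct.mk k (Forms k A n) X (rmul k A _ a ω) -
      TensorProduct.mk k (Forms k A n) X ω ∘ₗ ρ a)
    (by intro x y a; simp only [map_add, LinearMap.add_comp]; abel)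
    (by intro c x a; simp only [map_smul, LinearMap.smul_comp, smul_sub])
    (by intro x a b; simp only [map_add, LinearMap.add_apply, LinearMap.comp_add]; abel)
    (by intro c x a; simp only [map_smul, LinearMap.smul_apply, LinearMap.comp_smul, smul_sub])

lemma barForm_apply (n : ℕ) (ω : Forms k A n) (a : A) (x : X) :
    barForm k A ρ n ω a x = (MulOpposite.op a • ω) ⊗ₜ x - ω ⊗ₜ ρ a x := rfl

/-- The differential `(ω ⊗ ā) ⊗ x ↦ ω a ⊗ x - ω ⊗ a x` of the normalized bar resolution of the
left `A`-module `X`, as a `k`-linear map. -/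
noncomputable def barAux (n : ℕ) : Forms k A (n + 1) ⊗[k] X →ₗ[k] Forms k A n ⊗[k] X :=
  TensorProduct.lift (descend (barForm k A ρ n) (by
    intro ω
    ext x
    simp [barForm_apply]) ∘ₗ (formsCat k A n).symm.toLinearMap)

lemma barAux_cat (n : ℕ) (ω : Forms k A n) (a : A) (x : X) :
    barAux k A ρ n (formsCat k A n (ω ⊗ₜ red k A a) ⊗ₜ x) =
      (MulOpposite.op a • ω) ⊗ₜ x - ω ⊗ₜ ρ a x := by
  rw [barAux, TensorProduct.lift.tmul, LinearMap.comp_apply, LinearEquiv.coe_coe,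
    LinearEquiv.symm_apply_apply, descend_tmul, barForm_apply]

/-- Linear maps out of `Ω^{n+1}(A) ⊗ X` are determined by their values on the `(ω ⊗ ā) ⊗ x`. -/
lemma ext_bar {n : ℕ} {N : Type*} [AddCommGroup N] [Module k N]
    {f g : Forms k A (n + 1) ⊗[k] X →ₗ[k] N}
    (h : ∀ ω a x, f (formsCat k A n (ω ⊗ₜ red k A a) ⊗ₜ x) =
      g (formsCat k A n (ω ⊗ₜ red k A a) ⊗ₜ x)) : f = g := by
  apply TensorProduct.ext
  apply forms_ext_cat
  intro ω a
  ext x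
  exact h ω a x

/-- The differential of the normalized bar resolution of the left `A`-module `X`. -/
noncomputable def barDiff (n : ℕ) : Forms k A (n + 1) ⊗[k] X →ₗ[A] Forms k A n ⊗[k] X :=
  { barAux k A ρ n with
    map_smul' := by
      intro a z
      suffices h : barAux k A ρ n ∘ₗ Algebra.lsmul k k _ a =
        Algebra.lsmul k k _ a ∘ₗ barAux k A ρ n from LinearMap.congr_fun h z
      apply ext_bar
      intro ω c x
      have : SMulCommClass Aᵐᵒᵖ A (Forms k A n) := SMulCommClass.symm A Aᵐᵒᵖ _
      change barAux k A ρ n ((a • formsCat k A n (ω ⊗ₜ red k A c)) ⊗ₜ x) =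
        a • barAux k A ρ n (formsCat k A n (ω ⊗ₜ red k A c) ⊗ₜ x)
      rw [smul_formsCat, barAux_cat, barAux_cat, smul_sub, TensorProduct.smul_tmul',
        TensorProduct.smul_tmul', smul_comm] }

/-- Up to sign, `formsDiff` is a contracting homotopy: the Leibniz term reproduces the element
itself and all other terms match. -/
lemma barDiff_formsDiff (n : ℕ) (z : Forms k A (n + 1) ⊗[k] X) :
    barDiff k A ρ (n + 1) ((formsDiff k A (n + 1)).rTensor X z) =
      (formsDiff k A n).rTensor X (barDiff k A ρ n z) - (-1 : k) ^ n • z := by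
  suffices h : barAux k A ρ (n + 1) ∘ₗ (formsDiff k A (n + 1)).rTensor X =
      (formsDiff k A n).rTensor X ∘ₗ barAux k A ρ n - (-1 : k) ^ n • LinearMap.id from
    LinearMap.congr_fun h z
  apply ext_bar
  intro ω a x
  simp only [LinearMap.comp_apply, LinearMap.sub_apply, LinearMap.smul_apply, LinearMap.id_apply,
    LinearMap.rTensor_tmul]
  rw [formsDiff_cat, barAux_cat, barAux_cat, map_sub, LinearMap.rTensor_tmul,
    LinearMap.rTensor_tmul, formsDiff_op_smul, TensorProduct.add_tmul, TensorProduct.smul_tmul']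
  abel

/-- The bar resolution is exact. -/
lemma exists_barDiff_eq (n : ℕ) (z : Forms k A (n + 1) ⊗[k] X) (hz : barDiff k A ρ n z = 0) :
    ∃ y, barDiff k A ρ (n + 1) y = z := by
  -- The scalar cancels the factor `-(-1)^n` of the homotopy formula.
  refine ⟨-((-1 : k) ^ n • (formsDiff k A (n + 1)).rTensor X z), ?_⟩
  have : barDiff k A ρ (n + 1) ((-1 : k) ^ n • (formsDiff k A (n + 1)).rTensor X z) =
    (-1 : k) ^ n • barDiff k A ρ (n + 1) ((formsDiff k A (n + 1)).rTensor X z) :=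
    map_smul (barAux k A ρ (n + 1)) _ _
  rw [map_neg, this, barDiff_formsDiff, hz, map_zero, zero_sub, smul_neg, neg_neg, smul_smul,
    ← mul_pow]
  simp

end BarResolution

/-! ### Vanishing of the cohomology of `M ⊗ A` for injective `M`. -/

section Vanishing

/-- Both maps factor through `M ⧸ ker d`, which embeds into `N`, and injectivity of `Q` extends
along that embedding. This is exactness of `Hom(-, Q)` in the form needed for the bar resolution. -/
lemma exists_comp_eq_of_ker_le {R M N : Type*} [Ring R] [AddCommGroup M] [Module R M]
    [Small.{w} R] {Q : Type w} [AddCommGroup Q] [Module R Q] [Module.Injective R Q]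
    [AddCommGroup N] [Module R N] (d : M →ₗ[R] N) (f : M →ₗ[R] Q)
    (h : LinearMap.ker d ≤ LinearMap.ker f) : ∃ g : N →ₗ[R] Q, g ∘ₗ d = f := by
  obtain ⟨g, hg⟩ := Module.Injective.extension_property R Q _ _
    ((LinearMap.ker d).liftQ d le_rfl)
    (LinearMap.ker_eq_bot.1 (Submodule.ker_liftQ_eq_bot _ _ _ le_rfl))
    ((LinearMap.ker d).liftQ f h)
  refine ⟨g, LinearMap.ext fun x => ?_⟩
  exact LinearMap.congr_fun hg (Submodule.Quotient.mk x)

variable (k : Type u) (A : Type v) [Field k] [Ring A] [Algebra k A]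

/-- The left action `(a φ)(y) = φ(y a)` of `A` on its dual space. -/
noncomputable def dualAct : A →ₐ[k] Module.End k (Module.Dual k A) where
  toFun a := (LinearMap.mulRight k a).dualMap
  map_one' := by ext; simp
  map_mul' a b := by ext; simp [mul_assoc]
  map_zero' := by ext; simp
  map_add' a b := by ext; simp [mul_add]
  commutes' c := by ext; simp [Algebra.algebraMap_eq_smul_one]

variable {k A}
variable {M : Type w} [AddCommGroup M] [Module k M] [Module A M] [IsScalarTower k A M]

/-- The `A`-linear map `Ω^n(A) ⊗ Hom(A, k) → M` corresponding to a cochain with values in `M ⊗ A`. -/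
noncomputable def adjunct {n : ℕ} (f : RedPow k A n →ₗ[k] Outer k A M) :
    Forms k A n ⊗[k] Module.Dual k A →ₗ[A] M :=
  { TensorProduct.lift (LinearMap.mk₂ k
      (fun (ω : Forms k A n) (φ : Module.Dual k A) => contract M φ (leftExt f ω))
      (by intro x y φ; exact (congrArg _ (map_add (leftExt f) x y)).trans (map_add _ _ _))
      (by intro c x φ; exact (congrArg _ (map_smul (leftExt f) c x)).trans (map_smul _ _ _))
      (by intro x φ ψ; rw [contract_add, LinearMap.add_apply])
      (by intro c x φ; rw [contract_const_smul, LinearMap.smul_apply])) with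
    map_smul' := by
      intro a z
      induction z with
      | zero => simp
      | add x y hx hy =>
        simp only [AddHom.toFun_eq_coe, LinearMap.coe_toAddHom, RingHom.id_apply, smul_add,
          map_add] at hx hy ⊢
        rw [hx, hy]
      | tmul ω φ =>
        refine Eq.trans ?_ (contract_smul M φ a (leftExt f ω))
        exact congrArg _ (leftExt_smul f a ω) }

lemma adjunct_tmul {n : ℕ} (f : RedPow k A n →ₗ[k] Outer k A M) (ω : Forms k A n)
    (φ : Module.Dual k A) : adjunct f (ω ⊗ₜ φ) = contract M φ (leftExt f ω) := rfl

/-- The cochain is `t ↦ ∑ G((1 ⊗ t) ⊗ eᵢ*) ⊗ eᵢ` for a basis `eᵢ` of `A` with dual basis `eᵢ*`;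
finite dimension makes the sum finite and the `eᵢ*` span the dual. -/
lemma exists_adjunct_eq [FiniteDimensional k A] {n : ℕ}
    (G : Forms k A n ⊗[k] Module.Dual k A →ₗ[A] M) :
    ∃ g : RedPow k A n →ₗ[k] Outer k A M, adjunct g = G := by
  let e := Module.finBasis k A
  let G' : Forms k A n ⊗[k] Module.Dual k A →ₗ[k] M := G.restrictScalars k
  let g : RedPow k A n →ₗ[k] Outer k A M := ∑ i, (outerMk k A M).flip (e i) ∘ₗ G' ∘ₗ
    (TensorProduct.mk k (Forms k A n) (Module.Dual k A)).flip (e.coord i) ∘ₗ formsMk k A n 1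
  refine ⟨g, ?_⟩
  have hg : ∀ t, g t = ∑ i, outerMk k A M (G' (formsMk k A n 1 t ⊗ₜ e.coord i)) (e i) := by
    intro t
    simp only [g, LinearMap.sum_apply]
    rfl
  have key : ∀ t φ, contract M φ (g t) = G' (formsMk k A n 1 t ⊗ₜ φ) := by
    intro t φ
    rw [hg, map_sum]
    conv_rhs => rw [← e.sum_dual_apply_smul_coord φ, TensorProduct.tmul_sum, map_sum]
    refine Finset.sum_congr rfl fun i _ => ?_
    rw [contract_mk, TensorProduct.tmul_smul, map_smul]
  suffices h : (adjunct (M := M) g).restrictScalars k = G' from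
    LinearMap.ext fun z => LinearMap.congr_fun h z
  apply TensorProduct.ext
  apply forms_ext
  intro a t
  ext φ
  change contract M φ (a • g t) = G (formsMk k A n a t ⊗ₜ φ)
  rw [contract_smul, key]
  change a • G (formsMk k A n 1 t ⊗ₜ φ) = _
  rw [← map_smul, TensorProduct.smul_tmul', smul_formsMk, mul_one]

lemma leftExt_coboundary_forms (n : ℕ) (f : RedPow k A n →ₗ[k] Outer k A M) (x : Forms k A n)
    (c : A) : leftExt (coboundary k A (Outer k A M) n f) (formsCat k A n (x ⊗ₜ red k A c)) =
      (-1 : k) ^ n • (leftExt f (MulOpposite.op c • x : Forms k A n) -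
        MulOpposite.op c • leftExt f x) :=
  leftExt_coboundary k A (Outer k A M) n f x c

/-- Up to sign, the adjunction carries the Hochschild differential to precomposition with the bar
differential, so the cohomology of `M ⊗ A` is that of `Hom_A` from the bar resolution to `M`. -/
lemma adjunct_barDiff (n : ℕ) (f : RedPow k A n →ₗ[k] Outer k A M)
    (z : Forms k A (n + 1) ⊗[k] Module.Dual k A) :
    adjunct f (barDiff k A (dualAct k A) n z) =
      (-1 : k) ^ n • adjunct (coboundary k A (Outer k A M) n f) z := by
  suffices h : (adjunct f).restrictScalars k ∘ₗ barAux k A (dualAct k A) n =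
      (-1 : k) ^ n • (adjunct (coboundary k A (Outer k A M) n f)).restrictScalars k from
    LinearMap.congr_fun h z
  apply ext_bar
  intro ω a φ
  rw [LinearMap.comp_apply, barAux_cat, map_sub, LinearMap.smul_apply]
  simp only [LinearMap.coe_restrictScalars, adjunct_tmul]
  rw [leftExt_coboundary_forms, map_smul, smul_smul, ← mul_pow, neg_one_mul, neg_neg, one_pow,
    one_smul, map_sub, contract_op_smul]
  rfl

lemma leftExt_mk {n : ℕ} (f : RedPow k A n →ₗ[k] M) (a : A) (t : RedPow k A n) :
    leftExt f (formsMk k A n a t) = a • f t := rfl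

lemma adjunct_add {n : ℕ} (f g : RedPow k A n →ₗ[k] Outer k A M)
    (z : Forms k A n ⊗[k] Module.Dual k A) : adjunct (f + g) z = adjunct f z + adjunct g z := by
  refine LinearMap.congr_fun (f := (adjunct (f + g)).restrictScalars k)
    (g := (adjunct f).restrictScalars k + (adjunct g).restrictScalars k)
    (TensorProduct.ext (forms_ext fun a t => LinearMap.ext fun φ => ?_)) z
  change contract M φ (a • (f t + g t)) = contract M φ (a • f t) + contract M φ (a • g t)
  rw [smul_add, map_add]

lemma adjunct_zero {n : ℕ} (z : Forms k A n ⊗[k] Module.Dual k A) :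
    adjunct (0 : RedPow k A n →ₗ[k] Outer k A M) z = 0 := by
  simpa using adjunct_add (M := M) 0 0 z

lemma eq_of_adjunct_eq {n : ℕ} {f g : RedPow k A n →ₗ[k] Outer k A M}
    (h : adjunct f = adjunct g) : f = g := by
  refine LinearMap.ext fun t => eq_of_contract_eq M fun φ => ?_
  have := LinearMap.congr_fun h (formsMk k A n 1 t ⊗ₜ φ)
  rwa [adjunct_tmul, adjunct_tmul, leftExt_mk, leftExt_mk, one_smul, one_smul] at this

lemma adjunct_smul {n : ℕ} (c : k) (f : RedPow k A n →ₗ[k] Outer k A M)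
    (z : Forms k A n ⊗[k] Module.Dual k A) : adjunct (c • f) z = c • adjunct f z := by
  refine LinearMap.congr_fun (f := (adjunct (c • f)).restrictScalars k)
    (g := c • (adjunct f).restrictScalars k)
    (TensorProduct.ext (forms_ext fun a t => LinearMap.ext fun φ => ?_)) z
  change contract M φ (a • c • f t) = c • contract M φ (a • f t)
  rw [smul_comm, map_smul]

/-- The Hochschild cohomology of `M ⊗ A` vanishes in positive degrees if `M` is injective. -/
lemma exists_coboundary_eq [FiniteDimensional k A] [Small.{w} A] [Module.Injective A M] (n : ℕ)
    (f : RedPow k A (n + 1) →ₗ[k] Outer k A M)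
    (hf : coboundary k A (Outer k A M) (n + 1) f = 0) :
    ∃ g, coboundary k A (Outer k A M) n g = f := by
  -- A cocycle's adjunct kills the image of the next bar differential, which by exactness is the
  -- kernel of this one.
  obtain ⟨G, hG⟩ := exists_comp_eq_of_ker_le (barDiff k A (dualAct k A) n) (adjunct f) (by
    intro z hz
    obtain ⟨y, rfl⟩ := exists_barDiff_eq k A _ n z hz
    rw [LinearMap.mem_ker, adjunct_barDiff, hf, adjunct_zero, smul_zero])
  obtain ⟨g, rfl⟩ := exists_adjunct_eq G
  -- The sign compensates for the one in `adjunct_barDiff`.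
  refine ⟨(-1 : k) ^ n • g, eq_of_adjunct_eq (LinearMap.ext fun z => ?_)⟩
  rw [map_smul, adjunct_smul, ← adjunct_barDiff, ← hG]
  rfl

end Vanishing

/-! ### Injectivity of the modules of forms. -/

section Injectivity

/-- The module of forms over a self-injective algebra is injective. -/
lemma injective_forms (k : Type u) (A : Type v) [Field k] [Ring A] [Algebra k A]
    [FiniteDimensional k A] [Module.Injective A A] (n : ℕ) :
    Module.Injective A (Forms k A n) := by
  have : Module.Free k (RedPow k A n) :=
    Module.Free.of_basis (Basis.piTensorProduct fun _ : Fin n => Module.finBasis k (RedAlg k A))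
  -- A `k`-basis of `Ā^{⊗n}` exhibits the forms as a finite power of `A`. Baer's criterion then
  -- transports injectivity between modules in different universes.
  let e := (Algebra.TensorProduct.basis A (Module.finBasis k (RedPow k A n))).equivFun.symm
  exact Module.Baer.injective (Module.Baer.of_equiv e
    (Module.Baer.of_injective (Module.Injective.pi A fun _ => A)))

end Injectivity

/-! ### The short exact sequence relating `Ω^{p+1}(A)`, `Ω^p(A) ⊗ A` and `Ω^p(A)`. -/

section FormsSequence

variable (k : Type u) (A : Type v) [Field k] [Ring A] [Algebra k A] (p : ℕ)

/-- The action map `Ω^p(A) ⊗ A → Ω^p(A)`, `ω ⊗ a ↦ ω a`. -/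
noncomputable def outerAct : Outer k A (Forms k A p) →ₗ[k] Forms k A p :=
  outerLift (rmul k A (Forms k A p)).flip

/-- The left `A`-linear section `ω ↦ ω ⊗ 1` of the action map. -/
noncomputable def outerUnit : Forms k A p →ₗ[k] Outer k A (Forms k A p) :=
  (outerMk k A (Forms k A p)).flip 1

/-- The left `A`-linear map `Ω^p(A) ⊗ A → Ω^{p+1}(A)`, `ω ⊗ a ↦ ω ⊗ ā`. -/
noncomputable def outerRed : Outer k A (Forms k A p) →ₗ[k] Forms k A (p + 1) :=
  outerLift ((TensorProduct.mk k (Forms k A p) (RedAlg k A)).compr₂ (formsCat k A p).toLinearMap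
    |>.compl₂ (red k A))

/-- The bimodule map `Ω^{p+1}(A) → Ω^p(A) ⊗ A`, `ω ⊗ ā ↦ ω ⊗ a - ω a ⊗ 1`. -/
noncomputable def outerIncl : Forms k A (p + 1) →ₗ[k] Outer k A (Forms k A p) :=
  descend (outerMk k A (Forms k A p) -
    (rmul k A (Forms k A p)).flip.compr₂ (outerUnit k A p)) (by
      intro ω
      simp [outerUnit]) ∘ₗ (formsCat k A p).symm.toLinearMap

@[simp]
lemma outerAct_mk (ω : Forms k A p) (a : A) :
    outerAct k A p (outerMk k A _ ω a) = MulOpposite.op a • ω := rfl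

lemma outerUnit_apply (ω : Forms k A p) : outerUnit k A p ω = outerMk k A _ ω 1 := rfl

@[simp]
lemma outerRed_mk (ω : Forms k A p) (a : A) :
    outerRed k A p (outerMk k A _ ω a) = formsCat k A p (ω ⊗ₜ red k A a) := rfl

@[simp]
lemma outerIncl_cat (ω : Forms k A p) (a : A) :
    outerIncl k A p (formsCat k A p (ω ⊗ₜ red k A a)) =
      outerMk k A _ ω a - outerMk k A _ (MulOpposite.op a • ω) 1 := by
  rw [outerIncl, LinearMap.comp_apply, LinearEquiv.coe_coe, LinearEquiv.symm_apply_apply,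
    descend_tmul]
  rfl

lemma outerAct_incl (ω : Forms k A (p + 1)) : outerAct k A p (outerIncl k A p ω) = 0 :=
  LinearMap.congr_fun (f := outerAct k A p ∘ₗ outerIncl k A p) (g := 0)
    (forms_ext_cat fun ω a => by simp) ω

lemma outerRed_incl (ω : Forms k A (p + 1)) : outerRed k A p (outerIncl k A p ω) = ω :=
  LinearMap.congr_fun (f := outerRed k A p ∘ₗ outerIncl k A p) (g := LinearMap.id)
    (forms_ext_cat fun ω a => by simp [red_one]) ω

lemma outerIncl_injective : Function.Injective (outerIncl k A p) :=
  Function.LeftInverse.injective (outerRed_incl k A p)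

lemma outerAct_unit (ω : Forms k A p) : outerAct k A p (outerUnit k A p ω) = ω := by
  simp [outerUnit_apply]

/-- Together with the identities for the composites above, this is the splitting of the short exact
sequence; exactness in the middle is read off from it. -/
lemma outer_decomposition (z : Outer k A (Forms k A p)) :
    outerIncl k A p (outerRed k A p z) + outerUnit k A p (outerAct k A p z) = z :=
  LinearMap.congr_fun (f := outerIncl k A p ∘ₗ outerRed k A p + outerUnit k A p ∘ₗ outerAct k A p)
    (g := LinearMap.id) (outer_ext fun ω a => by simp [outerUnit_apply]) z

lemma outerAct_smul (a : A) (z : Outer k A (Forms k A p)) :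
    outerAct k A p (a • z) = a • outerAct k A p z :=
  LinearMap.congr_fun (f := outerAct k A p ∘ₗ Algebra.lsmul k k _ a)
    (g := Algebra.lsmul k k _ a ∘ₗ outerAct k A p)
    (outer_ext fun ω b => by
      simp only [LinearMap.comp_apply, Algebra.lsmul_coe, smul_outerMk, outerAct_mk]
      exact (smul_comm _ _ _).symm) z

lemma outerAct_op_smul (a : A) (z : Outer k A (Forms k A p)) :
    outerAct k A p (MulOpposite.op a • z) = MulOpposite.op a • outerAct k A p z :=
  LinearMap.congr_fun (f := outerAct k A p ∘ₗ rmul k A _ a) (g := rmul k A _ a ∘ₗ outerAct k A p)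
    (outer_ext fun ω b => by simp [mul_smul]) z

lemma outerIncl_smul (a : A) (ω : Forms k A (p + 1)) :
    outerIncl k A p (a • ω) = a • outerIncl k A p ω :=
  LinearMap.congr_fun (f := outerIncl k A p ∘ₗ Algebra.lsmul k k _ a)
    (g := Algebra.lsmul k k _ a ∘ₗ outerIncl k A p)
    (forms_ext_cat fun ω b => by
      have : SMulCommClass Aᵐᵒᵖ A (Forms k A p) := SMulCommClass.symm A Aᵐᵒᵖ _
      simp only [LinearMap.comp_apply, Algebra.lsmul_coe, smul_formsCat, outerIncl_cat, smul_sub,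
        smul_outerMk]
      rw [smul_comm]) ω

lemma outerIncl_op_smul (a : A) (ω : Forms k A (p + 1)) :
    outerIncl k A p (MulOpposite.op a • ω) = MulOpposite.op a • outerIncl k A p ω :=
  LinearMap.congr_fun (f := outerIncl k A p ∘ₗ rmul k A _ a)
    (g := rmul k A _ a ∘ₗ outerIncl k A p)
    (forms_ext_cat fun ω b => by
      simp only [LinearMap.comp_apply, rmul_apply, op_smul_formsCat, map_sub, outerIncl_cat,
        op_smul_outerMk, MulOpposite.op_mul, mul_smul, one_mul]
      abel) ω

/-- The failure of the section `ω ↦ ω ⊗ 1` to be right linear is concatenation with `ā`, which is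
the source of `θ`. -/
lemma outerUnit_op_smul (a : A) (ω : Forms k A p) :
    outerUnit k A p (MulOpposite.op a • ω) = MulOpposite.op a • outerUnit k A p ω -
      outerIncl k A p (formsCat k A p (ω ⊗ₜ red k A a)) := by
  simp [outerUnit_apply]

variable {p}

lemma leftExt_outerUnit {n : ℕ} (f : RedPow k A n →ₗ[k] Forms k A p) (x : Forms k A n) :
    leftExt (outerUnit k A p ∘ₗ f) x = outerUnit k A p (leftExt f x) :=
  LinearMap.congr_fun (f := leftExt (outerUnit k A p ∘ₗ f)) (g := outerUnit k A p ∘ₗ leftExt f)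
    (TensorProduct.ext' fun _ _ => rfl) x

lemma coboundary_snoc_forms (M : Type w) [AddCommGroup M] [Module k M] [Module A M]
    [IsScalarTower k A M] [Module Aᵐᵒᵖ M] [IsScalarTower k Aᵐᵒᵖ M] (n : ℕ)
    (f : RedPow k A n →ₗ[k] M) (t : RedPow k A n) (a : A) :
    coboundary k A M n f (snocEquiv k A n (t ⊗ₜ red k A a)) = (-1 : k) ^ n •
      (leftExt f (MulOpposite.op a • formsMk k A n 1 t : Forms k A n) - MulOpposite.op a • f t) :=
  coboundary_snoc k A M n f t a

/-- For a cocycle `f` the first term on the right vanishes, so lifting `f` by the section and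
differentiating gives `∓ θ f`: `θ` represents the connecting map up to sign. -/
lemma coboundary_outerUnit {n : ℕ} (f : RedPow k A n →ₗ[k] Forms k A p) :
    coboundary k A (Outer k A (Forms k A p)) n (outerUnit k A p ∘ₗ f) =
      outerUnit k A p ∘ₗ coboundary k A (Forms k A p) n f -
        (-1 : k) ^ n • (outerIncl k A p ∘ₗ theta k A p n f) := by
  apply ext_snoc
  intro t a
  simp only [LinearMap.sub_apply, LinearMap.smul_apply, LinearMap.comp_apply, theta_snoc]
  rw [coboundary_snoc_forms, coboundary_snoc_forms, leftExt_outerUnit, LinearMap.comp_apply,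
    map_smul, map_sub, outerUnit_op_smul, ← smul_sub]
  congr 1
  abel

lemma coboundary_outerIncl {n : ℕ} (f : RedPow k A n →ₗ[k] Forms k A (p + 1)) :
    coboundary k A (Outer k A (Forms k A p)) n (outerIncl k A p ∘ₗ f) =
      outerIncl k A p ∘ₗ coboundary k A (Forms k A (p + 1)) n f :=
  coboundary_comp k A _ _ (outerIncl_smul k A p) (outerIncl_op_smul k A p) n f

lemma coboundary_outerAct {n : ℕ} (f : RedPow k A n →ₗ[k] Outer k A (Forms k A p)) :
    coboundary k A (Forms k A p) n (outerAct k A p ∘ₗ f) =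
      outerAct k A p ∘ₗ coboundary k A (Outer k A (Forms k A p)) n f :=
  coboundary_comp k A _ _ (outerAct_smul k A p) (outerAct_op_smul k A p) n f

variable {k A}

section SelfInjective

variable [FiniteDimensional k A] [Module.Injective A A]

lemma exists_coboundary_eq_outer (n : ℕ) (f : RedPow k A (n + 1) →ₗ[k] Outer k A (Forms k A p))
    (hf : coboundary k A (Outer k A (Forms k A p)) (n + 1) f = 0) :
    ∃ g, coboundary k A (Outer k A (Forms k A p)) n g = f := by
  have := injective_forms k A p
  exact exists_coboundary_eq n f hf

/-- The map induced by `θ` on cohomology is surjective in positive degrees. -/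
lemma exists_theta_add_coboundary {n : ℕ} (g : RedPow k A (n + 1) →ₗ[k] Forms k A (p + 1))
    (hg : coboundary k A (Forms k A (p + 1)) (n + 1) g = 0) :
    ∃ f h, coboundary k A (Forms k A p) n f = 0 ∧
      g = theta k A p n f + coboundary k A (Forms k A (p + 1)) n h := by
  -- In the middle term the cocycle acquires a primitive `h`; its image under `outerAct` is, up to
  -- sign, the preimage under `θ`, and `outerRed ∘ h` is the correction.
  obtain ⟨h, hh⟩ := exists_coboundary_eq_outer n (outerIncl k A p ∘ₗ g) (by
    rw [coboundary_outerIncl, hg, LinearMap.comp_zero])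
  have hf : coboundary k A (Forms k A p) n (outerAct k A p ∘ₗ h) = 0 := by
    rw [coboundary_outerAct, hh]
    ext1
    ext t
    exact outerAct_incl k A p _
  refine ⟨-((-1 : k) ^ n • (outerAct k A p ∘ₗ h)), outerRed k A p ∘ₗ h, ?_, ?_⟩
  · rw [map_neg, map_smul, hf, smul_zero, neg_zero]
  · have hd : h = outerIncl k A p ∘ₗ (outerRed k A p ∘ₗ h) +
        outerUnit k A p ∘ₗ (outerAct k A p ∘ₗ h) :=
      LinearMap.ext fun t => (outer_decomposition k A p (h t)).symm
    rw [hd, map_add, coboundary_outerIncl, coboundary_outerUnit, hf, LinearMap.comp_zero,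
      zero_sub, ← LinearMap.comp_smul, ← LinearMap.comp_neg, ← LinearMap.comp_add] at hh
    -- All terms of the differentiated splitting of `h` now lie in the image of `outerIncl`, which
    -- can be cancelled.
    refine LinearMap.ext fun t => outerIncl_injective k A p ?_
    rw [map_neg, map_smul, add_comm (-_)]
    exact (LinearMap.congr_fun hh t).symm

/-- The map induced by `θ` on cohomology is injective in positive degrees. -/
lemma exists_eq_coboundary_of_theta {n : ℕ} (f : RedPow k A (n + 1) →ₗ[k] Forms k A p)
    (hf : coboundary k A (Forms k A p) (n + 1) f = 0)
    (e : RedPow k A (n + 1) →ₗ[k] Forms k A (p + 1))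
    (he : theta k A p (n + 1) f = coboundary k A (Forms k A (p + 1)) (n + 1) e) :
    ∃ e', f = coboundary k A (Forms k A p) n e' := by
  -- The correction by `e` turns the lift of `f` into a cocycle of `Ω^p(A) ⊗ A`. Projecting a
  -- primitive of it by `outerAct` gives one of `f`, since `outerAct` kills the correction.
  obtain ⟨h, hh⟩ := exists_coboundary_eq_outer n
    (outerUnit k A p ∘ₗ f + (-1 : k) ^ (n + 1) • (outerIncl k A p ∘ₗ e)) (by
      rw [map_add, map_smul, coboundary_outerUnit, coboundary_outerIncl, hf, he,
        LinearMap.comp_zero, zero_sub, neg_add_cancel])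
  refine ⟨outerAct k A p ∘ₗ h, ?_⟩
  rw [coboundary_outerAct, hh]
  refine LinearMap.ext fun t => ?_
  simp [outerAct_unit, outerAct_incl]

end SelfInjective

/-! ### Central elements of `Ω^p(A) ⊗ A`. -/

section Central

/-- Expanding along the basis of `V` writes `x` as a finite sum `∑ cᵢ ⊗ bᵢ`, with all `cᵢ` in `N` by
hypothesis. -/
lemma exists_rTensor_subtype_eq {R M V ι : Type*} [CommSemiring R] [AddCommMonoid M] [Module R M]
    [AddCommMonoid V] [Module R V] [DecidableEq ι] (b : Module.Basis ι R V) (N : Submodule R M)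
    (x : M ⊗[R] V) (h : ∀ i, TensorProduct.equivFinsuppOfBasisRight b x i ∈ N) :
    ∃ w : N ⊗[R] V, N.subtype.rTensor V w = x := by
  set c := TensorProduct.equivFinsuppOfBasisRight (M := M) b x with hc
  refine ⟨∑ i ∈ c.support, (⟨c i, h i⟩ : N) ⊗ₜ b i, ?_⟩
  rw [map_sum, ← (TensorProduct.equivFinsuppOfBasisRight b).symm_apply_apply x, ← hc,
    TensorProduct.equivFinsuppOfBasisRight_symm_apply]
  rfl

lemma equivFinsuppOfBasisRight_rTensor {R M N V ι : Type*} [CommSemiring R] [AddCommMonoid M]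
    [Module R M] [AddCommMonoid N] [Module R N] [AddCommMonoid V] [Module R V] [DecidableEq ι]
    (b : Module.Basis ι R V) (L : M →ₗ[R] N) (x : M ⊗[R] V) (i : ι) :
    TensorProduct.equivFinsuppOfBasisRight b (L.rTensor V x) i =
      L (TensorProduct.equivFinsuppOfBasisRight b x i) :=
  LinearMap.congr_fun (f := Finsupp.lapply i ∘ₗ
      (TensorProduct.equivFinsuppOfBasisRight (M := N) b).toLinearMap ∘ₗ L.rTensor V)
    (g := L ∘ₗ Finsupp.lapply i ∘ₗ (TensorProduct.equivFinsuppOfBasisRight (M := M) b).toLinearMap)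
    (TensorProduct.ext' fun m v => by simp) x

variable (k A p) in
/-- The map `spread`, with values in the bimodule `Ω^p(A) ⊗ A`. -/
noncomputable def outerSpread : Dual k A ⊗[k] RedPow k A p →ₗ[k] Outer k A (Forms k A p) :=
  spread k A p

lemma outerAct_spread (w : Dual k A ⊗[k] RedPow k A p) :
    outerAct k A p (outerSpread k A p w) = actMap k A p (spread k A p w) := rfl

lemma outerRed_spread (w : Dual k A ⊗[k] RedPow k A p) :
    outerRed k A p (outerSpread k A p w) = iotaNeg k A p w :=
  LinearMap.congr_fun (f := outerRed k A p)
    (g := (formsCat k A p).toLinearMap ∘ₗ (red k A).lTensor _) (outer_ext fun _ _ => rfl) _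

/-- The centre of the bimodule `Ω^p(A) ⊗ A` is `A^∨ ⊗ Ā^{⊗p}`. -/
lemma exists_outerSpread_eq (z : Outer k A (Forms k A p))
    (hz : ∀ a : A, a • z = MulOpposite.op a • z) : ∃ w, outerSpread k A p w = z := by
  classical
  obtain ⟨x, rfl⟩ : ∃ x, (interchange k A p x : Outer k A (Forms k A p)) = z :=
    (TensorProduct.rightComm k A A (RedPow k A p)).surjective z
  -- The middle factors `Ā^{⊗p}` are untouched by both actions, so along a basis of them centrality
  -- is a condition on each coordinate in `A ⊗ A`, namely membership in `A^∨`.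
  let b := Basis.piTensorProduct fun _ : Fin p => Module.Basis.ofVectorSpace k (RedAlg k A)
  have hx : ∀ a : A, ((LinearMap.mulLeft k a).rTensor A).rTensor (RedPow k A p) x =
      ((LinearMap.mulRight k a).lTensor A).rTensor (RedPow k A p) x := by
    intro a
    apply (TensorProduct.rightComm k A A (RedPow k A p)).injective
    have h1 : interchange k A p ∘ₗ ((LinearMap.mulLeft k a).rTensor A).rTensor _ =
        (Algebra.lsmul k k (Outer k A (Forms k A p)) a) ∘ₗ interchange k A p :=
      TensorProduct.ext_threefold fun x y t => rfl
    have h2 : interchange k A p ∘ₗ ((LinearMap.mulRight k a).lTensor A).rTensor _ =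
        outerRight k A (Forms k A p) a ∘ₗ interchange k A p :=
      TensorProduct.ext_threefold fun x y t => rfl
    exact (LinearMap.congr_fun h1 x).trans ((hz a).trans (LinearMap.congr_fun h2 x).symm)
  obtain ⟨w, hw⟩ := exists_rTensor_subtype_eq b (dualSubmodule k A) x (by
    intro i a
    have h := congrArg (fun y => TensorProduct.equivFinsuppOfBasisRight b y i) (hx a)
    simp only [equivFinsuppOfBasisRight_rTensor] at h
    exact h)
  refine ⟨w, ?_⟩
  rw [← hw]
  rfl

end Central

/-! ### Cochains without arguments: the low end of the long exact sequence. -/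

section DegreeZero

variable {M : Type w} [AddCommGroup M] [Module k M]

lemma exists_eq_const (f : RedPow k A 0 →ₗ[k] M) : ∃ m, f = const k A M m := by
  refine ⟨f ((redPowZero k A).symm 1), LinearMap.ext fun t => ?_⟩
  rw [const_apply, ← map_smul, ← map_smul, smul_eq_mul, mul_one, LinearEquiv.symm_apply_apply]

lemma const_injective : Function.Injective (const k A M) := by
  intro m m' h
  have := LinearMap.congr_fun h ((redPowZero k A).symm 1)
  simpa [const_apply] using this

/-- The differential of a constant is its commutator with `A`, so zero cocycles are the central
elements. -/
lemma coboundary_const_eq_zero_iff [Module A M] [IsScalarTower k A M] [Module Aᵐᵒᵖ M]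
    [IsScalarTower k Aᵐᵒᵖ M] (m : M) : coboundary k A M 0 (const k A M m) = 0 ↔
      ∀ a : A, a • m = MulOpposite.op a • m := by
  constructor
  · intro h a
    have := LinearMap.congr_fun h (snocEquiv k A 0 ((redPowZero k A).symm 1 ⊗ₜ red k A a))
    rwa [coboundary_const, LinearEquiv.apply_symm_apply, one_smul, LinearMap.zero_apply,
      sub_eq_zero] at this
  · intro h
    apply ext_snoc
    intro t a
    rw [coboundary_const, h, sub_self, smul_zero, LinearMap.zero_apply]

/-- A degree zero cocycle killed by `θ` on cohomology comes from `A^∨ ⊗ Ā^{⊗p}`. -/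
lemma exists_const_actMap_eq (f : RedPow k A 0 →ₗ[k] Forms k A p)
    (hf : coboundary k A (Forms k A p) 0 f = 0) (e : RedPow k A 0 →ₗ[k] Forms k A (p + 1))
    (he : theta k A p 0 f = coboundary k A (Forms k A (p + 1)) 0 e) :
    ∃ w, f = const k A _ (actMap k A p (spread k A p w)) := by
  -- The correction by `e` makes the lift of `f` a cocycle without arguments, hence a central
  -- element of `Ω^p(A) ⊗ A`; `outerAct` then recovers `f`.
  obtain ⟨z, hz⟩ := exists_eq_const (outerUnit k A p ∘ₗ f + outerIncl k A p ∘ₗ e)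
  have hc : coboundary k A (Outer k A (Forms k A p)) 0 (const k A _ z) = 0 := by
    rw [← hz, map_add, coboundary_outerUnit, coboundary_outerIncl, hf, he, LinearMap.comp_zero,
      zero_sub, pow_zero, one_smul, neg_add_cancel]
  obtain ⟨w, rfl⟩ := exists_outerSpread_eq z ((coboundary_const_eq_zero_iff z).1 hc)
  refine ⟨w, LinearMap.ext fun t => ?_⟩
  have := congrArg (outerAct k A p) (LinearMap.congr_fun hz t)
  rwa [LinearMap.add_apply, map_add, LinearMap.comp_apply, LinearMap.comp_apply, outerAct_unit,
    outerAct_incl, add_zero, const_apply, map_smul, outerAct_spread] at this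

/-- The central elements of `Ω^{p+1}(A)` come from `A^∨ ⊗ Ā^{⊗p}`. -/
lemma exists_iotaNeg_eq (ω : Forms k A (p + 1)) (hω : ∀ a : A, a • ω = MulOpposite.op a • ω) :
    ∃ w, iotaNeg k A p w = ω ∧ actMap k A p (spread k A p w) = 0 := by
  -- A bimodule map preserves central elements; `outerRed` recovers `ω`, and `outerAct` kills it.
  obtain ⟨w, hw⟩ := exists_outerSpread_eq (outerIncl k A p ω) (fun a => by
    rw [← outerIncl_smul, hω, outerIncl_op_smul])
  exact ⟨w, by rw [← outerRed_spread, hw, outerRed_incl],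
    by rw [← outerAct_spread, hw, outerAct_incl]⟩

end DegreeZero

end FormsSequence

/-! ### Injectivity of `θ` and of `ι` on cochains when `Ā ≠ 0`. -/

section Injective

variable {k : Type u} {A : Type v} [Field k] [Ring A] [Algebra k A]

lemma tmul_left_injective {M V : Type*} [AddCommGroup M] [Module k M] [AddCommGroup V] [Module k V]
    {v : V} (hv : v ≠ 0) : Function.Injective (fun m : M => m ⊗ₜ[k] v) := by
  obtain ⟨φ, hφ⟩ := Module.Projective.exists_dual_ne_zero k hv
  intro x y h
  have h' := congrArg (TensorProduct.rid k M ∘ φ.lTensor M) h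
  simp only [Function.comp_apply, LinearMap.lTensor_tmul, TensorProduct.rid_tmul] at h'
  exact smul_right_injective M hφ h'

/-- Concatenating with one fixed nonzero `v` in `Ā` is already injective. -/
lemma theta_injective [Nontrivial (RedAlg k A)] (p n : ℕ) :
    Function.Injective (theta k A p n) := by
  obtain ⟨v, hv⟩ := exists_ne (0 : RedAlg k A)
  intro f g h
  refine LinearMap.ext fun t => tmul_left_injective hv ((formsCat k A p).injective ?_)
  simp only [← theta_snoc, h]

lemma thetaD_injective [Nontrivial (RedAlg k A)] (p : ℕ) (m : ℤ) :
    Function.Injective (thetaD k A p m) := by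
  intro f g h
  funext ⟨n, hn⟩
  exact theta_injective p n (congrFun h ⟨n + 1, by push_cast; omega⟩)

lemma embed_injective (M : Type w) [AddCommGroup M] [Module k M] (p n : ℕ) (m : ℤ)
    (h : (n : ℤ) = m + p) : Function.Injective (embed k A M p n m h) := by
  intro f g hfg
  rw [← embed_apply k A M p n m h f, hfg, embed_apply]

lemma exists_eq_embed {M : Type w} [AddCommGroup M] [Module k M] {p n : ℕ} {m : ℤ}
    (h : (n : ℤ) = m + p) (x : CochainSpace k A M p m) : ∃ f, x = embed k A M p n m h f := by
  refine ⟨x ⟨n, h⟩, ?_⟩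
  funext ⟨n', h'⟩
  obtain rfl : n' = n := by omega
  rw [embed_apply]

lemma toFormsZero_bijective : Function.Bijective (toFormsZero k A) := by
  have h : ∀ a, TensorProduct.rid k A ((redPowZero k A).toLinearMap.lTensor A
      (toFormsZero k A a : A ⊗[k] RedPow k A 0)) = a := by
    intro a
    change redPowZero k A ((redPowZero k A).symm 1) • a = a
    rw [LinearEquiv.apply_symm_apply, one_smul]
  have h' : ∀ ω : Forms k A 0, toFormsZero k A (TensorProduct.rid k A
      ((redPowZero k A).toLinearMap.lTensor A (ω : A ⊗[k] RedPow k A 0))) = ω := by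
    intro ω
    refine LinearMap.congr_fun (f := toFormsZero k A ∘ₗ (TensorProduct.rid k A).toLinearMap ∘ₗ
      (redPowZero k A).toLinearMap.lTensor A) (g := LinearMap.id) (forms_ext fun a t => ?_) ω
    change (redPowZero k A t • a) ⊗ₜ[k] (redPowZero k A).symm 1 = a ⊗ₜ[k] t
    rw [TensorProduct.smul_tmul, ← map_smul, smul_eq_mul, mul_one, LinearEquiv.symm_apply_apply]
  exact ⟨fun a b hab => (h a).symm.trans (Eq.trans (congrArg (fun ω : A ⊗[k] RedPow k A 0 =>
    TensorProduct.rid k A ((redPowZero k A).toLinearMap.lTensor A ω)) hab) (h b)),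
    fun ω => ⟨_, h' ω⟩⟩

lemma iotaPos_injective (n : ℕ) : Function.Injective (iotaPos k A n) :=
  (embed_injective _ 0 n _ _).comp fun _ _ h =>
    LinearMap.ext fun t => toFormsZero_bijective.1 (LinearMap.congr_fun h t)

lemma exists_iotaPos_eq {n : ℕ} (x : CochainSpace k A (Forms k A 0) 0 (Int.ofNat n)) :
    ∃ f, iotaPos k A n f = x := by
  obtain ⟨f, rfl⟩ := exists_eq_embed (n := n) (by simp) x
  let e := LinearEquiv.ofBijective _ (toFormsZero_bijective (k := k) (A := A))
  refine ⟨e.symm.toLinearMap ∘ₗ f, congrArg (embed k A (Forms k A 0) 0 n (Int.ofNat n) (by simp))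
    (LinearMap.ext fun t => ?_)⟩
  exact e.apply_symm_apply _

/-- If `Ā ≠ 0`, then `A^∨` embeds into `A ⊗ Ā`. -/
lemma dual_red_injective [Nontrivial (RedAlg k A)] :
    Function.Injective ((red k A).lTensor A ∘ₗ dualIncl k A) := by
  rw [injective_iff_map_eq_zero]
  intro z hz
  let z' : Outer k A A := dualIncl k A z
  obtain ⟨v, hv⟩ := exists_ne (0 : RedAlg k A)
  obtain ⟨a, rfl⟩ := Submodule.mkQ_surjective _ v
  obtain ⟨χ, hχ⟩ := Module.Projective.exists_dual_ne_zero k hv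
  -- The aim is that every functional contracts `z'` to zero. Those vanishing at `1` factor through
  -- `Ā`, where the image of `z` is zero.
  have hzero : ∀ χ : Module.Dual k (RedAlg k A), contract A (χ ∘ₗ red k A) z' = 0 := by
    intro χ
    have h := LinearMap.congr_fun (f := contract A (χ ∘ₗ red k A))
      (g := (TensorProduct.rid k A).toLinearMap ∘ₗ χ.lTensor A ∘ₗ (red k A).lTensor A)
      (outer_ext fun m b => rfl) z'
    refine h.trans ?_
    refine (congrArg ((TensorProduct.rid k A).toLinearMap ∘ₗ χ.lTensor A) hz).trans (map_zero _)
  have hone : ∀ φ : Module.Dual k A, φ 1 = 0 → contract A φ z' = 0 := by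
    intro φ hφ
    have h : φ = (Submodule.liftQ _ φ (by
        rw [Submodule.span_singleton_le_iff_mem, LinearMap.mem_ker, hφ])) ∘ₗ red k A := rfl
    rw [h]
    exact hzero _
  have hz' : a • z' = MulOpposite.op a • z' := by
    refine (dualIncl_mem k A z a).trans ?_
    exact LinearMap.congr_fun (f := (LinearMap.mulRight k a).lTensor A) (g := outerRight k A A a)
      (outer_ext fun m b => rfl) z'
  -- A functional not vanishing at `1`: its value there is `χ(ā) ≠ 0`. By centrality, contracting
  -- with it equals `a` times the contraction with `χ ∘ red`, hence zero.
  set ψ : Module.Dual k A := (χ ∘ₗ red k A) ∘ₗ LinearMap.mulRight k a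
  have hψ : contract A ψ z' = 0 := by
    rw [← contract_op_smul, ← hz', contract_smul, hzero, smul_zero]
  have hψ1 : ψ 1 ≠ 0 := by
    have : χ (red k A a) ≠ 0 := hχ
    simpa [ψ] using this
  refine dualIncl_injective k A ?_
  rw [map_zero]
  refine eq_of_contract_eq A (x := z') (y := 0) fun φ => ?_
  -- Functionals vanishing at `1` together with `ψ` span the dual.
  have h : φ = (φ - (φ 1 / ψ 1) • ψ) + (φ 1 / ψ 1) • ψ := by abel
  rw [map_zero, h, contract_add, LinearMap.add_apply, hone, contract_const_smul,
    LinearMap.smul_apply, hψ, smul_zero, add_zero]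
  simp [hψ1]

/-- Up to reordering factors this is the embedding of `A^∨` into `A ⊗ Ā` tensored with the flat
module `Ā^{⊗n}`. -/
lemma iotaNeg_injective [Nontrivial (RedAlg k A)] (n : ℕ) :
    Function.Injective (iotaNeg k A n) := by
  have : Module.Free k (RedPow k A n) :=
    Module.Free.of_basis
      (Basis.piTensorProduct fun _ : Fin n => Module.Basis.ofVectorSpace k (RedAlg k A))
  have h1 : (red k A).lTensor (Forms k A n) ∘ₗ interchange k A n =
      (TensorProduct.rightComm k A (RedAlg k A) (RedPow k A n)).toLinearMap ∘ₗ
        ((red k A).lTensor A).rTensor (RedPow k A n) :=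
    TensorProduct.ext_threefold fun x y t => rfl
  have h2 := Module.Flat.rTensor_preserves_injective_linearMap (M := RedPow k A n) _
    (dual_red_injective (k := k) (A := A))
  rw [LinearMap.rTensor_comp] at h2
  have h3 : ∀ w, iotaNeg k A n w = formsCat k A n
      (TensorProduct.rightComm k A (RedAlg k A) (RedPow k A n)
        ((((red k A).lTensor A).rTensor (RedPow k A n) ∘ₗ (dualIncl k A).rTensor _) w)) :=
    fun w => congrArg (formsCat k A n)
      (LinearMap.congr_fun h1 ((dualIncl k A).rTensor (RedPow k A n) w))
  intro x y hxy
  rw [h3, h3] at hxy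
  exact h2 ((TensorProduct.rightComm k A _ _).injective ((formsCat k A n).injective hxy))

lemma iotaNegSucc_injective [Nontrivial (RedAlg k A)] (n : ℕ) :
    Function.Injective (iotaNegSucc k A n) :=
  (embed_injective _ _ _ _ _).comp (const_injective.comp (iotaNeg_injective n))

end Injective

/-! ### Elements of the singular complex and their representatives at finite levels. -/

section Singular

variable (k : Type u) (A : Type v) [Field k] [Ring A] [Algebra k A]

/-- The structure maps of the colimit `C_sg^*(A, A)`. -/
noncomputable def toSg (p : ℕ) (m : ℤ) :
    CochainSpace k A (Forms k A p) p m →ₗ[k] (singularHochschild k A).X m :=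
  ((toSingular k A p).f m).hom

/-- The differential of `C_sg^*(A, A)`. -/
noncomputable def sgD (m : ℤ) :
    (singularHochschild k A).X m →ₗ[k] (singularHochschild k A).X (m + 1) :=
  ((singularHochschild k A).d m (m + 1)).hom

/-- The differential of `𝒟^*(A, A)`. -/
noncomputable def tateD (m : ℤ) :
    (tateHochschild k A).X m →ₗ[k] (tateHochschild k A).X (m + 1) :=
  ((tateHochschild k A).d m (m + 1)).hom

/-- The map `ι^m`. -/
noncomputable def iotaMap (m : ℤ) :
    (tateHochschild k A).X m →ₗ[k] (singularHochschild k A).X m :=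
  ((iota k A).f m).hom

variable {k A}

lemma toSg_thetaD (p : ℕ) (m : ℤ) (x : CochainSpace k A (Forms k A p) p m) :
    toSg k A (p + 1) m (thetaD k A p m x) = toSg k A p m x :=
  ConcreteCategory.congr_hom
    (congrArg (fun f => HomologicalComplex.Hom.f f m) (theta_toSingular k A p)) x

lemma sgD_toSg (p : ℕ) (m : ℤ) (x : CochainSpace k A (Forms k A p) p m) :
    sgD k A m (toSg k A p m x) = toSg k A p (m + 1) (cochainD k A (Forms k A p) p m x) := by
  have h := ConcreteCategory.congr_hom ((toSingular k A p).comm m (m + 1)) x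
  rw [gradedHochschildCochains_d] at h
  exact h

lemma exists_toSg_eq (m : ℤ) (y : (singularHochschild k A).X m) :
    ∃ p x, toSg k A p m x = y := colimit_exists_rep (thetaHom k A) m y

lemma toSg_injective [Nontrivial (RedAlg k A)] (p : ℕ) (m : ℤ) :
    Function.Injective (toSg k A p m) :=
  colimit_ι_injective (thetaHom k A) (fun p m => thetaD_injective p m) p m

lemma exists_toSg_eq_of_le (m : ℤ) (y : (singularHochschild k A).X m) (p : ℕ) :
    ∃ q x, toSg k A (p + q) m x = y := by
  suffices h : ∃ r x, p ≤ r ∧ toSg k A r m x = y by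
    obtain ⟨r, x, hr, hx⟩ := h
    obtain ⟨q, rfl⟩ := Nat.exists_eq_add_of_le hr
    exact ⟨q, x, hx⟩
  induction p with
  | zero =>
    obtain ⟨p, x, hx⟩ := exists_toSg_eq m y
    exact ⟨p, x, Nat.zero_le _, hx⟩
  | succ p ih =>
    obtain ⟨r, x, hr, hx⟩ := ih
    exact ⟨r + 1, thetaD k A r m x, by omega, by rw [toSg_thetaD, hx]⟩

lemma iotaMap_tateD (m : ℤ) (x : (tateHochschild k A).X m) :
    iotaMap k A (m + 1) (tateD k A m x) = sgD k A m (iotaMap k A m x) :=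
  (ConcreteCategory.congr_hom ((iota k A).comm m (m + 1)) x).symm

lemma sgD_sgD (m : ℤ) (y : (singularHochschild k A).X m) : sgD k A (m + 1) (sgD k A m y) = 0 :=
  ConcreteCategory.congr_hom ((singularHochschild k A).d_comp_d m (m + 1) (m + 1 + 1)) y

lemma iotaMap_injective [Nontrivial (RedAlg k A)] (m : ℤ) : Function.Injective (iotaMap k A m) := by
  match m with
  | Int.ofNat n => exact (toSg_injective 0 _).comp (iotaPos_injective n)
  | Int.negSucc n => exact (toSg_injective (n + 1) _).comp (iotaNegSucc_injective n)

end Singular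

/-! ### Comparison of cohomology when `A` is self-injective. -/

section Comparison

variable {k : Type u} {A : Type v} [Field k] [Ring A] [Algebra k A]

lemma embed_zero (M : Type w) [AddCommGroup M] [Module k M] (p n : ℕ) (m : ℤ)
    (h : (n : ℤ) = m + p) : embed k A M p n m h 0 = 0 := map_zero _

lemma coboundary_eq_zero_of_cochainD {M : Type w} [AddCommGroup M] [Module k M] [Module A M]
    [IsScalarTower k A M] [Module Aᵐᵒᵖ M] [IsScalarTower k Aᵐᵒᵖ M] [SMulCommClass A Aᵐᵒᵖ M]
    {p n : ℕ} {m : ℤ} (h : (n : ℤ) = m + p) (f : RedPow k A n →ₗ[k] M)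
    (hf : cochainD k A M p m (embed k A M p n m h f) = 0) : coboundary k A M n f = 0 := by
  rw [cochainD_embed, smul_eq_zero_iff_right (zpow_ne_zero _ (by simp))] at hf
  exact embed_injective M p (n + 1) (m + 1) _ (hf.trans (embed_zero M p (n + 1) (m + 1) _).symm)

lemma embed_coboundary {M : Type w} [AddCommGroup M] [Module k M] [Module A M]
    [IsScalarTower k A M] [Module Aᵐᵒᵖ M] [IsScalarTower k Aᵐᵒᵖ M] [SMulCommClass A Aᵐᵒᵖ M]
    {p n : ℕ} {m : ℤ} (h : (n : ℤ) = m + p) (h' : ((n + 1 : ℕ) : ℤ) = m + 1 + p)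
    (f : RedPow k A n →ₗ[k] M) :
    embed k A M p (n + 1) (m + 1) h' (coboundary k A M n f) =
      cochainD k A M p m (embed k A M p n m h ((-1 : k) ^ (m + 1) • f)) := by
  rw [map_smul, map_smul, cochainD_embed, smul_smul, ← mul_zpow]
  simp

/-- The commutator of `∑ ωⱼ ⊗ ȳⱼ` with `b` is `(∑ ωⱼ yⱼ) ⊗ b̄`. This form treats `μ` and the
Hochschild boundary uniformly in `p`. -/
lemma coboundary_const_iotaNeg (p : ℕ) (w : Dual k A ⊗[k] RedPow k A p) :
    coboundary k A (Forms k A (p + 1)) 0 (const k A _ (iotaNeg k A p w)) =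
      theta k A p 0 (const k A _ (actMap k A p (spread k A p w))) := by
  apply ext_snoc
  intro t b
  rw [coboundary_const, iota_smul_sub, theta_snoc, const_apply, ← TensorProduct.smul_tmul',
    map_smul]

section SelfInjective

variable [FiniteDimensional k A] [Module.Injective A A]

/-- Every cocycle of `C_sg^*(A, A)` is cohomologous to one in the image of `ι`. -/
lemma exists_iotaMap_add_sgD (p : ℕ) (i : ℤ) (x : CochainSpace k A (Forms k A p) p (i + 1))
    (hx : cochainD k A (Forms k A p) p (i + 1) x = 0) :
    ∃ y z, toSg k A p (i + 1) x = iotaMap k A (i + 1) y + sgD k A i z := by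
  by_cases hneg : i + 1 + p < 0
  · refine ⟨0, 0, ?_⟩
    have : x = 0 := by
      funext ⟨n, hn⟩
      omega
    rw [this]
    simp only [map_zero, add_zero]
  obtain ⟨n, hn⟩ := Int.eq_ofNat_of_zero_le (not_lt.1 hneg)
  have hn' : (n : ℤ) = i + 1 + p := hn.symm
  induction p generalizing n with
  | zero =>
    -- The degree is abstracted so that it can be replaced by a constructor of `ℤ`, on which `ι`
    -- reduces definitionally.
    obtain ⟨m, hm⟩ : ∃ m, m = i + 1 := ⟨_, rfl⟩
    have key : ∀ x : CochainSpace k A (Forms k A 0) 0 m, ∃ y, toSg k A 0 m x = iotaMap k A m y := by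
      obtain rfl : m = Int.ofNat n := by simpa [hm] using hn
      intro x
      obtain ⟨f, rfl⟩ := exists_iotaPos_eq x
      exact ⟨f, rfl⟩
    subst hm
    obtain ⟨y, hy⟩ := key x
    exact ⟨y, 0, by rw [hy, map_zero, add_zero]⟩
  | succ p ih =>
    obtain ⟨g, rfl⟩ := exists_eq_embed hn' x
    have hg := coboundary_eq_zero_of_cochainD hn' g hx
    cases n with
    | zero =>
      obtain ⟨ω, rfl⟩ := exists_eq_const g
      -- No arguments remain: the cocycle is a central element of `Ω^{p+1}(A)`, hence already in the
      -- image of `ι`.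
      obtain ⟨w, rfl, -⟩ := exists_iotaNeg_eq ω ((coboundary_const_eq_zero_iff ω).1 hg)
      obtain ⟨m, hm⟩ : ∃ m, m = i + 1 := ⟨_, rfl⟩
      have key : ∀ h : ((0 : ℕ) : ℤ) = m + (p + 1 : ℕ), ∃ y, toSg k A (p + 1) m
          (embed k A _ (p + 1) 0 m h (const k A _ (iotaNeg k A p w))) = iotaMap k A m y := by
        obtain rfl : m = Int.negSucc p := by
          rw [Int.negSucc_eq]
          push_cast at hn'
          omega
        exact fun h => ⟨w, rfl⟩
      subst hm
      obtain ⟨y, hy⟩ := key hn'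
      exact ⟨y, 0, by rw [hy, map_zero, add_zero]⟩
    | succ n =>
      -- Up to a coboundary the class descends one level, where `f` and `θ f` represent the same
      -- element of the colimit.
      obtain ⟨f, h, hf, rfl⟩ := exists_theta_add_coboundary g hg
      have e1 : (n : ℤ) = i + 1 + p := by push_cast at hn'; omega
      have e2 : (n : ℤ) = i + (p + 1 : ℕ) := by push_cast at hn' ⊢; omega
      obtain ⟨y, z, hyz⟩ := ih (embed k A _ p n (i + 1) e1 f)
        (by rw [cochainD_embed, hf, map_zero, smul_zero]) (by omega) n e1.symm e1
      refine ⟨y, z + toSg k A (p + 1) i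
        (embed k A _ (p + 1) n i e2 ((-1 : k) ^ (i + 1) • h)), ?_⟩
      rw [map_add, map_add, map_add, sgD_toSg, embed_coboundary e2, ← add_assoc, ← hyz,
        ← toSg_thetaD p, thetaD_embed]

variable [Nontrivial (RedAlg k A)]

/-- A cocycle of `C^*(A, Ω^p(A))` with at least one argument that becomes a coboundary in
`C_sg^*(A, A)` is a coboundary. -/
lemma exists_cochainD_eq {r q p n : ℕ} (hr : r = p + q) {i : ℤ} (hn : (n : ℤ) = i + p)
    (x : CochainSpace k A (Forms k A p) p (i + 1))
    (hx : cochainD k A (Forms k A p) p (i + 1) x = 0)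
    (z : CochainSpace k A (Forms k A r) r i)
    (hz : toSg k A p (i + 1) x = sgD k A i (toSg k A r i z)) :
    ∃ z', x = cochainD k A (Forms k A p) p i z' := by
  induction q generalizing p n with
  | zero =>
    subst hr
    rw [sgD_toSg] at hz
    exact ⟨z, toSg_injective _ _ hz⟩
  -- `q` is the height of the level of the primitive above that of `x`. The induction hypothesis is
  -- applied to `θ x`, and injectivity of `θ` on cohomology brings the primitive down.
  | succ q ih =>
    have e : ((n + 1 : ℕ) : ℤ) = i + 1 + p := by push_cast; omega
    have e' : ((n + 1 : ℕ) : ℤ) = i + (p + 1 : ℕ) := by push_cast; omega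
    obtain ⟨z', hz'⟩ := ih (p := p + 1) (n := n + 1) (by omega) e' (thetaD k A p (i + 1) x)
      (by rw [← LinearMap.comp_apply, ← thetaD_comm, LinearMap.comp_apply, hx, map_zero])
      (by rw [toSg_thetaD, hz])
    obtain ⟨f, rfl⟩ := exists_eq_embed e x
    obtain ⟨g, rfl⟩ := exists_eq_embed e' z'
    rw [thetaD_embed, cochainD_embed, ← map_smul, ← map_smul] at hz'
    obtain ⟨h, rfl⟩ := exists_eq_coboundary_of_theta f (coboundary_eq_zero_of_cochainD e f hx) _
      (embed_injective _ _ _ _ _ hz')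
    exact ⟨_, embed_coboundary hn e h⟩

/-- A cocycle of `C^*(A, Ω^p(A))` without arguments that becomes a coboundary in `C_sg^*(A, A)`
comes from `A^∨ ⊗ Ā^{⊗p}`. -/
lemma exists_embed_const_actMap_eq {p : ℕ} {i : ℤ} (hi : ((0 : ℕ) : ℤ) = i + 1 + p)
    (x : CochainSpace k A (Forms k A p) p (i + 1))
    (hx : cochainD k A (Forms k A p) p (i + 1) x = 0)
    (z : (singularHochschild k A).X i) (hz : toSg k A p (i + 1) x = sgD k A i z) :
    ∃ w, x = embed k A _ p 0 (i + 1) hi (const k A _ (actMap k A p (spread k A p w))) := by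
  -- The primitive is taken at level at least `p + 1`: there `θ x` has one argument, so it can be
  -- descended to that level but no further.
  obtain ⟨q, z, rfl⟩ := exists_toSg_eq_of_le i z (p + 1)
  have e : ((0 : ℕ) : ℤ) = i + (p + 1 : ℕ) := by push_cast at hi ⊢; omega
  obtain ⟨z', hz'⟩ := exists_cochainD_eq (p := p + 1) rfl e (thetaD k A p (i + 1) x)
    (by rw [← LinearMap.comp_apply, ← thetaD_comm, LinearMap.comp_apply, hx, map_zero]) z
    (by rw [toSg_thetaD, hz])
  obtain ⟨f, rfl⟩ := exists_eq_embed hi x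
  obtain ⟨g, rfl⟩ := exists_eq_embed e z'
  rw [thetaD_embed, cochainD_embed, ← map_smul, ← map_smul] at hz'
  obtain ⟨w, rfl⟩ := exists_const_actMap_eq f (coboundary_eq_zero_of_cochainD hi f hx) _
    (embed_injective _ _ _ _ _ hz')
  exact ⟨w, rfl⟩

/-- An element of `𝒟^*(A, A)` whose image under `ι` comes from a cochain without arguments and is
a coboundary is a coboundary. -/
lemma exists_tateD_eq_of_nonpos (p : ℕ) (i : ℤ) (hi : ((0 : ℕ) : ℤ) = i + 1 + p)
    (y : (tateHochschild k A).X (i + 1)) (hy : tateD k A (i + 1) y = 0)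
    (x : CochainSpace k A (Forms k A p) p (i + 1))
    (hx : iotaMap k A (i + 1) y = toSg k A p (i + 1) x) (z : (singularHochschild k A).X i)
    (hz : iotaMap k A (i + 1) y = sgD k A i z) : ∃ w, y = tateD k A i w := by
  obtain ⟨w, rfl⟩ := exists_embed_const_actMap_eq hi x (toSg_injective _ _ (by
    rw [← sgD_toSg, ← hx, ← iotaMap_tateD, hy, map_zero, map_zero])) z (hx.symm.trans hz)
  obtain rfl : i = Int.negSucc p := by
    rw [Int.negSucc_eq]
    push_cast at hi
    omega
  -- It suffices to compare images under the injective `ι`. There the differential of `w` is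
  -- represented by `± θ x`; the scalar is the sign in `cochainD`.
  refine ⟨(-1 : k) ^ (Int.negSucc p + 1) • (show (tateHochschild k A).X (Int.negSucc p) from w),
    iotaMap_injective _ ?_⟩
  have e : ((0 : ℕ) : ℤ) = Int.negSucc p + (p + 1 : ℕ) := by
    rw [Int.negSucc_eq]
    push_cast
    omega
  have h : iotaMap k A (Int.negSucc p) w = toSg k A (p + 1) (Int.negSucc p)
    (embed k A _ (p + 1) 0 _ e (const k A _ (iotaNeg k A p w))) := rfl
  have h2 : sgD k A (Int.negSucc p) (iotaMap k A (Int.negSucc p) w) =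
      (-1 : k) ^ (Int.negSucc p + 1) • iotaMap k A (Int.negSucc p + 1) y := by
    rw [h, sgD_toSg, cochainD_embed, coboundary_const_iotaNeg, map_smul, hx, ← toSg_thetaD p,
      thetaD_embed]
  have h3 : (-1 : k) ^ (Int.negSucc p + 1) * (-1 : k) ^ (Int.negSucc p + 1) = 1 := by
    rw [← mul_zpow]
    simp
  rw [map_smul, map_smul, iotaMap_tateD]
  refine Eq.trans ?_ (congrArg (fun v => (-1 : k) ^ (Int.negSucc p + 1) • v) h2.symm)
  rw [smul_smul, h3, one_smul]

/-- A cocycle of `𝒟^*(A, A)` whose image under `ι` is a coboundary is a coboundary. -/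
lemma exists_tateD_eq (i : ℤ) (y : (tateHochschild k A).X (i + 1)) (hy : tateD k A (i + 1) y = 0)
    (z : (singularHochschild k A).X i) (hz : iotaMap k A (i + 1) y = sgD k A i z) :
    ∃ w, y = tateD k A i w := by
  match i with
  | Int.ofNat n =>
    let x := iotaPos k A (n + 1) y
    have hx : iotaMap k A (Int.ofNat n + 1) y = toSg k A 0 (Int.ofNat n + 1) x := rfl
    obtain ⟨q, z, rfl⟩ := exists_toSg_eq_of_le _ z 0
    obtain ⟨z', hz'⟩ := exists_cochainD_eq (p := 0) rfl (i := Int.ofNat n) (n := n) (by simp) x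
      (toSg_injective _ _ (by
        rw [← sgD_toSg, ← hx, ← iotaMap_tateD, hy, map_zero, map_zero])) z (hx.symm.trans hz)
    obtain ⟨w, rfl⟩ := exists_iotaPos_eq z'
    refine ⟨w, iotaMap_injective _ ?_⟩
    refine hx.trans (Eq.trans ?_ (iotaMap_tateD (Int.ofNat n) w).symm)
    rw [hz']
    exact (sgD_toSg 0 _ _).symm
  | Int.negSucc 0 =>
    exact exists_tateD_eq_of_nonpos 0 _ (by simp) y hy (iotaPos k A 0 y) rfl z hz
  | Int.negSucc (p + 1) =>
    exact exists_tateD_eq_of_nonpos (p + 1) _ (by rw [Int.negSucc_eq]; push_cast; omega) y hy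
      (iotaNegSucc k A p y) rfl z hz

lemma quasiIso_iota_of_nontrivial : QuasiIso (iota k A) := by
  refine quasiIso_of_elements _ (fun i y hy => ?_) (fun i x hx z hz => exists_tateD_eq i x hx z hz)
  obtain ⟨p, x, rfl⟩ := exists_toSg_eq _ y
  have hy' : sgD k A (i + 1) (toSg k A p (i + 1) x) = 0 := hy
  obtain ⟨y, z, h⟩ := exists_iotaMap_add_sgD p i x (toSg_injective _ _ (by
    rw [← sgD_toSg, hy', map_zero]))
  -- The element `y` is a cocycle because `ι` of its differential vanishes and `ι` is injective.
  refine ⟨y, iotaMap_injective _ ?_, z, h⟩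
  refine (iotaMap_tateD (i + 1) y).trans ?_
  rw [map_zero, ← hy', h, map_add, sgD_sgD, add_zero]

end SelfInjective

end Comparison

/-! ### The degenerate case `Ā = 0`. -/

section TrivialReduction

variable {k : Type u} {A : Type v} [Field k] [Ring A] [Algebra k A] [Subsingleton (RedAlg k A)]

lemma subsingleton_redPow (n : ℕ) : Subsingleton (RedPow k A (n + 1)) := by
  refine ⟨fun x y => ?_⟩
  have := (snocEquiv k A n).symm.injective.subsingleton
  exact Subsingleton.elim x y

/-- Each element can be pushed one level up. The result is zero: either it takes at least one
argument from `Ā = 0`, or it has none and `θ` produces only cochains with arguments. -/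
lemma subsingleton_singularHochschild (m : ℤ) : Subsingleton ((singularHochschild k A).X m) := by
  suffices h : ∀ y : (singularHochschild k A).X m, y = 0 from ⟨fun x y => (h x).trans (h y).symm⟩
  intro y
  obtain ⟨p, x, rfl⟩ := exists_toSg_eq m y
  rw [← toSg_thetaD]
  have : thetaD k A p m x = 0 := by
    funext ⟨n, hn⟩
    cases n with
    | zero => rfl
    | succ n =>
      have := subsingleton_redPow (k := k) (A := A) n
      exact Subsingleton.elim (α := RedPow k A (n + 1) →ₗ[k] Forms k A (p + 1)) _ _
  rw [this, map_zero]

lemma exists_smul_one_eq (a : A) : ∃ c : k, c • (1 : A) = a := by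
  have : a ∈ Submodule.span k {(1 : A)} :=
    (Submodule.Quotient.mk_eq_zero _).1 (Subsingleton.elim (red k A a) 0)
  exact Submodule.mem_span_singleton.1 this

/-- Since `A` is spanned by `1`, each tensor in `A ⊗ A` is its product tensored with `1`, and `1 ⊗
1` is central. -/
lemma mu_bijective : Function.Bijective (mu k A) := by
  have h1 : ∀ z : A ⊗[k] A, LinearMap.mul' k A z ⊗ₜ[k] (1 : A) = z := by
    intro z
    refine LinearMap.congr_fun (f := (TensorProduct.mk k A A).flip 1 ∘ₗ LinearMap.mul' k A)
      (g := LinearMap.id) (TensorProduct.ext' fun a b => ?_) z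
    obtain ⟨c, rfl⟩ := exists_smul_one_eq (k := k) b
    simp [TensorProduct.smul_tmul']
  constructor
  · intro x y h
    apply dualIncl_injective
    rw [← h1 (dualIncl k A x), ← h1 (dualIncl k A y)]
    exact congrArg (fun a : A => a ⊗ₜ[k] (1 : A)) h
  · intro a
    obtain ⟨c, rfl⟩ := exists_smul_one_eq (k := k) a
    let z : Dual k A := ⟨(1 : A) ⊗ₜ[k] (1 : A), fun b => by
      obtain ⟨c, rfl⟩ := exists_smul_one_eq (k := k) b
      simp [TensorProduct.smul_tmul']⟩
    refine ⟨c • z, ?_⟩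
    rw [map_smul]
    congr 1
    change (1 : A) * 1 = 1
    rw [mul_one]

lemma muZero_bijective : Function.Bijective (muZero k A) := by
  let e : Dual k A ⊗[k] RedPow k A 0 ≃ₗ[k] Dual k A :=
    (redPowZero k A).lTensor (Dual k A) ≪≫ₗ TensorProduct.rid k (Dual k A)
  have hconst : Function.Bijective (const k A A) :=
    ⟨const_injective, fun f => (exists_eq_const f).imp fun _ h => h.symm⟩
  exact hconst.comp (mu_bijective.comp e.bijective)

/-- If `Ā = 0`, then `𝒟^*(A, A)` is acyclic. -/
lemma exists_tateD_eq_of_subsingleton (i : ℤ) (y : (tateHochschild k A).X (i + 1))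
    (hy : tateD k A (i + 1) y = 0) : ∃ w, y = tateD k A i w := by
  match i with
  | Int.ofNat n =>
    have := subsingleton_redPow (k := k) (A := A) n
    exact ⟨0, Subsingleton.elim (α := RedPow k A (n + 1) →ₗ[k] A) _ _⟩
  | Int.negSucc 0 =>
    obtain ⟨w, hw⟩ := muZero_bijective.2 (y : RedPow k A 0 →ₗ[k] A)
    exact ⟨w, hw.symm⟩
  -- In degree `-1` a cocycle lies in the kernel of `μ`, so it is zero; in degree `0` above,
  -- surjectivity of `μ` was used. All other terms of the complex vanish.
  | Int.negSucc 1 =>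
    exact ⟨0, (muZero_bijective.1 (hy.trans (map_zero (muZero k A)).symm)).trans
      (map_zero (tateD k A (Int.negSucc 1))).symm⟩
  | Int.negSucc (n + 2) =>
    have := subsingleton_redPow (k := k) (A := A) n
    have : Subsingleton (Dual k A ⊗[k] RedPow k A (n + 1)) := inferInstance
    exact ⟨0, Subsingleton.elim (α := Dual k A ⊗[k] RedPow k A (n + 1)) _ _⟩

lemma quasiIso_iota_of_subsingleton : QuasiIso (iota k A) := by
  refine quasiIso_of_elements _ (fun i y _ => ?_)
    (fun i x hx _ _ => exists_tateD_eq_of_subsingleton i x hx)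
  have := subsingleton_singularHochschild (k := k) (A := A) (i + 1)
  exact ⟨0, map_zero _, 0, Subsingleton.elim _ _⟩

/-- A nonzero algebra spanned by `1` has dimension one. -/
lemma subsingleton_of_finrank_ne_one (h : Module.finrank k A ≠ 1) : Subsingleton A := by
  by_contra hA
  rw [not_subsingleton_iff_nontrivial] at hA
  exact h (finrank_eq_one (1 : A) one_ne_zero fun a => exists_smul_one_eq a)

lemma iotaMap_injective_of_subsingleton [Subsingleton A] (m : ℤ) :
    Function.Injective (iotaMap k A m) := by
  match m with
  | Int.ofNat n =>
    have : Subsingleton (RedPow k A n →ₗ[k] A) := inferInstance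
    exact fun x y _ => Subsingleton.elim (α := RedPow k A n →ₗ[k] A) x y
  | Int.negSucc n =>
    have : Subsingleton (Dual k A) := (mu_bijective (k := k) (A := A)).1.subsingleton
    have : Subsingleton (Dual k A ⊗[k] RedPow k A n) := inferInstance
    exact fun x y _ => Subsingleton.elim (α := Dual k A ⊗[k] RedPow k A n) x y

end TrivialReduction

end TateHochschild

theorem proposition6p4 (k : Type*) [Field k] (A : Type*) [Ring A] [Algebra k A]
    [FiniteDimensional k A] [Module.Injective A A] :
    QuasiIso (TateHochschild.iota k A) ∧
      (Module.finrank k A ≠ 1 →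
        ∀ i : ℤ, Function.Injective ((TateHochschild.iota k A).f i)) := by
  rcases subsingleton_or_nontrivial (TateHochschild.RedAlg k A) with h | h
  · refine ⟨TateHochschild.quasiIso_iota_of_subsingleton, fun hA i => ?_⟩
    have := TateHochschild.subsingleton_of_finrank_ne_one hA
    exact TateHochschild.iotaMap_injective_of_subsingleton i
  · exact ⟨TateHochschild.quasiIso_iota_of_nontrivial,
      fun _ i => TateHochschild.iotaMap_injective i⟩
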